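/- **The architecture.** Consider the following discrete-time optical set-up with a single spin emitter (an atom, i.e. one qubit, initially in $|0\rangle$). A photonic qubit is dual-rail encoded: $|b\rangle$ is one photon in mode $b\in\{0,1\}$ of a pair of bosonic modes. Linear-optical components act on Fock space (phase shifters, and beam splitters with the Hadamard matrix), and detectors are photon-number resolving. At each time step $t$: 1. If an input qubit is due, it is handed to the atom in exchange for the atom's previous content, which is not used again. 2. A chosen single-qubit unitary $u_t$ is applied to the atom, and the atom emits a photon via $|b\rangle\mapsto|b\rangle\otimes|b\rangle$. 3. A router sends the photon into a delay line of chosen length $\sigma_t$. A second router $\rho_t$ connects chosen delay-line ends to the two inputs of a fusion module and to the input of a correction module. Photons leaving unconnected line ends are discarded. 4. The repeat-until-success (RUS) fusion module is of chosen kind $X$ or $Y$. Put $\theta=0$ for $X$ and $\theta=\pi/2$ for $Y$. If no fusion has succeeded since the last (chosen) restart of the module, each of its two inputs undergoes a $Z$-rotation by $\theta$ and a Hadamard. Then rail $1$ of the first and rail $0$ of the second input meet on a beam splitter and are detected, and the remaining pair (rail $0$ of the first, rail $1$ of the second input) is measured in the basis $(|0\rangle\pm e^{-i\theta}|1\rangle)/\sqrt2$.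 The fusion succeeds if the first two detectors together count an odd number of photons. Once a fusion has succeeded, the two inputs are instead measured separately in the basis $(|0\rangle\pm e^{-i\theta}|1\rangle)/\sqrt2$. 5. The correction module applies $X^{x_t}Z^{z_t}$ up to order and phase, where $x_t,z_t\in\{0,1\}$ are chosen functions of all outcomes observed at earlier time steps. The photon is then either measured in a chosen plane $\lambda_t\in\{XY,XZ,YZ\}$ at a chosen angle $\alpha_t$, or released as an output. All choices except the corrections (that is, the number of time steps, the times at which the inputs enter and the outputs leave, $u,\sigma,\rho$, the fusion kinds and restarts, $\lambda,\alpha$) are fixed in advance. Inputs enter and outputs leave one after the other in their natural order. Together with the feed-forward functions $x,z$, these choices are called the *settings*. For an isometry $V:(\mathbb C^2)^{\otimes m}\to(\mathbb C^2)^{\otimes n}$, settings with $m$ inputs and $n$ outputs *implement $V$ with probability greater than $p$* if there is a finite set $S$ of measurement records of the complete run such that * for every $h\in S$ there is a vector $R_h$ of all the degrees of freedom other than the output wires (atom, exchanged qubits, photons remaining in delay lines or discarded) such that, for every input $\psi$, the unnormalised final state in branch $h$ is $R_h\otimes \mathrm{enc}(V\psi)$, where $\mathrm{enc}$ is the dual-rail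 encoding on the $n$ output wires; in particular $R_h$ does not depend on $\psi$; * $\sum_{h\in S}\|R_h\|^2>p$. (This sum is the probability that the record lies in $S$, for every normalised input.) **Theorem.** Let $n\ge 0$, let $U$ be a unitary on $n$ qubits, and let $\varepsilon>0$. Then * (a) there are settings of the architecture with $n$ inputs and $n$ outputs that implement $U$ with probability greater than $1-\varepsilon$; * (b) there are settings without any external input that implement the preparation of the $n$-qubit state $U|0\cdots0\rangle$ with probability greater than $1-\varepsilon$. -/

import Mathlib

open scoped BigOperators

noncomputable section

namespace SpinOptical

/-! ### Dual-rail modes and Fock space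

The state of finitely many photons is written as a polynomial in the creation operators of the
modes applied to the vacuum: the monomial `∏ X_k ^ (m k)` is `√(∏ (m k)!)` times the normalised
occupation-number state `|m⟩`. -/

/-- The optical wires of the set-up; every wire is a pair of modes (rails `0` and `1`).
`src` is the output of the emitter, `line l j` is the place in the delay line of length `l` from
which the exit is reached after `j` more time steps, `fus 0` and `fus 1` are the inputs of the
fusion module, `meas` is the input of the correction module, `out t` is the output wire at time
step `t`, and `lost t l` is the beam dump for line `l` at time `t`. -/
inductive Wire where
  | src : Wire
  | line (l j : ℕ) : Wire
  | fus (i : Fin 2) : Wire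
  | meas : Wire
  | out (t : ℕ) : Wire
  | lost (t l : ℕ) : Wire
  deriving DecidableEq

/-- A bosonic mode: a wire together with one of its two rails. A qubit in the state `|b⟩` is
encoded on a wire by one photon in rail `b`. -/
abbrev Mode : Type := Wire × Fin 2

/-- Finite-photon-number vectors of the bosonic Fock space over all modes. -/
abbrev Fock : Type := MvPolynomial Mode ℂ

/-- The squared Fock norm, in which `X_k ^ n` has squared norm `n!`. -/
def fockNormSq (f : Fock) : ℝ :=
  ∑ m ∈ f.support, (∏ k ∈ m.support, ((m k).factorial : ℝ)) * ‖f.coeff m‖ ^ 2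

/-! ### Linear optical components -/

/-- Phase shifter of angle `θ` on the mode `k`. -/
def phaseShift (k : Mode) (θ : ℝ) : Fock →ₐ[ℂ] Fock :=
  MvPolynomial.bind₁ fun j =>
    if j = k then MvPolynomial.C (Complex.exp (θ * Complex.I)) * MvPolynomial.X j
    else MvPolynomial.X j

/-- Beam splitter on two distinct modes `k` and `l`, with the Hadamard matrix. -/
def beamSplitter (k l : Mode) : Fock →ₐ[ℂ] Fock :=
  MvPolynomial.bind₁ fun j =>
    if j = k then
      MvPolynomial.C ((1 / Real.sqrt 2 : ℝ) : ℂ) * (MvPolynomial.X k + MvPolynomial.X l)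
    else if j = l then
      MvPolynomial.C ((1 / Real.sqrt 2 : ℝ) : ℂ) * (MvPolynomial.X k - MvPolynomial.X l)
    else MvPolynomial.X j

/-- Redirecting wires, with both of their rails. -/
def rewire (g : Wire → Wire) : Fock →ₐ[ℂ] Fock :=
  MvPolynomial.rename fun k => (g k.1, k.2)

/-- The Kraus operator `⟨n|` of a number-resolving detector on the mode `k`. -/
def detect (k : Mode) (n : ℕ) (f : Fock) : Fock :=
  ∑ m ∈ f.support with m k = n,
    MvPolynomial.monomial (m.erase k) ((Real.sqrt (n.factorial : ℝ) : ℂ) * f.coeff m)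

/-- `Z`-rotation by `θ` of a dual-rail qubit. -/
def rotZ (w : Wire) (θ : ℝ) : Fock →ₐ[ℂ] Fock := phaseShift (w, 1) θ

/-- Hadamard gate on a dual-rail qubit. -/
def hadamard (w : Wire) : Fock →ₐ[ℂ] Fock := beamSplitter (w, 0) (w, 1)

/-- Correction module: `X ^ x` followed by `Z ^ z` on a dual-rail qubit. -/
def correct (w : Wire) (x z : Bool) : Fock →ₐ[ℂ] Fock :=
  (if z then rotZ w Real.pi else AlgHom.id ℂ Fock).comp
    (if x then MvPolynomial.rename (Equiv.swap ((w, 0) : Mode) (w, 1)) else AlgHom.id ℂ Fock)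

/-! ### Measurement and fusion -/

/-- Measurement planes of the Bloch sphere. -/
inductive Plane where
  | XY : Plane
  | XZ : Plane
  | YZ : Plane

/-- The two kinds of fusion. -/
inductive FusionKind where
  | X : FusionKind
  | Y : FusionKind

/-- The photon counts of all detectors at one time step: `a`, `b` for the modes `(fus 0, 1)` and
`(fus 1, 0)` (the detectors of the Type I fusion), `c`, `d` for the modes `(fus 0, 0)` and
`(fus 1, 1)`, and `m₀`, `m₁` for the two rails of `meas`. -/
structure Outcome where
  a : ℕ
  b : ℕ
  c : ℕ
  d : ℕ
  m₀ : ℕ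
  m₁ : ℕ

/-- The linear optical circuit in front of the two detectors of the measurement module. One photon
detected in rail `0` (rail `1`) is the effect `⟨+_{λ,α}|` (`⟨-_{λ,α}|`), where
`|±_{XY,α}⟩ = (|0⟩ ± e^{iα}|1⟩)/√2`, `|±_{XZ,α}⟩ = (|i⟩ ± e^{iα}|-i⟩)/√2` and
`|±_{YZ,α}⟩ = (|+⟩ ± e^{iα}|-⟩)/√2`. -/
def measCircuit (w : Wire) (p : Plane) (α : ℝ) : Fock →ₐ[ℂ] Fock :=
  (hadamard w).comp <| (rotZ w (-α)).comp <|
    match p with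
    | .XY => AlgHom.id ℂ Fock
    | .XZ => (hadamard w).comp (rotZ w (-(Real.pi / 2)))
    | .YZ => hadamard w

/-- The linear optical circuit of the destructive fusion with green failure: on each input a
`Z`-rotation and a Hadamard, then the Type I fusion (a beam splitter on rail `1` of the first and
rail `0` of the second qubit, both detected), and then a measurement of the remaining dual-rail
qubit, consisting of rail `0` of the first and rail `1` of the second input, in the `XY` plane. -/
def fusionCircuit (θ₀ θ₁ φ : ℝ) : Fock →ₐ[ℂ] Fock :=
  (beamSplitter (.fus 0, 0) (.fus 1, 1)).comp <| (phaseShift (.fus 1, 1) φ).comp <|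
  (beamSplitter (.fus 0, 1) (.fus 1, 0)).comp <|
  (hadamard (.fus 1)).comp <| (hadamard (.fus 0)).comp <|
  (rotZ (.fus 1) θ₁).comp (rotZ (.fus 0) θ₀)

/-- The common angle of the `Z`-rotations on the two inputs of an `X`- or `Y`-fusion. -/
def FusionKind.angle : FusionKind → ℝ
  | .X => 0
  | .Y => Real.pi / 2

/-- The angle of the final measurement of an `X`-fusion (the Type II fusion) or a `Y`-fusion (whose
success adds a `CZ` edge up to Pauli `Z` errors). -/
def FusionKind.finalAngle : FusionKind → ℝ
  | .X => 0
  | .Y => Real.pi / 2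

/-- The optical part of the repeat-until-success module. The switch is controlled by `done`: as long
as no fusion has succeeded the two photons are sent to the fusion circuit, and afterwards each of
them is measured on its own in the `XY` plane. -/
def rusCircuit (done : Bool) (k : FusionKind) : Fock →ₐ[ℂ] Fock :=
  if done then
    (measCircuit (.fus 1) .XY (-k.angle)).comp (measCircuit (.fus 0) .XY (-k.angle))
  else fusionCircuit k.angle k.angle k.finalAngle

/-- Success of a fusion: an odd number of photons in the detectors of the Type I fusion. -/
def Outcome.success (o : Outcome) : Bool := decide ((o.a + o.b) % 2 = 1)

/-- All detectors of one time step. -/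
def detectAll (o : Outcome) (f : Fock) : Fock :=
  detect (.fus 0, 1) o.a <| detect (.fus 1, 0) o.b <|
  detect (.fus 0, 0) o.c <| detect (.fus 1, 1) o.d <|
  detect (.meas, 0) o.m₀ <| detect (.meas, 1) o.m₁ f

/-! ### The architecture -/

/-- The three destinations that the router behind the delay lines can serve at each time step. -/
inductive Port where
  | fus (i : Fin 2) : Port
  | meas : Port

/-- Settings of the architecture for a computation with `m` input and `n` output qubits. Only the
corrections may depend on what has been observed: `x` and `z` receive the list of all outcomes of
the earlier time steps, latest first. -/
structure Settings (m n : ℕ) where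
  /-- number of time steps for which the set-up is run -/
  steps : ℕ
  /-- times at which the input qubits are handed to the atom, one after the other -/
  inTime : Fin m ↪o ℕ
  /-- times at which the output qubits leave on the output wire, one after the other -/
  outTime : Fin n ↪o ℕ
  /-- single-qubit unitary on the atom -/
  u : ℕ → Matrix.unitaryGroup (Fin 2) ℂ
  /-- router in front of the delay lines: the line into which the new photon is sent -/
  σ : ℕ → ℕ
  /-- router behind the delay lines: the line, if any, that is connected to each port -/
  ρ : ℕ → Port → Option ℕ
  /-- kind of fusion -/
  kind : ℕ → FusionKind
  /-- whether a new repeat-until-success fusion starts -/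
  restart : ℕ → Bool
  /-- measurement plane; with `none` the photon is not measured but sent to the output -/
  plane : ℕ → Option Plane
  /-- measurement angle -/
  angle : ℕ → ℝ
  /-- feed-forward of the `X` corrections -/
  x : ℕ → List Outcome → Bool
  /-- feed-forward of the `Z` corrections -/
  z : ℕ → List Outcome → Bool

/-- Joint (pure, not normalised) states of the atom, of the `m` qubits outside of the atom, and of
all the photons. -/
abbrev State (m : ℕ) : Type := Fin 2 → (Fin m → Fin 2) → Fock

/-- Exchange the content of the atom with the `i`-th outside qubit. -/
def exchange {m : ℕ} (i : Fin m) (f : State m) : State m :=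
  fun b r => f (r i) (Function.update r i b)

/-- The emitter: a unitary on the atom, followed by the emission of a photon via the `Z` spider
`|b⟩ ↦ |b⟩ ⊗ |b⟩`. -/
def emit {m : ℕ} (u : Matrix (Fin 2) (Fin 2) ℂ) (f : State m) : State m :=
  fun b r => MvPolynomial.X ((Wire.src, b) : Mode) * ∑ b' : Fin 2, MvPolynomial.C (u b b') * f b' r

namespace Settings

variable {m n : ℕ} (s : Settings m n)

/-- Where the exit of delay line `l` is connected at time `t`. -/
def exit (t l : ℕ) : Wire :=
  if s.ρ t (Port.fus 0) = some l then .fus 0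
  else if s.ρ t (Port.fus 1) = some l then .fus 1
  else if s.ρ t Port.meas = some l then .meas
  else .lost t l

/-- The router that sends a new photon into a delay line. -/
def intoLines (t : ℕ) : Wire → Wire
  | .src => .line (s.σ t) (s.σ t)
  | w => w

/-- One time step of the delay lines and of the router behind them. -/
def throughLines (t : ℕ) : Wire → Wire
  | .line l 0 => s.exit t l
  | .line l (j + 1) => .line l j
  | w => w

/-- The control of the switch in the repeat-until-success module, given the outcomes so far: has a
fusion succeeded since the module was last restarted? -/
def done : List Outcome → Bool
  | [] => false
  | o :: past => if s.restart (past.length + 1) then false else done past || o.success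

/-- Correction module, followed by the measurement module or by the output wire. -/
def correctAndMeasure (t : ℕ) (past : List Outcome) : Fock →ₐ[ℂ] Fock :=
  (match s.plane t with
    | some p => measCircuit .meas p (s.angle t)
    | none => rewire fun w => if w = Wire.meas then .out t else w).comp
  (correct .meas (s.x t past) (s.z t past))

/-- The optical part of one time step, behind the emitter, as a Kraus operator. -/
def optics (past : List Outcome) (o : Outcome) (f : Fock) : Fock :=
  detectAll o <| s.correctAndMeasure past.length past <|
  rusCircuit (s.done past) (s.kind past.length) <|
  rewire (s.throughLines past.length) <| rewire (s.intoLines past.length) f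

/-- Hand an input qubit to the atom, if one is due at time `t`. -/
def input (t : ℕ) (f : State m) : State m :=
  match Function.partialInv s.inTime t with
  | some i => exchange i f
  | none => f

/-- One time step (the time is the length of `past`), as a Kraus operator. -/
def step (past : List Outcome) (o : Outcome) (f : State m) : State m :=
  fun b r => s.optics past o (emit (s.u past.length).1 (s.input past.length f) b r)

/-- The unrolled protocol: the branch with the given list of outcomes (latest first), applied to the
input state `ψ`. Initially the atom is in the state `|0⟩` and there are no photons. -/
def run (ψ : (Fin m → Fin 2) → ℂ) : List Outcome → State m
  | [] => fun b r => if b = 0 then MvPolynomial.C (ψ r) else 0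
  | o :: past => s.step past o (run ψ past)

/-- The dual-rail encoding of an `n`-qubit state on the output wires. -/
def encode (φ : (Fin n → Fin 2) → ℂ) : Fock :=
  ∑ y : Fin n → Fin 2,
    MvPolynomial.C (φ y) * ∏ i, MvPolynomial.X ((Wire.out (s.outTime i), y i) : Mode)

/-- With probability greater than `p`, and heralded by the measurement outcomes, the protocol
implements the isometry `V`: there is a set `S` of outcome lists such that in each branch `h ∈ S`,
for every input state `ψ`, the output photons are left in the encoded state `V ψ`, in a product
with a state `R h` of everything else (atom, outside qubits, photons that are not on an output
wire) that does not depend on `ψ`. For normalised `ψ` the probability of `h` is the squared norm of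
`R h`. -/
def Implements (V : Matrix (Fin n → Fin 2) (Fin m → Fin 2) ℂ) (p : ℝ) : Prop :=
  ∃ (S : Finset (List Outcome)) (R : List Outcome → State m),
    (∀ h ∈ S, h.length = s.steps ∧
      (∀ b r, ∀ k ∈ (R h b r).vars, ∀ t, k.1 ≠ Wire.out t) ∧
      ∀ (ψ : (Fin m → Fin 2) → ℂ) (b : Fin 2) (r : Fin m → Fin 2),
        s.run ψ h b r = R h b r * s.encode (V.mulVec ψ)) ∧
    p < ∑ h ∈ S, ∑ b, ∑ r, fockNormSq (R h b r)

end Settings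

end SpinOptical

end

/-!
The settings carry out a measurement-based computation, and every edge of its graph state is made by
one repeat-until-success fusion.

*Circuits.* Conjugating the Hadamard gates on all qubits by phase gates on one qubit isolates a
Hadamard gate on that qubit (`Gen.hadAt`). Together with diagonal unitaries it gives multiplexed
rotations, with which any vector can be moved to a multiple of a basis vector, hence all complex
reflections, hence all unitaries (`Gen.of_unitary`). The phases of a diagonal unitary are a linear
combination of parities, so every unitary is, up to a phase, a product `D_L 𝐇 D_{L-1} ⋯ 𝐇 D_0`,
where `𝐇` consists of Hadamard gates on all qubits and every `D_l` is a product of phases on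
parities (`Gen.exists_layers`). Its matrix elements are sums over paths (`layers_mulVec`).

*Measurement pattern.* The graph has a vertex for every layer and qubit, joined to the same qubit in
the next layer, and a vertex for every layer and parity, joined to the qubits in the support of the
parity. The sum over paths is the amplitude of this graph state when qubits are measured in the `XY`
plane at angle `0`, which gives `𝐇`, and parities in the `YZ` plane, which gives `D_l`. All Pauli
by-products are removed by feed-forward from one layer to the next (`coef_add`, `sum_coef`).

*Edges.* The emitter goes through the vertices one after the other. For each vertex it emits a
photon for the readout, `k` photons for each incident edge, and a photon that is measured in
the `Z` basis at once, which disentangles the emitter. Since all photons of a vertex have the same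
rail, a `Y`-fusion of two of them is diagonal in the basis states of the two vertices: a success, which has
probability `1 / 2`, is a controlled `Z`, while a failure, and a pair of separate measurements after
a success, is a phase gate `diag(1, i)` on both vertices, always up to Pauli `Z` operators
(`fuseAmp`). For `k ≡ 1` modulo `4` the `k - 1` phase gates cancel (`prod_fuseAmp`).

*Run.* `Plan.Inv` describes the state after every time step as a sum over the basis states of the
vertices, with an amplitude and a monomial of photons for each; `Plan.inv_prog` is its form at the
end. The photons and the emitter that remain are in a state that depends on the record only, so the
records in which each edge is created at least once implement the circuit (`Plan.run_prog`,
`implements_of_layers`). They have total probability `(1 - 2⁻ᵏ) ^ N` for `N` edges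
(`Plan.sum_norm_scale`), which tends to one. For a state preparation no vertex is an input; the
emitter then prepares `|+⟩⋯|+⟩`, and the pattern for `U 𝐇` gives `U|0⋯0⟩`.
-/

noncomputable section

set_option linter.unusedSectionVars false

namespace SpinOptical

/-! ### Diagonal gates and Hadamards generate all unitaries -/

/-- The sign `(-1) ^ b` of a bit. -/
def sg (b : Fin 2) : ℂ := if b = 0 then 1 else -1

@[simp] lemma sg_zero : sg 0 = 1 := rfl
@[simp] lemma sg_one : sg 1 = -1 := rfl

lemma sg_add (a b : Fin 2) : sg (a + b) = sg a * sg b := by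
  fin_cases a <;> fin_cases b <;> simp [sg]

lemma sg_mul_self (a : Fin 2) : sg a * sg a = 1 := by fin_cases a <;> simp [sg]

@[simp] lemma norm_sg (a : Fin 2) : ‖sg a‖ = 1 := by fin_cases a <;> simp [sg]

@[simp] lemma star_sg (a : Fin 2) : star (sg a) = sg a := by fin_cases a <;> simp [sg]

lemma sg_sum {ι : Type*} (s : Finset ι) (f : ι → Fin 2) :
    sg (∑ i ∈ s, f i) = ∏ i ∈ s, sg (f i) := by
  classical
  induction s using Finset.induction_on with
  | empty => simp
  | insert a s ha ih => rw [Finset.sum_insert ha, Finset.prod_insert ha, sg_add, ih]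

/-- The tensor product of one-qubit matrices. -/
def tens {n : ℕ} (A : Fin n → Matrix (Fin 2) (Fin 2) ℂ) :
    Matrix (Fin n → Fin 2) (Fin n → Fin 2) ℂ :=
  Matrix.of fun x y => ∏ i, A i (x i) (y i)

lemma tens_mul {n : ℕ} (A B : Fin n → Matrix (Fin 2) (Fin 2) ℂ) :
    tens A * tens B = tens fun i => A i * B i := by
  ext x y
  simp only [tens, Matrix.mul_apply, Matrix.of_apply, Finset.prod_univ_sum, Fintype.piFinset_univ,
    Finset.prod_mul_distrib]

lemma tens_one {n : ℕ} : tens (fun _ : Fin n => 1) = 1 := by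
  ext x y
  by_cases h : x = y
  · subst h
    simp [tens]
  · obtain ⟨i, hi⟩ := Function.ne_iff.1 h
    simp only [tens, Matrix.of_apply, Matrix.one_apply_ne h]
    exact Finset.prod_eq_zero (Finset.mem_univ i) (Matrix.one_apply_ne hi)

lemma tens_conjTranspose {n : ℕ} (A : Fin n → Matrix (Fin 2) (Fin 2) ℂ) :
    (tens A).conjTranspose = tens fun i => (A i).conjTranspose := by
  ext x y
  simp [tens]

/-- The Hadamard matrix. -/
def had1 : Matrix (Fin 2) (Fin 2) ℂ := Matrix.of fun a b => sg (a * b) * ((Real.sqrt 2 : ℝ) : ℂ)⁻¹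

lemma sqrt_two_inv_mul_self : ((Real.sqrt 2 : ℝ) : ℂ)⁻¹ * ((Real.sqrt 2 : ℝ) : ℂ)⁻¹ = 1 / 2 := by
  rw [← mul_inv, ← Complex.ofReal_mul, Real.mul_self_sqrt (by norm_num)]
  norm_num

lemma had1_mul_had1 : had1 * had1 = 1 := by
  ext a b
  fin_cases a <;> fin_cases b <;>
    (simp [had1, Matrix.mul_apply, sqrt_two_inv_mul_self]; try norm_num)

lemma had1_conjTranspose : had1.conjTranspose = had1 := by
  ext a b
  simp only [Matrix.conjTranspose_apply, had1, Matrix.of_apply, star_mul', star_sg, mul_comm b a]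
  simp

/-- Hadamards on all of the `n` qubits. -/
def hadN (n : ℕ) : Matrix (Fin n → Fin 2) (Fin n → Fin 2) ℂ := tens fun _ => had1

lemma hadN_mul_hadN (n : ℕ) : hadN n * hadN n = 1 := by
  simp [hadN, tens_mul, had1_mul_had1, tens_one]

lemma hadN_conjTranspose (n : ℕ) : (hadN n).conjTranspose = hadN n := by
  simp [hadN, tens_conjTranspose, had1_conjTranspose]

lemma diagonal_mem_unitary {ι : Type*} [Fintype ι] [DecidableEq ι] {d : ι → ℂ}
    (hd : ∀ x, ‖d x‖ = 1) : Matrix.diagonal d * (Matrix.diagonal d).conjTranspose = 1 := by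
  rw [Matrix.diagonal_conjTranspose, Matrix.diagonal_mul_diagonal, ← Matrix.diagonal_one]
  congr 1
  ext x
  simp [Complex.mul_conj, Complex.normSq_eq_norm_sq, hd]

/-- The matrices of circuits in which layers of diagonal unitaries alternate with Hadamards on all
qubits. -/
inductive Gen (n : ℕ) : Matrix (Fin n → Fin 2) (Fin n → Fin 2) ℂ → Prop
  | diag (d : (Fin n → Fin 2) → ℂ) (hd : ∀ x, ‖d x‖ = 1) : Gen n (Matrix.diagonal d)
  | layer (d : (Fin n → Fin 2) → ℂ) (hd : ∀ x, ‖d x‖ = 1)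
      (A : Matrix (Fin n → Fin 2) (Fin n → Fin 2) ℂ) (hA : Gen n A) :
      Gen n (Matrix.diagonal d * hadN n * A)

namespace Gen

variable {n : ℕ} {A B : Matrix (Fin n → Fin 2) (Fin n → Fin 2) ℂ}

lemma one : Gen n 1 := by
  rw [← Matrix.diagonal_one]
  exact .diag _ (by simp)

lemma had_mul (hA : Gen n A) : Gen n (hadN n * A) := by
  have := Gen.layer 1 (by simp) A hA
  rwa [show Matrix.diagonal (1 : (Fin n → Fin 2) → ℂ) = 1 from Matrix.diagonal_one, one_mul] at this

lemma had : Gen n (hadN n) := by simpa using had_mul (one (n := n))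

lemma diag_mul (d : (Fin n → Fin 2) → ℂ) (hd : ∀ x, ‖d x‖ = 1) (hA : Gen n A) :
    Gen n (Matrix.diagonal d * A) := by
  cases hA with
  | diag d' hd' =>
    rw [Matrix.diagonal_mul_diagonal]
    exact .diag _ (by simp [hd, hd'])
  | layer d' hd' A hA =>
    rw [← mul_assoc, ← mul_assoc, Matrix.diagonal_mul_diagonal]
    exact .layer _ (by simp [hd, hd']) A hA

lemma mul (hA : Gen n A) (hB : Gen n B) : Gen n (A * B) := by
  induction hA with
  | diag d hd => exact diag_mul d hd hB
  | layer d hd A _ ih =>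
    rw [mul_assoc, mul_assoc]
    exact diag_mul d hd (had_mul ih)

lemma conjTranspose (hA : Gen n A) : Gen n A.conjTranspose := by
  induction hA with
  | diag d hd =>
    rw [Matrix.diagonal_conjTranspose]
    exact .diag _ (by simpa using hd)
  | layer d hd A _ ih =>
    rw [Matrix.conjTranspose_mul, Matrix.conjTranspose_mul, hadN_conjTranspose,
      Matrix.diagonal_conjTranspose]
    exact mul ih (mul had (.diag _ (by simpa using hd)))

lemma mul_conjTranspose (hA : Gen n A) : A * A.conjTranspose = 1 := by
  induction hA with
  | diag d hd => exact diagonal_mem_unitary hd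
  | layer d hd A _ ih =>
    rw [Matrix.conjTranspose_mul, Matrix.conjTranspose_mul, hadN_conjTranspose]
    calc Matrix.diagonal d * hadN n * A *
          (A.conjTranspose * (hadN n * (Matrix.diagonal d).conjTranspose))
        = Matrix.diagonal d * (hadN n * (A * A.conjTranspose) * hadN n) *
            (Matrix.diagonal d).conjTranspose := by simp only [mul_assoc]
      _ = 1 := by rw [ih, mul_one, hadN_mul_hadN, mul_one, diagonal_mem_unitary hd]

lemma conjTranspose_mul (hA : Gen n A) : A.conjTranspose * A = 1 := by
  simpa using hA.conjTranspose.mul_conjTranspose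

end Gen

/-- A Hadamard on the qubit `j`. -/
def hadAt {n : ℕ} (j : Fin n) : Matrix (Fin n → Fin 2) (Fin n → Fin 2) ℂ :=
  tens fun i => if i = j then had1 else 1

/-- The phase gate `diag(1, i)`. -/
def sGate : Matrix (Fin 2) (Fin 2) ℂ := Matrix.diagonal fun b => if b = 0 then 1 else Complex.I

lemma tens_diagonal {n : ℕ} (d : Fin n → Fin 2 → ℂ) :
    tens (fun i => Matrix.diagonal (d i)) = Matrix.diagonal fun x => ∏ i, d i (x i) := by
  ext x y
  by_cases h : x = y
  · simp [tens, h]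
  · obtain ⟨i, hi⟩ := Function.ne_iff.1 h
    simp only [tens, Matrix.of_apply, Matrix.diagonal_apply_ne _ h]
    exact Finset.prod_eq_zero (Finset.mem_univ i) (Matrix.diagonal_apply_ne _ hi)

lemma sGate_had1_sGate :
    sGate * had1 * sGate * had1 * sGate =
      (((1 + Complex.I) * ((Real.sqrt 2 : ℝ) : ℂ)⁻¹)) • had1 := by
  have h := sqrt_two_inv_mul_self
  have hI := Complex.I_mul_I
  ext a b
  fin_cases a <;> fin_cases b <;>
    simp [sGate, had1, Matrix.mul_apply, Fin.sum_univ_two] <;> grind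

/-- A single Hadamard is a product of phase gates on its qubit and Hadamards on all qubits: on the
other qubits the Hadamards cancel. -/
lemma Gen.hadAt {n : ℕ} (j : Fin n) : Gen n (hadAt j) := by
  set c : ℂ := (1 + Complex.I) * ((Real.sqrt 2 : ℝ) : ℂ)⁻¹ with hc
  have hcn : ‖c‖ = 1 := by
    have h : ‖c‖ ^ 2 = 1 := by
      rw [← Complex.normSq_eq_norm_sq]
      simp [hc, Complex.normSq_apply]
      nlinarith [Real.mul_self_sqrt (show (0 : ℝ) ≤ 2 by norm_num)]
    nlinarith [norm_nonneg c, sq_nonneg (‖c‖ - 1)]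
  have hc0 : c ≠ 0 := by rw [← norm_pos_iff, hcn]; norm_num
  let S : Matrix (Fin n → Fin 2) (Fin n → Fin 2) ℂ := tens fun i => if i = j then sGate else 1
  have hS : Gen n S := by
    have : S = Matrix.diagonal fun x => ∏ i, (if i = j then fun b : Fin 2 => if b = 0 then 1 else
        Complex.I else fun _ => (1 : ℂ)) (x i) := by
      rw [← tens_diagonal]
      refine congrArg tens (funext fun i => ?_)
      by_cases h : i = j
      · simp [h, sGate]
      · simp only [h, if_false]
        exact Matrix.diagonal_one.symm
    rw [this]
    refine .diag _ fun x => ?_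
    rw [norm_prod]
    refine Finset.prod_eq_one fun i _ => ?_
    by_cases h : i = j
    · subst h
      rcases Fin.exists_fin_two.1 ⟨x i, rfl⟩ with h | h <;> simp [h]
    · simp [h]
  -- On the qubit `j` this is `S H S H S ∝ H`, on the other qubits it is `H H = 1`.
  have key : S * hadN n * S * hadN n * S = c • SpinOptical.hadAt j := by
    simp only [S, hadN, tens_mul, SpinOptical.hadAt]
    ext x y
    simp only [tens, Matrix.of_apply, Matrix.smul_apply, smul_eq_mul]
    rw [← Finset.mul_prod_erase _ _ (Finset.mem_univ j),
      ← Finset.mul_prod_erase (a := j) _ (fun i => (if i = j then had1 else 1) (x i) (y i))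
        (Finset.mem_univ j), ← mul_assoc]
    congr 1
    · simp [sGate_had1_sGate, hc]
    · refine Finset.prod_congr rfl fun i hi => ?_
      simp [(Finset.mem_erase.1 hi).1, had1_mul_had1]
  have : SpinOptical.hadAt j = Matrix.diagonal (fun _ => c⁻¹) * (S * hadN n * S * hadN n * S) := by
    rw [key]
    ext x y
    simp [Matrix.diagonal_mul, hc0]
  rw [this]
  exact diag_mul _ (by simp [hcn]) ((((hS.mul had).mul hS).mul had).mul hS)

lemma hadAt_mulVec {n : ℕ} (j : Fin n) (w : (Fin n → Fin 2) → ℂ) (x : Fin n → Fin 2) :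
    (hadAt j).mulVec w x = ((Real.sqrt 2 : ℝ) : ℂ)⁻¹ *
      (w (Function.update x j 0) + sg (x j) * w (Function.update x j 1)) := by
  have hne : Function.update x j 0 ≠ Function.update x j 1 := fun h => by
    simpa using congrFun h j
  have hval : ∀ b, hadAt j x (Function.update x j b) =
      sg (x j * b) * ((Real.sqrt 2 : ℝ) : ℂ)⁻¹ := by
    intro b
    simp only [hadAt, tens, Matrix.of_apply]
    rw [← Finset.mul_prod_erase _ _ (Finset.mem_univ j), Finset.prod_eq_one]
    · simp [had1]
    · intro i hi
      have hij := (Finset.mem_erase.1 hi).1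
      rw [if_neg hij, Function.update_of_ne hij, Matrix.one_apply_eq]
  rw [Matrix.mulVec, dotProduct, ← Finset.sum_subset (Finset.subset_univ
    {Function.update x j 0, Function.update x j 1}), Finset.sum_pair hne, hval, hval]
  · simp
    ring
  · intro y _ hy
    have : ∃ i, i ≠ j ∧ x i ≠ y i := by
      by_contra! h
      refine hy ?_
      have : y = Function.update x j (y j) := by
        ext1 i
        by_cases hi : i = j
        · subst hi; simp
        · simp [hi, h i hi]
      rcases Fin.exists_fin_two.1 ⟨y j, rfl⟩ with hb | hb <;> rw [hb] at this <;> simp [← this]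
    obtain ⟨i, hij, hxy⟩ := this
    rw [show hadAt j x y = 0 from Finset.prod_eq_zero (Finset.mem_univ i) (by simp [hij, hxy]),
      zero_mul]

/-- A unit complex number with the phase of `z`. -/
def unitPhase (z : ℂ) : ℂ := if z = 0 then 1 else z / ‖z‖

lemma norm_unitPhase (z : ℂ) : ‖unitPhase z‖ = 1 := by
  unfold unitPhase
  split_ifs with h
  · simp
  · simp [h]

lemma star_unitPhase_mul (z : ℂ) : star (unitPhase z) * z = ‖z‖ := by
  unfold unitPhase
  split_ifs with h
  · simp [h]
  · have h' : (‖z‖ : ℂ) ≠ 0 := by simpa using h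
    simp only [RCLike.star_def, map_div₀, Complex.conj_ofReal]
    rw [div_mul_eq_mul_div, Complex.conj_mul', div_eq_iff h']
    ring

/-- Givens rotations that act on the qubit `j` and are controlled by the other qubits remove all
amplitudes in which the qubit `j` is `1`. -/
lemma exists_gen_clear_bit {n : ℕ} (j : Fin n) (w : (Fin n → Fin 2) → ℂ) :
    ∃ g, Gen n g ∧ (∀ x, x j = 1 → g.mulVec w x = 0) ∧
      ∀ x, w (Function.update x j 0) = 0 → w (Function.update x j 1) = 0 → g.mulVec w x = 0 := by
  -- `d₁` turns the amplitudes `p`, `q` at `x j = 0`, `1` into `|p|` and `-i |q|`; conjugating the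
  -- multiplexed `Z`-rotation `d₂` by Hadamards then gives the rotation by the argument of
  -- `|p| + i |q|`.
  let d₁ : (Fin n → Fin 2) → ℂ := fun x =>
    star (unitPhase (w x)) * if x j = 0 then 1 else -Complex.I
  let ζ : (Fin n → Fin 2) → ℂ := fun x => unitPhase
    (‖w (Function.update x j 0)‖ + ‖w (Function.update x j 1)‖ * Complex.I)
  let d₂ : (Fin n → Fin 2) → ℂ := fun x => if x j = 0 then ζ x else star (ζ x)
  have h₁ : ∀ x, ‖d₁ x‖ = 1 := by
    intro x
    simp only [d₁, norm_mul, norm_star, norm_unitPhase]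
    split_ifs <;> simp
  have h₂ : ∀ x, ‖d₂ x‖ = 1 := by
    intro x
    simp only [d₂]
    split_ifs <;> simp [ζ, norm_unitPhase]
  have hw : ∀ x, d₁ x * w x = ‖w x‖ * if x j = 0 then 1 else -Complex.I := by
    intro x
    rw [← star_unitPhase_mul]
    simp only [d₁]
    ring
  have hζ : ∀ x b, ζ (Function.update x j b) = ζ x := by intro x b; simp [ζ]
  refine ⟨hadAt j * Matrix.diagonal d₂ * hadAt j * Matrix.diagonal d₁,
    (((Gen.hadAt j).mul (.diag _ h₂)).mul (Gen.hadAt j)).mul (.diag _ h₁), ?_, ?_⟩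
  · intro x hx
    simp only [← Matrix.mulVec_mulVec, hadAt_mulVec, Matrix.mulVec_diagonal, hw, hx,
      Function.update_self, Function.update_idem, d₂, hζ]
    simp only [if_true, one_ne_zero, if_false, sg_zero, sg_one]
    set p := ‖w (Function.update x j 0)‖
    set q := ‖w (Function.update x j 1)‖
    have e1 : star (ζ x) * (p + q * Complex.I) = ‖(p + q * Complex.I : ℂ)‖ :=
      star_unitPhase_mul _
    have e2 := congrArg star e1
    simp only [star_mul', star_add, RCLike.star_def, Complex.conj_ofReal,
      Complex.conj_I, Complex.conj_conj] at e1 e2 ⊢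
    linear_combination (((Real.sqrt 2 : ℝ) : ℂ)⁻¹) ^ 2 * (e2 - e1)
  · intro x h0 h1
    simp only [← Matrix.mulVec_mulVec, hadAt_mulVec, Matrix.mulVec_diagonal, Function.update_idem,
      h0, h1]
    simp

/-- Every vector can be moved to a multiple of the first basis vector, by clearing one bit after the
other. -/
lemma exists_gen_mulVec_eq {n : ℕ} (v : (Fin n → Fin 2) → ℂ) :
    ∃ g, Gen n g ∧ ∀ x, x ≠ 0 → g.mulVec v x = 0 := by
  have key : ∀ s : Finset (Fin n), ∃ g, Gen n g ∧ ∀ x, (∃ j ∈ s, x j = 1) → g.mulVec v x = 0 := by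
    intro s
    induction s using Finset.induction_on with
    | empty => exact ⟨1, Gen.one, by simp⟩
    | insert j s hj ih =>
      obtain ⟨g, hg, h⟩ := ih
      obtain ⟨g', hg', h1, h2⟩ := exists_gen_clear_bit j (g.mulVec v)
      refine ⟨g' * g, hg'.mul hg, fun x hx => ?_⟩
      rw [← Matrix.mulVec_mulVec]
      obtain ⟨i, hi, hxi⟩ := hx
      rcases Finset.mem_insert.1 hi with rfl | his
      · exact h1 x hxi
      · have hij : i ≠ j := fun e => hj (e ▸ his)
        exact h2 x (h _ ⟨i, his, by simp [hij, hxi]⟩) (h _ ⟨i, his, by simp [hij, hxi]⟩)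
  obtain ⟨g, hg, h⟩ := key Finset.univ
  refine ⟨g, hg, fun x hx => h x ?_⟩
  obtain ⟨j, hj⟩ := Function.ne_iff.1 hx
  refine ⟨j, Finset.mem_univ j, ?_⟩
  rcases Fin.exists_fin_two.1 ⟨x j, rfl⟩ with h | h
  · exact absurd h hj
  · exact h

/-- Complex reflections are generated: after a change of basis that moves `v` to a multiple of the
first basis vector they are diagonal. -/
lemma Gen.reflection {n : ℕ} (v : (Fin n → Fin 2) → ℂ) (κ : ℂ)
    (hκ : ‖1 - κ * (star v ⬝ᵥ v)‖ = 1) :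
    Gen n (1 - κ • Matrix.vecMulVec v (star v)) := by
  obtain ⟨g, hg, h⟩ := exists_gen_mulVec_eq v
  set c := g.mulVec v 0
  have hgv : g.mulVec v = Pi.single 0 c := by
    ext1 x
    by_cases hx : x = 0
    · subst hx; simp [c]
    · simp [h x hx, hx]
  have hc : star v ⬝ᵥ v = star c * c := by
    calc star v ⬝ᵥ v = star v ⬝ᵥ (g.conjTranspose * g).mulVec v := by
          rw [hg.conjTranspose_mul, Matrix.one_mulVec]
      _ = star (g.mulVec v) ⬝ᵥ g.mulVec v := by
          rw [← Matrix.mulVec_mulVec, Matrix.dotProduct_mulVec, Matrix.star_mulVec]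
      _ = star c * c := by rw [hgv]; simp
  have hd : Gen n (Matrix.diagonal fun x : Fin n → Fin 2 =>
      if x = 0 then 1 - κ * (star c * c) else 1) := by
    refine .diag _ fun x => ?_
    split_ifs
    · rw [← hc]; exact hκ
    · simp
  have : (1 - κ • Matrix.vecMulVec v (star v)) = g.conjTranspose *
      (Matrix.diagonal fun x : Fin n → Fin 2 => if x = 0 then 1 - κ * (star c * c) else 1) * g := by
    have e : (Matrix.diagonal fun x : Fin n → Fin 2 => if x = 0 then 1 - κ * (star c * c) else 1)
        = 1 - κ • Matrix.vecMulVec (g.mulVec v) (star (g.mulVec v)) := by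
      rw [hgv]
      ext x y
      by_cases hxy : x = y
      · subst hxy
        by_cases hx : x = 0
        · subst hx
          simp [Matrix.vecMulVec_apply, mul_comm]
        · simp [Matrix.vecMulVec_apply, hx]
      · rw [Matrix.diagonal_apply_ne _ hxy, Matrix.sub_apply, Matrix.one_apply_ne hxy]
        by_cases hx : x = 0
        · have hy : y ≠ 0 := fun h => hxy (hx.trans h.symm)
          simp [Matrix.vecMulVec_apply, Pi.single_eq_of_ne hy]
        · simp [Matrix.vecMulVec_apply, hx]
    rw [e, mul_sub, sub_mul, mul_one, hg.conjTranspose_mul, Matrix.mul_smul, Matrix.smul_mul,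
      Matrix.mul_vecMulVec, Matrix.mulVec_mulVec, hg.conjTranspose_mul, Matrix.one_mulVec,
      Matrix.vecMulVec_mul, Matrix.star_mulVec, Matrix.vecMul_vecMul, hg.conjTranspose_mul,
      Matrix.vecMul_one]
  rw [this]
  exact (hg.conjTranspose.mul hd).mul hg

lemma unitary_apply_eq_zero {ι : Type*} [Fintype ι] [DecidableEq ι] {W : Matrix ι ι ℂ}
    (hW : W.conjTranspose * W = 1) {i j : ι} (hi : W.mulVec (Pi.single i 1) = Pi.single i 1)
    (hij : i ≠ j) : W i j = 0 := by
  have h := congrFun (congrFun hW i) j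
  rw [Matrix.one_apply_ne hij, Matrix.mul_apply] at h
  have hcol : ∀ x, W x i = (Pi.single i 1 : ι → ℂ) x := fun x => by
    rw [← hi]; simp
  simpa [Matrix.conjTranspose_apply, hcol, Pi.single_apply] using h

open scoped ComplexOrder in
/-- Every unitary is generated: reflections move one column after the other to its place. -/
lemma Gen.of_unitary {n : ℕ} (U : Matrix (Fin n → Fin 2) (Fin n → Fin 2) ℂ)
    (hU : U.conjTranspose * U = 1) : Gen n U := by
  have key : ∀ s : Finset (Fin n → Fin 2), ∃ R, Gen n R ∧
      ∀ x ∈ s, (R * U).mulVec (Pi.single x 1) = Pi.single x 1 := by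
    intro s
    induction s using Finset.induction_on with
    | empty => exact ⟨1, Gen.one, by simp⟩
    | insert j s hj ih =>
      obtain ⟨R, hR, h⟩ := ih
      set W := R * U with hWdef
      have hW : W.conjTranspose * W = 1 := by
        rw [hWdef, Matrix.conjTranspose_mul, mul_assoc, ← mul_assoc R.conjTranspose,
          hR.conjTranspose_mul, one_mul, hU]
      by_cases hj1 : W.mulVec (Pi.single j 1) = Pi.single j 1
      · refine ⟨R, hR, fun x hx => ?_⟩
        rcases Finset.mem_insert.1 hx with rfl | hx
        · exact hj1
        · exact h x hx
      -- The reflection along `e_j - W e_j` moves `W e_j` back to `e_j`.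
      set a := W.mulVec (Pi.single j 1) with ha
      have haj : ∀ x, a x = W x j := by intro x; simp [ha]
      have haa : star a ⬝ᵥ a = 1 := by
        rw [ha, Matrix.star_mulVec, ← Matrix.dotProduct_mulVec, Matrix.mulVec_mulVec, hW]
        simp
      set e : (Fin n → Fin 2) → ℂ := Pi.single j 1 with he
      set v := e - a with hv
      have hva : star v ⬝ᵥ a = a j - 1 := by
        rw [hv, star_sub, sub_dotProduct, haa, he]
        simp
      have hvv : star v ⬝ᵥ v = 2 - a j - star (a j) := by
        rw [hv, dotProduct_sub, ← hv, hva, hv, star_sub, sub_dotProduct, he]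
        simp
        ring
      have hne : a j - 1 ≠ 0 := by
        intro h0
        have h1 : a j = 1 := sub_eq_zero.1 h0
        have : star v ⬝ᵥ v = 0 := by rw [hvv, h1]; norm_num
        rw [dotProduct_star_self_eq_zero] at this
        exact hj1 (sub_eq_zero.1 this).symm
      refine ⟨(1 - (-(a j - 1)⁻¹) • Matrix.vecMulVec v (star v)) * R,
        (Gen.reflection v _ ?_).mul hR, fun x hx => ?_⟩
      · have : 1 - -(a j - 1)⁻¹ * (star v ⬝ᵥ v) = - (star (a j - 1) / (a j - 1)) := by
          rw [hvv]
          field_simp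
          simp
          ring
        rw [this, norm_neg, norm_div, norm_star, div_self (norm_ne_zero_iff.2 hne)]
      · rw [mul_assoc, ← hWdef, ← Matrix.mulVec_mulVec]
        rcases Finset.mem_insert.1 hx with rfl | hx
        · rw [← ha, Matrix.sub_mulVec, Matrix.one_mulVec, Matrix.smul_mulVec,
            Matrix.vecMulVec_mulVec, hva]
          ext1 y
          simp only [Pi.sub_apply, Pi.smul_apply, MulOpposite.smul_eq_mul_unop,
            MulOpposite.unop_op, hv, smul_eq_mul, he]
          field_simp
          ring
        · have hxj : x ≠ j := fun e => hj (e ▸ hx)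
          have h0 : star v ⬝ᵥ Pi.single x 1 = 0 := by
            simp [hv, he, haj, unitary_apply_eq_zero hW (h x hx) hxj, hxj]
          rw [h x hx, Matrix.sub_mulVec, Matrix.one_mulVec, Matrix.smul_mulVec,
            Matrix.vecMulVec_mulVec, h0]
          simp
  obtain ⟨R, hR, h⟩ := key Finset.univ
  have hRU : R * U = 1 := by
    ext x y
    have := congrFun (h y (Finset.mem_univ y)) x
    rw [Matrix.mulVec_single_one] at this
    rw [Matrix.one_apply, ← Pi.single_apply, ← this]
    rfl
  have : U = R.conjTranspose := by
    calc U = R.conjTranspose * R * U := by rw [hR.conjTranspose_mul, one_mul]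
      _ = R.conjTranspose := by rw [mul_assoc, hRU, mul_one]
  rw [this]
  exact hR.conjTranspose

/-! ### Layered circuits -/

/-- The parity of the bits of `x` selected by `y`. -/
def dot {n : ℕ} (y x : Fin n → Fin 2) : Fin 2 := ∑ j, y j * x j

/-- The eigenvalues `1`, `e^{-iα}` of a phase gate. -/
def ph (α : ℝ) (b : Fin 2) : ℂ := if b = 0 then 1 else Complex.exp (-(α * Complex.I))

lemma hadN_apply {n : ℕ} (x y : Fin n → Fin 2) :
    hadN n x y = sg (dot x y) * ((Real.sqrt 2 : ℝ) : ℂ)⁻¹ ^ n := by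
  simp [hadN, tens, had1, dot, sg_sum, Finset.prod_mul_distrib]

/-- Diagonal unitaries are products of phases on parities (Walsh expansion of the phase). -/
lemma exists_parity_phases {n : ℕ} (d : (Fin n → Fin 2) → ℂ) (hd : ∀ x, ‖d x‖ = 1) :
    ∃ (α : (Fin n → Fin 2) → ℝ) (c : ℂ), ‖c‖ = 1 ∧ ∀ x, d x = c * ∏ y, ph (α y) (dot y x) := by
  let r : ℝ := (Real.sqrt 2)⁻¹ ^ n
  let f : (Fin n → Fin 2) → ℝ := fun y =>
    r * ((hadN n).mulVec (fun x => (Complex.arg (d x) : ℂ)) y).re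
  have hf : ∀ x, Complex.arg (d x) = ∑ y, f y - ∑ y, if dot y x = 0 then 0 else 2 * f y := by
    intro x
    have h1 : (hadN n).mulVec ((hadN n).mulVec fun x => (Complex.arg (d x) : ℂ)) x
        = Complex.arg (d x) := by
      rw [Matrix.mulVec_mulVec, hadN_mul_hadN, Matrix.one_mulVec]
    have h2 := congrArg Complex.re h1
    rw [Complex.ofReal_re, Matrix.mulVec, dotProduct, Complex.re_sum] at h2
    rw [← h2, ← Finset.sum_sub_distrib]
    refine Finset.sum_congr rfl fun y _ => ?_
    have h3 : hadN n x y = ((if dot y x = 0 then r else -r : ℝ) : ℂ) := by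
      have : dot x y = dot y x := by simp [dot, mul_comm]
      rw [hadN_apply, this]
      by_cases h : dot y x = 0
      · simp [h, r]
      · simp [h, r, sg]
    rw [h3, Complex.re_ofReal_mul]
    split_ifs
    · simp [f]
    · simp only [f]
      ring
  refine ⟨fun y => 2 * f y, Complex.exp ((∑ y, f y : ℝ) * Complex.I),
    Complex.norm_exp_ofReal_mul_I _, fun x => ?_⟩
  have h1 : d x = Complex.exp (Complex.arg (d x) * Complex.I) := by
    conv_lhs => rw [← Complex.norm_mul_exp_arg_mul_I (d x), hd]
    simp
  rw [h1, hf, Complex.ofReal_sub, sub_mul, sub_eq_add_neg, Complex.exp_add]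
  congr 1
  rw [Complex.ofReal_sum, Finset.sum_mul, ← Finset.sum_neg_distrib, Complex.exp_sum]
  refine Finset.prod_congr rfl fun y _ => ?_
  unfold ph
  split_ifs <;> simp

/-- The circuit in which parity phases `α 0`, …, `α L` alternate with Hadamards on all qubits. -/
def layers {n : ℕ} (α : ℕ → (Fin n → Fin 2) → ℝ) : ℕ → Matrix (Fin n → Fin 2) (Fin n → Fin 2) ℂ
  | 0 => Matrix.diagonal fun x => ∏ y, ph (α 0 y) (dot y x)
  | L + 1 => (Matrix.diagonal fun x => ∏ y, ph (α (L + 1) y) (dot y x)) * hadN n * layers α L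

lemma layers_congr {n : ℕ} {α β : ℕ → (Fin n → Fin 2) → ℝ} {L : ℕ} (h : ∀ l ≤ L, α l = β l) :
    layers α L = layers β L := by
  induction L with
  | zero => simp [layers, h 0 le_rfl]
  | succ L ih => rw [layers, layers, h _ le_rfl, ih fun l hl => h l (hl.trans (Nat.le_succ L))]

lemma Gen.exists_layers {n : ℕ} {A : Matrix (Fin n → Fin 2) (Fin n → Fin 2) ℂ} (hA : Gen n A) :
    ∃ (L : ℕ) (α : ℕ → (Fin n → Fin 2) → ℝ) (c : ℂ), ‖c‖ = 1 ∧ A = c • layers α L := by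
  induction hA with
  | diag d hd =>
    obtain ⟨α, c, hc, h⟩ := exists_parity_phases d hd
    refine ⟨0, fun _ => α, c, hc, ?_⟩
    rw [layers, ← Matrix.diagonal_smul]
    congr 1
    ext1 x
    exact h x
  | layer d hd A _ ih =>
    obtain ⟨L, α, c, hc, rfl⟩ := ih
    obtain ⟨β, c', hc', h⟩ := exists_parity_phases d hd
    refine ⟨L + 1, fun l => if l ≤ L then α l else β, c' * c, by simp [hc, hc'], ?_⟩
    have hd' : Matrix.diagonal d = c' • Matrix.diagonal fun x => ∏ y, ph (β y) (dot y x) := by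
      rw [← Matrix.diagonal_smul]
      congr 1
      ext1 x
      exact h x
    rw [layers, layers_congr (α := fun l => if l ≤ L then α l else β) (β := α)
      (by intro l hl; simp [hl]), hd']
    simp [smul_smul, mul_comm]

/-- The matrix elements of a layered circuit are sums over paths, whose steps are the basis states
before each Hadamard layer. -/
lemma layers_mulVec {n : ℕ} (α : ℕ → (Fin n → Fin 2) → ℝ) (L : ℕ) (ψ : (Fin n → Fin 2) → ℂ)
    (z : Fin n → Fin 2) :
    (layers α L).mulVec ψ z = ∑ x : Fin (L + 1) → Fin n → Fin 2,
      if x (Fin.last L) = z then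
        ψ (x 0) * (∏ l : Fin (L + 1), ∏ y, ph (α l y) (dot y (x l))) *
          ∏ l : Fin L, hadN n (x l.succ) (x l.castSucc)
      else 0 := by
  induction L generalizing z with
  | zero =>
    rw [← (Equiv.funUnique (Fin 1) (Fin n → Fin 2)).symm.sum_comp]
    simp [layers, Matrix.mulVec_diagonal, mul_comm]
  | succ L ih =>
    rw [← (Fin.snocEquiv fun _ : Fin (L + 2) => Fin n → Fin 2).sum_comp, Fintype.sum_prod_type]
    have hz : ∀ w (x : Fin (L + 1) → Fin n → Fin 2),
        Fin.snocEquiv (fun _ : Fin (L + 2) => Fin n → Fin 2) (w, x) (Fin.last (L + 1)) = w := by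
      intro w x; simp [Fin.snocEquiv]
    simp only [hz]
    rw [Finset.sum_eq_single z (by intro w _ hw; simp [hw]) (by simp)]
    simp only [if_true]
    rw [layers, ← Matrix.mulVec_mulVec, ← Matrix.mulVec_mulVec, Matrix.mulVec_diagonal,
      Matrix.mulVec, dotProduct]
    simp only [ih, Finset.mul_sum]
    rw [Finset.sum_comm]
    refine Finset.sum_congr rfl fun x _ => ?_
    rw [Finset.sum_eq_single (x (Fin.last L)) (by intro w _ hw; simp [hw.symm]) (by simp)]
    simp only [if_true]
    rw [Fin.prod_univ_castSucc (n := L + 1), Fin.prod_univ_castSucc (n := L)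
      (f := fun l => hadN n (Fin.snocEquiv (fun _ : Fin (L + 2) => Fin n → Fin 2) (z, x) l.succ)
        (Fin.snocEquiv (fun _ : Fin (L + 2) => Fin n → Fin 2) (z, x) l.castSucc))]
    have h0 : Fin.snocEquiv (fun _ : Fin (L + 2) => Fin n → Fin 2) (z, x) 0 = x 0 :=
      Fin.snoc_castSucc (α := fun _ : Fin (L + 2) => Fin n → Fin 2) z x 0
    have hc : ∀ l : Fin (L + 1),
        Fin.snocEquiv (fun _ : Fin (L + 2) => Fin n → Fin 2) (z, x) l.castSucc = x l :=
      fun l => Fin.snoc_castSucc (α := fun _ : Fin (L + 2) => Fin n → Fin 2) z x l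
    have hs : ∀ l : Fin L,
        Fin.snocEquiv (fun _ : Fin (L + 2) => Fin n → Fin 2) (z, x) l.castSucc.succ = x l.succ := by
      intro l; rw [Fin.succ_castSucc, hc]
    simp only [h0, hc, hs, Fin.succ_last, hz, Fin.val_castSucc, Fin.val_last]
    ring

/-! ### Detectors -/

lemma detect_eq_sum (k : Mode) (n : ℕ) (f : Fock) {s : Finset (Mode →₀ ℕ)} (hs : f.support ⊆ s) :
    detect k n f = ∑ m ∈ s with m k = n,
      MvPolynomial.monomial (m.erase k) ((Real.sqrt (n.factorial : ℝ) : ℂ) * f.coeff m) := by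
  unfold detect
  refine Finset.sum_subset (Finset.filter_subset_filter _ hs) fun m hm hm' => ?_
  have : f.coeff m = 0 := by
    by_contra h
    exact hm' (Finset.mem_filter.2 ⟨MvPolynomial.mem_support_iff.2 h, (Finset.mem_filter.1 hm).2⟩)
  simp [this]

/-- A detector as a linear map. -/
def detectL (k : Mode) (n : ℕ) : Fock →ₗ[ℂ] Fock where
  toFun := detect k n
  map_add' f g := by
    rw [detect_eq_sum k n f Finset.subset_union_left, detect_eq_sum k n g Finset.subset_union_right,
      detect_eq_sum k n (f + g) MvPolynomial.support_add, ← Finset.sum_add_distrib]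
    exact Finset.sum_congr rfl fun m _ => by rw [MvPolynomial.coeff_add, mul_add, map_add]
  map_smul' c f := by
    rw [detect_eq_sum k n (c • f) MvPolynomial.support_smul, detect, Finset.smul_sum]
    exact Finset.sum_congr rfl fun m _ => by
      rw [MvPolynomial.coeff_smul, MvPolynomial.smul_monomial, smul_eq_mul, smul_eq_mul]
      simp only [RingHom.id_apply]
      ring_nf

lemma detectL_apply (k : Mode) (n : ℕ) (f : Fock) : detectL k n f = detect k n f := rfl

lemma detect_monomial (k : Mode) (n : ℕ) (m : Mode →₀ ℕ) (c : ℂ) :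
    detect k n (MvPolynomial.monomial m c) = if m k = n then
      MvPolynomial.monomial (m.erase k) ((Real.sqrt (n.factorial : ℝ) : ℂ) * c) else 0 := by
  rw [detect_eq_sum k n _ MvPolynomial.support_monomial_subset, Finset.sum_filter,
    Finset.sum_singleton]
  simp

lemma supported_induction {s : Set Mode} {P : Fock → Prop} {g : Fock}
    (hg : g ∈ MvPolynomial.supported ℂ s) (h0 : P 0) (hadd : ∀ f g, P f → P g → P (f + g))
    (hmon : ∀ (m : Mode →₀ ℕ) (c : ℂ), (∀ k, k ∉ s → m k = 0) → P (MvPolynomial.monomial m c)) :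
    P g := by
  rw [← MvPolynomial.support_sum_monomial_coeff g]
  refine Finset.sum_induction _ P hadd h0 fun m hm => hmon m _ fun k hk => ?_
  by_contra h
  refine hk (MvPolynomial.mem_supported.1 hg (Finset.mem_coe.2 ?_))
  exact (MvPolynomial.mem_vars_iff_mem_support k).2 ⟨m, hm, Finsupp.mem_support_iff.2 h⟩

/-- A detector does not act on factors without photons in its mode. -/
lemma detect_mul (k : Mode) (n : ℕ) (f : Fock) {g : Fock}
    (hg : g ∈ MvPolynomial.supported ℂ {j : Mode | j ≠ k}) :
    detect k n (f * g) = detect k n f * g := by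
  refine supported_induction (P := fun g => detect k n (f * g) = detect k n f * g) hg ?_ ?_ ?_
  · rw [mul_zero, mul_zero, ← detectL_apply, map_zero]
  · intro g₁ g₂ h₁ h₂
    rw [mul_add, mul_add, ← detectL_apply, map_add, detectL_apply, detectL_apply, h₁, h₂]
  · intro m c hm
    have hm : m k = 0 := hm k (by simp)
    induction f using MvPolynomial.induction_on' with
    | monomial m' c' =>
      rw [MvPolynomial.monomial_mul, detect_monomial, detect_monomial]
      by_cases h : m' k = n
      · have he : (m' + m).erase k = m'.erase k + m := by
          ext j
          by_cases hj : j = k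
          · subst hj; simp [hm]
          · simp [Finsupp.erase_ne hj]
        simp [h, hm, he, MvPolynomial.monomial_mul, mul_assoc]
      · simp [h, hm]
    | add p q hp hq =>
      rw [add_mul, ← detectL_apply, ← detectL_apply, map_add, map_add, detectL_apply,
        detectL_apply, detectL_apply, detectL_apply, hp, hq, add_mul]

lemma detect_X_pow_mul (k : Mode) (n i : ℕ) {g : Fock}
    (hg : g ∈ MvPolynomial.supported ℂ {j : Mode | j ≠ k}) :
    detect k n (MvPolynomial.X k ^ i * g) =
      if i = n then MvPolynomial.C (Real.sqrt (n.factorial : ℝ) : ℂ) * g else 0 := by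
  rw [detect_mul k n _ hg, MvPolynomial.X_pow_eq_monomial, detect_monomial]
  by_cases h : i = n
  · subst h
    simp
  · simp [h]

/-- All detectors as a linear map. -/
def detectAllL (o : Outcome) : Fock →ₗ[ℂ] Fock :=
  detectL (.fus 0, 1) o.a ∘ₗ detectL (.fus 1, 0) o.b ∘ₗ detectL (.fus 0, 0) o.c ∘ₗ
    detectL (.fus 1, 1) o.d ∘ₗ detectL (.meas, 0) o.m₀ ∘ₗ detectL (.meas, 1) o.m₁

lemma detectAllL_apply (o : Outcome) (f : Fock) : detectAllL o f = detectAll o f := rfl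

/-- The modes that are not connected to a detector. -/
def Undetected : Set Mode := {k | k.1 ≠ .fus 0 ∧ k.1 ≠ .fus 1 ∧ k.1 ≠ .meas}

lemma detectAll_mul (o : Outcome) (f : Fock) {g : Fock}
    (hg : g ∈ MvPolynomial.supported ℂ Undetected) : detectAll o (f * g) = detectAll o f * g := by
  have h : ∀ k : Mode, k ∉ Undetected → g ∈ MvPolynomial.supported ℂ {j : Mode | j ≠ k} :=
    fun k hk => MvPolynomial.supported_mono (fun j hj (e : j = k) => hk (e ▸ hj)) hg
  unfold detectAll
  rw [detect_mul _ _ _ (h _ (by simp [Undetected])), detect_mul _ _ _ (h _ (by simp [Undetected])),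
    detect_mul _ _ _ (h _ (by simp [Undetected])), detect_mul _ _ _ (h _ (by simp [Undetected])),
    detect_mul _ _ _ (h _ (by simp [Undetected])), detect_mul _ _ _ (h _ (by simp [Undetected]))]

/-- Equality of outcomes is decided classically. -/
instance : DecidableEq Outcome := Classical.decEq _

/-- The monomial in which each detector receives the number of photons given by the outcome. -/
def Outcome.mon (o : Outcome) : Fock :=
  MvPolynomial.X ((.meas, 1) : Mode) ^ o.m₁ * (MvPolynomial.X ((.meas, 0) : Mode) ^ o.m₀ *
  (MvPolynomial.X ((.fus 1, 1) : Mode) ^ o.d * (MvPolynomial.X ((.fus 0, 0) : Mode) ^ o.c *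
  (MvPolynomial.X ((.fus 1, 0) : Mode) ^ o.b * (MvPolynomial.X ((.fus 0, 1) : Mode) ^ o.a * 1)))))

/-- The weight `√(∏ n!)` that the detectors give to their monomial. -/
def Outcome.weight (o : Outcome) : ℂ :=
  Real.sqrt (o.m₁.factorial : ℝ) * (Real.sqrt (o.m₀.factorial : ℝ) *
  (Real.sqrt (o.d.factorial : ℝ) * (Real.sqrt (o.c.factorial : ℝ) *
  (Real.sqrt (o.b.factorial : ℝ) * Real.sqrt (o.a.factorial : ℝ)))))

lemma detect_C_mul (k : Mode) (n : ℕ) (c : ℂ) (f : Fock) :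
    detect k n (MvPolynomial.C c * f) = MvPolynomial.C c * detect k n f := by
  rw [← MvPolynomial.smul_eq_C_mul, ← MvPolynomial.smul_eq_C_mul, ← detectL_apply, map_smul,
    detectL_apply]

lemma detectAll_mon (o o' : Outcome) :
    detectAll o' o.mon = if o = o' then MvPolynomial.C o.weight else 0 := by
  have hX : ∀ {j k : Mode} (i : ℕ), j ≠ k →
      (MvPolynomial.X j ^ i : Fock) ∈ MvPolynomial.supported ℂ {l : Mode | l ≠ k} :=
    fun i h => pow_mem (MvPolynomial.X_mem_supported.2 h) i
  have h0 : ∀ k n, detect k n 0 = 0 := fun k n => by rw [← detectL_apply, map_zero]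
  obtain ⟨a, b, c, d, m₀, m₁⟩ := o
  obtain ⟨a', b', c', d', m₀', m₁'⟩ := o'
  simp only [detectAll, Outcome.mon, Outcome.weight, Outcome.mk.injEq]
  rw [detect_X_pow_mul]
  swap
  · refine mul_mem (hX _ ?_) (mul_mem (hX _ ?_) (mul_mem (hX _ ?_) (mul_mem (hX _ ?_)
      (mul_mem (hX _ ?_) (one_mem _))))) <;> decide
  by_cases h₁ : m₁ = m₁'
  swap
  · simp [h₁, h0]
  rw [if_pos h₁]
  simp only [detect_C_mul]
  rw [detect_X_pow_mul]
  swap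
  · refine mul_mem (hX _ ?_) (mul_mem (hX _ ?_) (mul_mem (hX _ ?_) (mul_mem (hX _ ?_)
      (one_mem _)))) <;> decide
  by_cases h₂ : m₀ = m₀'
  swap
  · simp [h₂, h0]
  rw [if_pos h₂]
  simp only [detect_C_mul]
  rw [detect_X_pow_mul]
  swap
  · refine mul_mem (hX _ ?_) (mul_mem (hX _ ?_) (mul_mem (hX _ ?_) (one_mem _))) <;> decide
  by_cases h₃ : d = d'
  swap
  · simp [h₃, h0]
  rw [if_pos h₃]
  simp only [detect_C_mul]
  rw [detect_X_pow_mul]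
  swap
  · refine mul_mem (hX _ ?_) (mul_mem (hX _ ?_) (one_mem _)) <;> decide
  by_cases h₄ : c = c'
  swap
  · simp [h₄, h0]
  rw [if_pos h₄]
  simp only [detect_C_mul]
  rw [detect_X_pow_mul]
  swap
  · refine mul_mem (hX _ ?_) (one_mem _)
    decide
  by_cases h₅ : b = b'
  swap
  · simp [h₅, h0]
  rw [if_pos h₅]
  simp only [detect_C_mul]
  rw [detect_X_pow_mul _ _ _ (one_mem _)]
  by_cases h₆ : a = a'
  swap
  · simp [h₆]
  subst h₁ h₂ h₃ h₄ h₅ h₆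
  simp [MvPolynomial.C_mul]

/-! ### Fusions and measurements of photons in definite rails -/

lemma phaseShift_X (k : Mode) (θ : ℝ) (j : Mode) : phaseShift k θ (MvPolynomial.X j) =
    if j = k then MvPolynomial.C (Complex.exp (θ * Complex.I)) * MvPolynomial.X j
    else MvPolynomial.X j := by
  simp [phaseShift]

lemma beamSplitter_X (k l j : Mode) : beamSplitter k l (MvPolynomial.X j) =
    if j = k then
      MvPolynomial.C ((1 / Real.sqrt 2 : ℝ) : ℂ) * (MvPolynomial.X k + MvPolynomial.X l)
    else if j = l then
      MvPolynomial.C ((1 / Real.sqrt 2 : ℝ) : ℂ) * (MvPolynomial.X k - MvPolynomial.X l)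
    else MvPolynomial.X j := by
  simp [beamSplitter]

lemma exp_pi_div_two : Complex.exp ((Real.pi / 2 : ℝ) * Complex.I) = Complex.I := by
  push_cast
  exact Complex.exp_pi_div_two_mul_I

/-- The eigenvalues of the phase gate `diag(1, i)`. -/
def ii (b : Fin 2) : ℂ := if b = 0 then 1 else Complex.I

/-- The result of the fusion circuit on two photons in the rails `b₀` and `b₁`. -/
lemma rusCircuit_false (b₀ b₁ : Fin 2) :
    rusCircuit false .Y (MvPolynomial.X (.fus 0, b₀) * MvPolynomial.X (.fus 1, b₁)) =
      (1 / 4 : ℂ) • ii b₀ • ii b₁ • (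
        (1 + Complex.I * sg b₀ * sg b₁) • (Outcome.mk 1 0 1 0 0 0).mon
        + (-1 + Complex.I * sg b₀ * sg b₁) • (Outcome.mk 0 1 1 0 0 0).mon
        + (1 - Complex.I * sg b₀ * sg b₁) • (Outcome.mk 1 0 0 1 0 0).mon
        + (-1 - Complex.I * sg b₀ * sg b₁) • (Outcome.mk 0 1 0 1 0 0).mon
        + sg b₀ • (Outcome.mk 2 0 0 0 0 0).mon - sg b₀ • (Outcome.mk 0 2 0 0 0 0).mon
        + (Complex.I * sg b₁) • (Outcome.mk 0 0 2 0 0 0).mon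
        - (Complex.I * sg b₁) • (Outcome.mk 0 0 0 2 0 0).mon) := by
  have hq : (MvPolynomial.C ((Real.sqrt 2 : ℝ) : ℂ)⁻¹ : Fock) ^ 4 = MvPolynomial.C (4 : ℂ)⁻¹ := by
    rw [← MvPolynomial.C_pow, show ((Real.sqrt 2 : ℝ) : ℂ)⁻¹ ^ 4 =
      (((Real.sqrt 2 : ℝ) : ℂ)⁻¹ * ((Real.sqrt 2 : ℝ) : ℂ)⁻¹) ^ 2 by ring, sqrt_two_inv_mul_self]
    norm_num
  have hi : (MvPolynomial.C Complex.I : Fock) ^ 2 = -1 := by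
    rw [← MvPolynomial.C_pow, Complex.I_sq]; simp
  simp only [rusCircuit, fusionCircuit, FusionKind.angle, FusionKind.finalAngle, hadamard, rotZ]
  fin_cases b₀ <;> fin_cases b₁ <;>
  · simp [phaseShift_X, beamSplitter_X, Outcome.mon, ii, MvPolynomial.smul_eq_C_mul]
    generalize (MvPolynomial.C Complex.I : Fock) = x at *
    generalize (MvPolynomial.C (Real.sqrt 2 : ℂ)⁻¹ : Fock) = w at *
    generalize (MvPolynomial.C (4 : ℂ)⁻¹ : Fock) = q at *
    grind

lemma measCircuit_XY_X (w : Wire) (θ : ℝ) (b : Fin 2) :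
    measCircuit w .XY θ (MvPolynomial.X (w, b)) =
      (((Real.sqrt 2 : ℝ) : ℂ)⁻¹ * if b = 0 then 1 else Complex.exp (-(θ * Complex.I))) •
        (MvPolynomial.X (w, 0) + sg b • MvPolynomial.X (w, 1)) := by
  simp only [measCircuit, hadamard, rotZ]
  fin_cases b <;> simp [phaseShift_X, beamSplitter_X, MvPolynomial.smul_eq_C_mul] <;> ring

lemma measCircuit_X_ne (w : Wire) (p : Plane) (θ : ℝ) (j : Mode) (hj : j.1 ≠ w) :
    measCircuit w p θ (MvPolynomial.X j) = MvPolynomial.X j := by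
  have h : ∀ b, j ≠ (w, b) := fun b e => hj (e ▸ rfl)
  cases p <;> simp [measCircuit, hadamard, rotZ, phaseShift_X, beamSplitter_X, h]

/-- The result of separate measurements of two photons in the rails `b₀` and `b₁`. -/
lemma rusCircuit_true (b₀ b₁ : Fin 2) :
    rusCircuit true .Y (MvPolynomial.X (.fus 0, b₀) * MvPolynomial.X (.fus 1, b₁)) =
      (1 / 2 : ℂ) • ii b₀ • ii b₁ • (
        (Outcome.mk 0 1 1 0 0 0).mon + sg b₁ • (Outcome.mk 0 0 1 1 0 0).mon
        + sg b₀ • (Outcome.mk 1 1 0 0 0 0).mon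
        + (sg b₀ * sg b₁) • (Outcome.mk 1 0 0 1 0 0).mon) := by
  have hq : (MvPolynomial.C ((Real.sqrt 2 : ℝ) : ℂ)⁻¹ : Fock) ^ 2 = MvPolynomial.C (1 / 2 : ℂ) := by
    rw [← MvPolynomial.C_pow, pow_two, sqrt_two_inv_mul_self]
  simp only [rusCircuit, if_true, FusionKind.angle, AlgHom.comp_apply, map_mul, measCircuit_XY_X]
  rw [measCircuit_X_ne _ _ _ (.fus 1, b₁) (by simp), measCircuit_XY_X]
  simp only [map_smul, map_add, measCircuit_X_ne (.fus 1) _ _ (.fus 0, _)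
    (show (Wire.fus 0) ≠ .fus 1 by decide)]
  have he : ∀ b : Fin 2, (if b = 0 then (1 : ℂ) else
      Complex.exp (-(((-(Real.pi / 2) : ℝ) : ℂ) * Complex.I))) = ii b := by
    intro b
    rw [← exp_pi_div_two]
    unfold ii
    simp
  rw [he, he]
  simp only [MvPolynomial.smul_eq_C_mul, MvPolynomial.C_mul, Outcome.mon, pow_zero, pow_one,
    one_mul, mul_one]
  rw [← hq]
  ring

/-- Outcome of a measurement on the input of the correction module. -/
def measOut (m : Fin 2) : Outcome := ⟨0, 0, 0, 0, if m = 0 then 1 else 0, if m = 0 then 0 else 1⟩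

lemma detectAll_measCircuit_XY (m b : Fin 2) :
    detectAll (measOut m) (measCircuit .meas .XY 0 (MvPolynomial.X (.meas, b))) =
      MvPolynomial.C (((Real.sqrt 2 : ℝ) : ℂ)⁻¹ * sg (m * b)) := by
  have h : measCircuit .meas .XY 0 (MvPolynomial.X (.meas, b)) = ((Real.sqrt 2 : ℝ) : ℂ)⁻¹ •
      ((measOut 0).mon + sg b • (measOut 1).mon) := by
    rw [measCircuit_XY_X]
    simp [Outcome.mon, measOut]
  rw [h, ← detectAllL_apply]
  simp only [map_smul, map_add, detectAllL_apply, detectAll_mon]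
  fin_cases m <;> simp [measOut, Outcome.weight, MvPolynomial.smul_eq_C_mul]

lemma detectAll_measCircuit_YZ (m b : Fin 2) (α : ℝ) :
    detectAll (measOut m) (measCircuit .meas .YZ α (MvPolynomial.X (.meas, b))) =
      MvPolynomial.C ((1 + sg m * sg b * Complex.exp (-(α * Complex.I))) / 2) := by
  have hq : (MvPolynomial.C ((Real.sqrt 2 : ℝ) : ℂ)⁻¹ : Fock) ^ 2 = MvPolynomial.C (2 : ℂ)⁻¹ := by
    rw [← MvPolynomial.C_pow, pow_two, sqrt_two_inv_mul_self]
    norm_num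
  have h : measCircuit .meas .YZ α (MvPolynomial.X (.meas, b)) = (1 / 2 : ℂ) •
      ((1 + sg b * Complex.exp (-(α * Complex.I))) • (measOut 0).mon +
        (1 - sg b * Complex.exp (-(α * Complex.I))) • (measOut 1).mon) := by
    simp only [measCircuit, hadamard, rotZ]
    fin_cases b <;>
    · simp [phaseShift_X, beamSplitter_X, MvPolynomial.smul_eq_C_mul, Outcome.mon, measOut]
      rw [← hq]
      ring
  rw [h, ← detectAllL_apply]
  simp only [map_smul, map_add, detectAllL_apply, detectAll_mon]
  fin_cases m <;>
  · simp [measOut, Outcome.weight, MvPolynomial.smul_eq_C_mul, div_eq_mul_inv]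
    ring

/-- The outcomes of a failed fusion: both photons are detected in the same mode. -/
def failOut (c : Fin 2 × Fin 2) : Outcome :=
  if c.1 = 0 then if c.2 = 0 then ⟨2, 0, 0, 0, 0, 0⟩ else ⟨0, 2, 0, 0, 0, 0⟩
  else if c.2 = 0 then ⟨0, 0, 2, 0, 0, 0⟩ else ⟨0, 0, 0, 2, 0, 0⟩

/-- The outcomes of a successful fusion. -/
def succOut (c : Fin 2 × Fin 2) : Outcome :=
  if c.1 = 0 then if c.2 = 0 then ⟨1, 0, 1, 0, 0, 0⟩ else ⟨1, 0, 0, 1, 0, 0⟩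
  else if c.2 = 0 then ⟨0, 1, 1, 0, 0, 0⟩ else ⟨0, 1, 0, 1, 0, 0⟩

/-- The outcomes of two separate measurements at the inputs of the fusion module. -/
def sepOut (c : Fin 2 × Fin 2) : Outcome :=
  if c.1 = 0 then if c.2 = 0 then ⟨0, 1, 1, 0, 0, 0⟩ else ⟨0, 0, 1, 1, 0, 0⟩
  else if c.2 = 0 then ⟨1, 1, 0, 0, 0, 0⟩ else ⟨1, 0, 0, 1, 0, 0⟩

/-- The bit with the given truth value. -/
def bitOf (p : Prop) [Decidable p] : Fin 2 := if p then 1 else 0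

/-- The Pauli `Z` by-product on the emitter of the photon at the input `i` of the fusion module;
`d` tells whether the photons were measured separately. -/
def zBit (d : Bool) (o : Outcome) (i : Fin 2) : Fin 2 :=
  if d then if i = 0 then bitOf (o.a = 1) else bitOf (o.d = 1)
  else if o.success then bitOf ((o.a + o.c) % 2 = 1)
  else if i = 0 then bitOf (o.a + o.b = 2) else bitOf (o.c + o.d = 2)

/-- The scalar factor of the Kraus operator of an outcome of the fusion module. -/
def fuseScale (d : Bool) (o : Outcome) : ℂ :=
  MvPolynomial.coeff 0 (detectAll o
    (rusCircuit d .Y (MvPolynomial.X (.fus 0, 0) * MvPolynomial.X (.fus 1, 0))))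

/-- The Kraus operator of an outcome of the fusion module, which is diagonal in the rails: a success
applies a controlled `Z`, anything else a phase gate to each side, both up to Pauli `Z`. -/
def fuseAmp (d : Bool) (o : Outcome) (b₀ b₁ : Fin 2) : ℂ :=
  fuseScale d o * (if !d && o.success then sg (b₀ * b₁) else ii b₀ * ii b₁) *
    sg (zBit d o 0 * b₀) * sg (zBit d o 1 * b₁)

lemma detectAll_add (o : Outcome) (f g : Fock) :
    detectAll o (f + g) = detectAll o f + detectAll o g := map_add (detectAllL o) f g

lemma detectAll_sub (o : Outcome) (f g : Fock) :
    detectAll o (f - g) = detectAll o f - detectAll o g := map_sub (detectAllL o) f g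

lemma detectAll_smul (o : Outcome) (c : ℂ) (f : Fock) :
    detectAll o (c • f) = c • detectAll o f := map_smul (detectAllL o) c f

@[simp] lemma ii_zero : ii 0 = 1 := rfl
@[simp] lemma ii_one : ii 1 = Complex.I := rfl

lemma smul_C (c x : ℂ) : c • (MvPolynomial.C x : Fock) = MvPolynomial.C (c * x) := by
  rw [MvPolynomial.smul_eq_C_mul, MvPolynomial.C_mul]

lemma detectAll_mon' (o o' : Outcome) :
    detectAll o' o.mon = MvPolynomial.C (if o = o' then o.weight else 0) := by
  rw [detectAll_mon]
  split_ifs <;> simp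

lemma detectAll_fail (c : Fin 2 × Fin 2) (b₀ b₁ : Fin 2) :
    detectAll (failOut c)
      (rusCircuit false .Y (MvPolynomial.X (.fus 0, b₀) * MvPolynomial.X (.fus 1, b₁))) =
    MvPolynomial.C (((Real.sqrt 2 : ℝ) : ℂ) / 4 * sg c.2 * ii c.1 * (ii b₀ * ii b₁) *
      if c.1 = 0 then sg b₀ else sg b₁) := by
  rw [rusCircuit_false]
  simp only [detectAll_add, detectAll_sub, detectAll_smul, detectAll_mon', smul_C, ← map_add,
    ← map_sub]
  congr 1
  obtain ⟨c₁, c₂⟩ := c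
  fin_cases c₁ <;> fin_cases c₂ <;>
  · simp [failOut, Outcome.weight]
    try ring

lemma detectAll_succ (c : Fin 2 × Fin 2) (b₀ b₁ : Fin 2) :
    detectAll (succOut c)
      (rusCircuit false .Y (MvPolynomial.X (.fus 0, b₀) * MvPolynomial.X (.fus 1, b₁))) =
    MvPolynomial.C (sg c.1 * (1 + sg (c.1 + c.2) * Complex.I) / 4 * sg (b₀ * b₁) *
      sg ((c.1 + c.2) * b₀) * sg ((c.1 + c.2) * b₁)) := by
  rw [rusCircuit_false]
  simp only [detectAll_add, detectAll_sub, detectAll_smul, detectAll_mon', smul_C, ← map_add,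
    ← map_sub]
  congr 1
  have hI := Complex.I_mul_I
  obtain ⟨c₁, c₂⟩ := c
  fin_cases c₁ <;> fin_cases c₂ <;>
  · simp [succOut, Outcome.weight]
    fin_cases b₀ <;> fin_cases b₁ <;> simp [ii] <;> grind

lemma detectAll_sep (c : Fin 2 × Fin 2) (b₀ b₁ : Fin 2) :
    detectAll (sepOut c)
      (rusCircuit true .Y (MvPolynomial.X (.fus 0, b₀) * MvPolynomial.X (.fus 1, b₁))) =
    MvPolynomial.C (1 / 2 * (ii b₀ * ii b₁) * sg (c.1 * b₀) * sg (c.2 * b₁)) := by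
  rw [rusCircuit_true]
  simp only [detectAll_add, detectAll_smul, detectAll_mon', smul_C, ← map_add]
  congr 1
  obtain ⟨c₁, c₂⟩ := c
  fin_cases c₁ <;> fin_cases c₂ <;>
  · simp [sepOut, Outcome.weight]
    try ring

lemma success_failOut (c : Fin 2 × Fin 2) : (failOut c).success = false := by
  obtain ⟨c₁, c₂⟩ := c
  fin_cases c₁ <;> fin_cases c₂ <;> rfl

lemma success_succOut (c : Fin 2 × Fin 2) : (succOut c).success = true := by
  obtain ⟨c₁, c₂⟩ := c
  fin_cases c₁ <;> fin_cases c₂ <;> rfl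

lemma detectAll_rus_fail (c : Fin 2 × Fin 2) (b₀ b₁ : Fin 2) :
    detectAll (failOut c)
      (rusCircuit false .Y (MvPolynomial.X (.fus 0, b₀) * MvPolynomial.X (.fus 1, b₁))) =
    MvPolynomial.C (fuseAmp false (failOut c) b₀ b₁) := by
  rw [fuseAmp, fuseScale, detectAll_fail, detectAll_fail, success_failOut]
  congr 1
  obtain ⟨c₁, c₂⟩ := c
  fin_cases c₁ <;> fin_cases c₂ <;>
    simp [failOut, zBit, bitOf, ii, Outcome.success]

lemma detectAll_rus_succ (c : Fin 2 × Fin 2) (b₀ b₁ : Fin 2) :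
    detectAll (succOut c)
      (rusCircuit false .Y (MvPolynomial.X (.fus 0, b₀) * MvPolynomial.X (.fus 1, b₁))) =
    MvPolynomial.C (fuseAmp false (succOut c) b₀ b₁) := by
  rw [fuseAmp, fuseScale, detectAll_succ, detectAll_succ, success_succOut]
  congr 1
  obtain ⟨c₁, c₂⟩ := c
  fin_cases c₁ <;> fin_cases c₂ <;>
    simp [succOut, zBit, bitOf, Outcome.success]

lemma detectAll_rus_sep (c : Fin 2 × Fin 2) (b₀ b₁ : Fin 2) :
    detectAll (sepOut c)
      (rusCircuit true .Y (MvPolynomial.X (.fus 0, b₀) * MvPolynomial.X (.fus 1, b₁))) =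
    MvPolynomial.C (fuseAmp true (sepOut c) b₀ b₁) := by
  rw [fuseAmp, fuseScale, detectAll_sep, detectAll_sep]
  congr 1
  obtain ⟨c₁, c₂⟩ := c
  fin_cases c₁ <;> fin_cases c₂ <;>
    simp [sepOut, zBit, bitOf, ii]

@[simp] lemma norm_ii (b : Fin 2) : ‖ii b‖ = 1 := by
  unfold ii
  split_ifs <;> simp

lemma norm_fuseScale_fail (c : Fin 2 × Fin 2) : ‖fuseScale false (failOut c)‖ ^ 2 = 1 / 8 := by
  rw [fuseScale, detectAll_fail, MvPolynomial.coeff_zero_C]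
  simp [div_pow, Real.sq_sqrt, abs_of_nonneg]
  norm_num

lemma norm_fuseScale_succ (c : Fin 2 × Fin 2) : ‖fuseScale false (succOut c)‖ ^ 2 = 1 / 8 := by
  rw [fuseScale, detectAll_succ, MvPolynomial.coeff_zero_C]
  have h : ‖1 + sg (c.1 + c.2) * Complex.I‖ ^ 2 = 2 := by
    rw [← Complex.normSq_eq_norm_sq]
    rcases Fin.exists_fin_two.1 ⟨c.1 + c.2, rfl⟩ with h | h <;>
      rw [h] <;> simp [Complex.normSq_apply] <;> norm_num
  simp [div_pow, h]
  norm_num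

lemma norm_fuseScale_sep (c : Fin 2 × Fin 2) : ‖fuseScale true (sepOut c)‖ ^ 2 = 1 / 4 := by
  rw [fuseScale, detectAll_sep, MvPolynomial.coeff_zero_C]
  simp [ii]
  norm_num

lemma correct_X (w : Wire) (x z b : Fin 2) :
    correct w (decide (x = 1)) (decide (z = 1)) (MvPolynomial.X (w, b)) =
      MvPolynomial.C (sg ((b + x) * z)) * MvPolynomial.X (w, b + x) := by
  fin_cases x <;> fin_cases z <;> fin_cases b <;>
    simp [correct, rotZ, phaseShift_X]

/-! ### Components act on their own modes only -/

lemma algHom_eq_self {φ : Fock →ₐ[ℂ] Fock} {s : Set Mode}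
    (h : ∀ k ∈ s, φ (MvPolynomial.X k) = MvPolynomial.X k) {g : Fock}
    (hg : g ∈ MvPolynomial.supported ℂ s) : φ g = g := by
  have := MvPolynomial.hom_congr_vars (f₁ := φ.toRingHom) (f₂ := RingHom.id Fock) (p₁ := g)
    (p₂ := g) (by ext; simp) (fun i hi _ => h i (MvPolynomial.mem_supported.1 hg hi)) rfl
  exact this

lemma rusCircuit_X {k : Mode} (hk : k ∈ Undetected) (d : Bool) (t : FusionKind) :
    rusCircuit d t (MvPolynomial.X k) = MvPolynomial.X k := by
  have h0 : ∀ b, k ≠ (.fus 0, b) := fun b e => hk.1 (e ▸ rfl)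
  have h1 : ∀ b, k ≠ (.fus 1, b) := fun b e => hk.2.1 (e ▸ rfl)
  cases d
  · simp [rusCircuit, fusionCircuit, hadamard, rotZ, phaseShift_X, beamSplitter_X, h0, h1]
  · simp [rusCircuit, measCircuit_X_ne _ _ _ k hk.1, measCircuit_X_ne _ _ _ k hk.2.1]

lemma rusCircuit_X_meas (b : Fin 2) (d : Bool) (t : FusionKind) :
    rusCircuit d t (MvPolynomial.X (.meas, b)) = MvPolynomial.X (.meas, b) := by
  cases d
  · simp [rusCircuit, fusionCircuit, hadamard, rotZ, phaseShift_X, beamSplitter_X]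
  · simp [rusCircuit, measCircuit_X_ne]

lemma correct_X_ne {w : Wire} {k : Mode} (hk : k.1 ≠ w) (x z : Bool) :
    correct w x z (MvPolynomial.X k) = MvPolynomial.X k := by
  have h : ∀ b, k ≠ (w, b) := fun b e => hk (e ▸ rfl)
  cases x <;> cases z <;>
    simp [correct, rotZ, phaseShift_X, h, Equiv.swap_apply_of_ne_of_ne]

lemma correctAndMeasure_X {m n : ℕ} (s : Settings m n) (t : ℕ) (past : List Outcome) {k : Mode}
    (hk : k.1 ≠ .meas) : s.correctAndMeasure t past (MvPolynomial.X k) = MvPolynomial.X k := by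
  unfold Settings.correctAndMeasure
  rw [AlgHom.comp_apply, correct_X_ne hk]
  split
  · exact measCircuit_X_ne _ _ _ _ hk
  · simp [rewire, hk]

/-! ### Graph states: schedule and settings -/

/-- What happens at a time step. The emitter runs through the vertices of a graph, one after the
other; it emits the photon that reads out the vertex `v` (`emit v`), the photons that are used for
the edges (`leg e j i`, for the attempt `j` to create the edge `e` at its end `i`), and a photon
that is measured at once to disentangle the emitter (`cut v`). Afterwards the attempts to create
the edges (`fuse e j`) and the readouts (`read v`) are carried out. -/
inductive Task (V E : Type) (k : ℕ) where
  | emit (v : V) : Task V E k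
  | leg (e : E) (j : Fin k) (i : Fin 2) : Task V E k
  | cut (v : V) : Task V E k
  | fuse (e : E) (j : Fin k) : Task V E k
  | read (v : V) : Task V E k
  deriving DecidableEq

/-- How a vertex is read out: released as an output, measured in the `XY` plane at angle `0`, or
measured in the `YZ` plane. -/
inductive Readout where
  | out : Readout
  | xy : Readout
  | yz (α : ℝ) : Readout

/-- The tasks whose outcome is known when the vertex `v` is read out. -/
def Task.Before {V E : Type} {k : ℕ} (rank : V → ℕ) (v : V) : Task V E k → Prop
  | .read u => rank u < rank v
  | _ => True

/-- A measurement-based computation on the graph with vertices `V` and edges `E`, in which there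
are `k` attempts to create each edge. The vertices are emitted and read out by increasing `rank`.
The corrections `x` and `z` may use the outcomes of all tasks that are carried out earlier. -/
structure Plan (V E : Type) (k m n : ℕ) where
  ends : E → Fin 2 → V
  rank : V → ℕ
  inp : Fin m → V
  inp_strictMono : StrictMono fun i => rank (inp i)
  outp : Fin n → V
  outp_strictMono : StrictMono fun i => rank (outp i)
  readout : V → Readout
  readout_eq_out : ∀ v, readout v = .out ↔ ∃ i, outp i = v
  x : V → (Task V E k → Outcome) → Fin 2
  z : V → (Task V E k → Outcome) → Fin 2
  x_congr : ∀ v ω ω', (∀ a, Task.Before rank v a → ω a = ω' a) → x v ω = x v ω'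
  z_congr : ∀ v ω ω', (∀ a, Task.Before rank v a → ω a = ω' a) → z v ω = z v ω'

/-- No photon is detected. -/
def noPhoton : Outcome := ⟨0, 0, 0, 0, 0, 0⟩

/-- The record of outcomes (latest first) of a list of tasks. -/
def hist {V E : Type} {k : ℕ} (ω : Task V E k → Outcome) (l : List (Task V E k)) : List Outcome :=
  (l.map ω).reverse

namespace Plan

variable {V E : Type} [Fintype V] [DecidableEq V] [Fintype E] [DecidableEq E] {k m n : ℕ}
  (P : Plan V E k m n)

/-- The vertices by increasing rank. -/
def vlist : List V := List.insertionSort (fun u v => P.rank u ≤ P.rank v) Finset.univ.toList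

lemma vlist_perm : P.vlist.Perm Finset.univ.toList := List.perm_insertionSort _ _

lemma mem_vlist (v : V) : v ∈ P.vlist := by simp [P.vlist_perm.mem_iff]

lemma nodup_vlist : P.vlist.Nodup := P.vlist_perm.nodup_iff.2 (Finset.nodup_toList _)

lemma pairwise_vlist : P.vlist.Pairwise fun u v => P.rank u ≤ P.rank v := by
  have : Std.Total fun u v : V => P.rank u ≤ P.rank v := ⟨fun u v => le_total _ _⟩
  have : IsTrans V fun u v => P.rank u ≤ P.rank v := ⟨fun _ _ _ h h' => h.trans h'⟩
  exact List.pairwise_insertionSort _ _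

lemma mem_of_rank_lt {vs vs' : List V} {u v : V} (h : P.vlist = vs ++ v :: vs')
    (huv : P.rank u < P.rank v) : u ∈ vs := by
  have hu := P.mem_vlist u
  have hp := P.pairwise_vlist
  rw [h] at hu hp
  rcases List.mem_append.1 hu with hu | hu
  · exact hu
  · rcases List.mem_cons.1 hu with rfl | hu
    · exact absurd huv (lt_irrefl _)
    · have := (List.pairwise_cons.1 (List.pairwise_append.1 hp).2.1).1 u hu
      omega

/-- The emission of the photons of the vertex `v` that are used for edges. -/
def legs (v : V) : List (Task V E k) :=
  (Finset.univ.filter fun p : E × Fin k × Fin 2 => P.ends p.1 p.2.2 = v).toList.map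
    fun p => .leg p.1 p.2.1 p.2.2

lemma mem_legs {v : V} {a : Task V E k} :
    a ∈ P.legs v ↔ ∃ e j i, P.ends e i = v ∧ a = .leg e j i := by
  simp only [legs, List.mem_map, Finset.mem_toList, Finset.mem_filter, Finset.mem_univ, true_and,
    Prod.exists]
  exact ⟨fun ⟨e, j, i, h, h'⟩ => ⟨e, j, i, h, h'.symm⟩,
    fun ⟨e, j, i, h, h'⟩ => ⟨e, j, i, h, h'.symm⟩⟩

/-- The emission of all photons of the vertex `v`. -/
def block (v : V) : List (Task V E k) := .emit v :: (P.legs v ++ [.cut v])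

/-- The attempts to create the edge `e`. -/
def fuses (k : ℕ) (e : E) : List (Task V E k) := (List.finRange k).map (.fuse e)

/-- All tasks, in the order in which they are carried out. -/
def prog : List (Task V E k) :=
  P.vlist.flatMap P.block ++ ((Finset.univ : Finset E).toList.flatMap (fuses k) ++
    P.vlist.map .read)

lemma mem_prog (a : Task V E k) : a ∈ P.prog := by
  simp only [prog, List.mem_append, List.mem_flatMap, List.mem_map, Finset.mem_toList, fuses]
  cases a with
  | emit v => exact .inl ⟨v, P.mem_vlist v, by simp [block]⟩
  | leg e j i => exact .inl ⟨_, P.mem_vlist (P.ends e i),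
      List.mem_cons_of_mem _ (List.mem_append_left _ (P.mem_legs.2 ⟨e, j, i, rfl, rfl⟩))⟩
  | cut v => exact .inl ⟨v, P.mem_vlist v, by simp [block]⟩
  | fuse e j => exact .inr (.inl ⟨e, Finset.mem_univ e, j, List.mem_finRange j, rfl⟩)
  | read v => exact .inr (.inr ⟨v, P.mem_vlist v, rfl⟩)

lemma nodup_prog : P.prog.Nodup := by
  have hblock : ∀ v a, a ∈ P.block v ↔ a = .emit v ∨ (∃ e j i, P.ends e i = v ∧ a = .leg e j i) ∨
      a = .cut v := by
    intro v a
    simp only [block, List.mem_cons, List.mem_append, mem_legs, List.not_mem_nil, or_false]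
  have hleg : Function.Injective fun p : E × Fin k × Fin 2 =>
      (Task.leg p.1 p.2.1 p.2.2 : Task V E k) := by
    rintro ⟨e, j, i⟩ ⟨e', j', i'⟩ h
    simpa using h
  refine List.nodup_append'.2 ⟨List.nodup_flatMap.2 ⟨fun v _ => ?_, ?_⟩,
    List.nodup_append'.2 ⟨List.nodup_flatMap.2 ⟨fun e _ => ?_, ?_⟩, ?_, ?_⟩, ?_⟩
  · refine List.nodup_cons.2 ⟨by simp [mem_legs], List.nodup_append'.2 ⟨?_, by simp, ?_⟩⟩
    · exact (Finset.nodup_toList _).map hleg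
    · intro a ha hb
      obtain ⟨e, j, i, -, rfl⟩ := P.mem_legs.1 ha
      simp at hb
  · refine P.nodup_vlist.imp fun {u v} huv => ?_
    intro a ha hb
    rw [hblock] at ha hb
    rcases ha with rfl | ⟨e, j, i, he, rfl⟩ | rfl <;>
      rcases hb with hb | ⟨e', j', i', he', hb⟩ | hb <;> simp_all
  · exact (List.nodup_finRange k).map fun _ _ h => by simpa using h
  · refine (Finset.nodup_toList _).imp fun {e e'} he => ?_
    intro a ha hb
    obtain ⟨j, -, rfl⟩ := List.mem_map.1 ha
    obtain ⟨j', -, h⟩ := List.mem_map.1 hb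
    simp only [Task.fuse.injEq] at h
    exact he h.1.symm
  · exact P.nodup_vlist.map fun _ _ h => by simpa using h
  · intro a ha hb
    obtain ⟨v, -, rfl⟩ := List.mem_map.1 hb
    simp [fuses] at ha
  · intro a ha hb
    obtain ⟨v, -, ha⟩ := List.mem_flatMap.1 ha
    rw [hblock] at ha
    rcases ha with rfl | ⟨e, j, i, he, rfl⟩ | rfl <;> simp [fuses] at hb

/-- The time step of a task. -/
def idx (a : Task V E k) : ℕ := P.prog.idxOf a

lemma idx_injective : Function.Injective P.idx := fun a _ h =>
  (List.idxOf_inj (P.mem_prog a)).1 h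

section Split

variable {P} {pre post : List (Task V E k)} {a : Task V E k}

lemma idx_lt_iff (h : P.prog = pre ++ post) (b : Task V E k) : P.idx b < pre.length ↔ b ∈ pre := by
  rw [idx, h]
  by_cases hb : b ∈ pre
  · rw [List.idxOf_append_of_mem hb]
    exact ⟨fun _ => hb, fun _ => List.idxOf_lt_length_of_mem hb⟩
  · rw [List.idxOf_append_of_notMem hb]
    exact ⟨fun h => absurd h (by omega), fun h => absurd h hb⟩

lemma notMem_pre (h : P.prog = pre ++ a :: post) : a ∉ pre := by
  have := P.nodup_prog
  rw [h] at this
  exact fun ha => (List.nodup_append'.1 this).2.2 ha List.mem_cons_self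

lemma idx_eq (h : P.prog = pre ++ a :: post) : P.idx a = pre.length := by
  rw [idx, h, List.idxOf_append_of_notMem (notMem_pre h)]
  simp

lemma getElem?_prog (h : P.prog = pre ++ a :: post) : P.prog[pre.length]? = some a := by
  rw [h]
  simp

end Split

lemma idx_emit_lt {u v : V} (h : P.rank u < P.rank v) : P.idx (.emit u) < P.idx (.emit v) := by
  obtain ⟨vs, vs', hv⟩ := List.append_of_mem (P.mem_vlist v)
  have hu := P.mem_of_rank_lt hv h
  have hp : P.prog = vs.flatMap P.block ++ .emit v :: (P.legs v ++ [.cut v] ++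
      vs'.flatMap P.block ++ ((Finset.univ : Finset E).toList.flatMap (fuses k) ++
        P.vlist.map .read)) := by
    rw [prog]
    conv_lhs => rw [show P.vlist.flatMap P.block = (vs ++ v :: vs').flatMap P.block by rw [hv]]
    simp [block]
  rw [idx_eq hp, idx_lt_iff hp]
  exact List.mem_flatMap.2 ⟨u, hu, by simp [block]⟩

lemma idx_read_lt {u v : V} (h : P.rank u < P.rank v) : P.idx (.read u) < P.idx (.read v) := by
  obtain ⟨vs, vs', hv⟩ := List.append_of_mem (P.mem_vlist v)
  have hu := P.mem_of_rank_lt hv h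
  have hp : P.prog = (P.vlist.flatMap P.block ++ ((Finset.univ : Finset E).toList.flatMap (fuses k)
      ++ vs.map .read)) ++ .read v :: vs'.map .read := by
    rw [prog]
    conv_lhs => rw [show P.vlist.map (.read : V → Task V E k) = (vs ++ v :: vs').map .read by
      rw [hv]]
    simp
  rw [idx_eq hp, idx_lt_iff hp]
  simp [hu]

/-- The task in which the photon emitted at a task leaves its delay line; the photons emitted during
fusions and readouts leave at once. -/
def dest : Task V E k → Task V E k
  | .emit v => .read v
  | .leg e j _ => .fuse e j
  | a => a

/-- The length of the delay line for the photon emitted at a task. -/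
def delay (a : Task V E k) : ℕ := P.idx (dest a) - P.idx a

/-- The outcome of a task according to a record. -/
def look (past : List Outcome) (a : Task V E k) : Outcome := past.reverse.getD (P.idx a) noPhoton

lemma look_hist {pre post : List (Task V E k)} (h : P.prog = pre ++ post)
    (ω : Task V E k → Outcome) {a : Task V E k} (ha : a ∈ pre) : P.look (hist ω pre) a = ω a := by
  have hlt : P.idx a < pre.length := (idx_lt_iff h a).2 ha
  have : pre[P.idx a]'hlt = a := by
    have h1 : P.idx a = pre.idxOf a := by rw [idx, h, List.idxOf_append_of_mem ha]
    simp [h1]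
  rw [look, hist, List.reverse_reverse, List.getD_eq_getElem?_getD, List.getElem?_map,
    List.getElem?_eq_getElem hlt]
  simp [this]

/-- The Hadamard gate as a unitary. -/
def hadU : Matrix.unitaryGroup (Fin 2) ℂ := ⟨had1, by
  rw [Matrix.mem_unitaryGroup_iff, Matrix.star_eq_conjTranspose, had1_conjTranspose, had1_mul_had1]⟩

/-- The settings that carry out the plan. -/
def settings : Settings m n where
  steps := P.prog.length
  inTime := OrderEmbedding.ofStrictMono (fun i => P.idx (.emit (P.inp i)))
    fun _ _ h => P.idx_emit_lt (P.inp_strictMono h)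
  outTime := OrderEmbedding.ofStrictMono (fun i => P.idx (.read (P.outp i)))
    fun _ _ h => P.idx_read_lt (P.outp_strictMono h)
  u t := match P.prog[t]? with
    | some (.emit v) => if ∃ i, P.inp i = v then 1 else hadU
    | some (.cut _) => hadU
    | _ => 1
  σ t := match P.prog[t]? with
    | some a => P.delay a
    | none => 0
  ρ t p := match P.prog[t]?, p with
    | some (.fuse e j), .fus i => some (P.delay (.leg e j i))
    | some (.read v), .meas => some (P.delay (.emit v))
    | some (.cut _), .meas => some 0
    | _, _ => none
  kind _ := .Y
  restart t := match P.prog[t]? with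
    | some (.fuse _ j) => decide (j.val = 0)
    | _ => false
  plane t := match P.prog[t]? with
    | some (.read v) => match P.readout v with
      | .out => none
      | .xy => some .XY
      | .yz _ => some .YZ
    | _ => some .YZ
  angle t := match P.prog[t]? with
    | some (.read v) => match P.readout v with
      | .yz α => α
      | _ => 0
    | _ => 0
  x t past := match P.prog[t]? with
    | some (.read v) => decide (P.x v (P.look past) = 1)
    | _ => decide ((0 : Fin 2) = 1)
  z t past := match P.prog[t]? with
    | some (.read v) => decide (P.z v (P.look past) = 1)
    | _ => decide ((0 : Fin 2) = 1)

/-- The rail of the photon emitted at a task, if the vertices are in the basis state `x`. -/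
def rail (x : V → Fin 2) : Task V E k → Fin 2
  | .emit v => x v
  | .leg e _ i => x (P.ends e i)
  | _ => 0

/-- The photons in the delay lines after the tasks in `pre`. -/
def inflight (pre : List (Task V E k)) (x : V → Fin 2) : Fock :=
  ∏ a ∈ pre.toFinset with dest a ∉ pre,
    MvPolynomial.X (.line (P.delay a) (P.idx (dest a) - pre.length), P.rail x a)

lemma rewire_X (g : Wire → Wire) (k : Mode) :
    rewire g (MvPolynomial.X k) = MvPolynomial.X (g k.1, k.2) := by simp [rewire]

/-- The photons that arrive at the ends of the delay lines at the task `a`. -/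
def arriving (pre : List (Task V E k)) (a : Task V E k) (x : V → Fin 2) : Fock :=
  ∏ a' ∈ pre.toFinset with dest a' = a,
    MvPolynomial.X (P.settings.exit pre.length (P.delay a'), P.rail x a')

section Transport

variable {P} {pre post : List (Task V E k)} {a : Task V E k}

lemma transport_inflight (h : P.prog = pre ++ a :: post) (x : V → Fin 2) :
    rewire (P.settings.throughLines pre.length) (rewire (P.settings.intoLines pre.length)
      (P.inflight pre x)) = P.arriving pre a x * ∏ a' ∈ pre.toFinset with dest a' ∉ pre ++ [a],
        MvPolynomial.X (.line (P.delay a') (P.idx (dest a') - (pre.length + 1)), P.rail x a') := by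
  have ha := notMem_pre h
  have hidx := idx_eq h
  rw [inflight, map_prod, map_prod, arriving]
  have hsplit : (pre.toFinset.filter fun a' => dest a' ∉ pre) =
      (pre.toFinset.filter fun a' => dest a' = a) ∪
        pre.toFinset.filter fun a' => dest a' ∉ pre ++ [a] := by
    ext a'
    simp only [Finset.mem_filter, Finset.mem_union, List.mem_append, List.mem_singleton, not_or,
      List.mem_toFinset]
    constructor
    · rintro ⟨h1, h2⟩
      by_cases h3 : dest a' = a
      · exact .inl ⟨h1, h3⟩
      · exact .inr ⟨h1, h2, h3⟩
    · rintro (⟨h1, rfl⟩ | ⟨h1, h2, -⟩)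
      · exact ⟨h1, ha⟩
      · exact ⟨h1, h2⟩
  rw [hsplit, Finset.prod_union]
  · congr 1
    · refine Finset.prod_congr rfl fun a' h' => ?_
      rw [(Finset.mem_filter.1 h').2, hidx, Nat.sub_self, rewire_X, rewire_X]
      simp [Settings.intoLines, Settings.throughLines]
    · refine Finset.prod_congr rfl fun a' h' => ?_
      have h1 : dest a' ∉ pre ++ [a] := (Finset.mem_filter.1 h').2
      have h2 : ¬ P.idx (dest a') < (pre ++ [a]).length := fun hlt =>
        h1 ((idx_lt_iff (post := post) (by simpa using h) _).1 hlt)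
      obtain ⟨j, hj⟩ : ∃ j, P.idx (dest a') = pre.length + 1 + j :=
        Nat.exists_eq_add_of_le (by simpa using h2)
      rw [hj, rewire_X, rewire_X, show pre.length + 1 + j - pre.length = j + 1 by omega,
        show pre.length + 1 + j - (pre.length + 1) = j by omega]
      simp [Settings.intoLines, Settings.throughLines]
  · rw [Finset.disjoint_left]
    intro a' h1 h2
    exact (Finset.mem_filter.1 h2).2 (by simp [(Finset.mem_filter.1 h1).2])

lemma settings_σ (h : P.prog = pre ++ a :: post) : P.settings.σ pre.length = P.delay a := by
  simp only [settings, getElem?_prog h]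

/-- A photon that enters a delay line of positive length joins the photons in the delay lines. -/
lemma transport_emit (h : P.prog = pre ++ a :: post) (hd : dest a ∉ pre ++ [a])
    (hpre : ∀ a' ∈ pre, dest a' ≠ a) (x : V → Fin 2) :
    rewire (P.settings.throughLines pre.length) (rewire (P.settings.intoLines pre.length)
      (MvPolynomial.X (.src, P.rail x a) * P.inflight pre x)) = P.inflight (pre ++ [a]) x := by
  have hlt : ¬ P.idx (dest a) < (pre ++ [a]).length := fun hlt =>
    hd ((idx_lt_iff (post := post) (by simpa using h) _).1 hlt)
  obtain ⟨j, hj⟩ : ∃ j, P.idx (dest a) = pre.length + 1 + j :=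
    Nat.exists_eq_add_of_le (by simpa using hlt)
  have hdel : P.delay a = j + 1 := by rw [delay, idx_eq h, hj]; omega
  have harr : P.arriving pre a x = 1 := by
    rw [arriving, Finset.filter_false_of_mem (fun a' h' => hpre a' (by simpa using h'))]
    simp
  rw [map_mul, map_mul, transport_inflight h, harr, one_mul, rewire_X, rewire_X]
  have hw : P.settings.throughLines pre.length (P.settings.intoLines pre.length .src) =
      .line (P.delay a) (P.idx (dest a) - (pre ++ [a]).length) := by
    simp only [Settings.intoLines, settings_σ h, hdel, Settings.throughLines]
    congr 1
    simp only [List.length_append, List.length_singleton]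
    omega
  rw [inflight, show (pre ++ [a]).toFinset = insert a pre.toFinset by ext; simp,
    Finset.filter_insert, if_pos hd, Finset.prod_insert (by simp [notMem_pre h]), hw]
  simp

/-- A photon that enters no delay line leaves together with those that arrive. -/
lemma transport_leave (h : P.prog = pre ++ a :: post) (hd : dest a = a) (b : Fin 2)
    (x : V → Fin 2) :
    rewire (P.settings.throughLines pre.length) (rewire (P.settings.intoLines pre.length)
      (MvPolynomial.X (.src, b) * P.inflight pre x)) =
    MvPolynomial.X (P.settings.exit pre.length 0, b) * P.arriving pre a x *
      P.inflight (pre ++ [a]) x := by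
  have hdel : P.delay a = 0 := by rw [delay, hd, Nat.sub_self]
  rw [map_mul, map_mul, transport_inflight h, rewire_X, rewire_X, mul_assoc, inflight,
    show (pre ++ [a]).toFinset = insert a pre.toFinset by ext; simp,
    Finset.filter_insert, if_neg (by simp [hd])]
  simp only [Settings.intoLines, settings_σ h, hdel, Settings.throughLines, List.length_append,
    List.length_singleton]

end Transport

end Plan

/-! ### The state along a run -/

/-- The bit that is observed at the input of the correction module. -/
def measBit (o : Outcome) : Fin 2 := bitOf (o.m₁ = 1)

lemma detectAll_noPhoton_one : detectAll noPhoton 1 = 1 := by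
  have h := detectAll_mon noPhoton noPhoton
  simpa [noPhoton, Outcome.mon, Outcome.weight] using h

namespace Plan

variable {V E : Type} [Fintype V] [DecidableEq V] [Fintype E] [DecidableEq E] {k m n : ℕ}
  (P : Plan V E k m n)

/-- The content of the emitter after the vertices in `vs`, each with its cut. -/
def lastCut (ω : Task V E k → Outcome) (vs : List V) : Fin 2 :=
  match vs.getLast? with
  | none => 0
  | some u => measBit (ω (.cut u))

/-- The content of the emitter before the vertex `v`. -/
def prevCut (ω : Task V E k → Outcome) (v : V) : Fin 2 :=
  lastCut ω (P.vlist.takeWhile (· ≠ v))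

/-- Whether the edge `e` exists before the attempt `j` to create it. -/
def fused (ω : Task V E k → Outcome) (e : E) (j : Fin k) : Bool :=
  decide (∃ j' < j, (ω (.fuse e j')).success = true)

/-- The amplitude of the outcome at the readout of a vertex in the basis state `b`. -/
def readAmp (ω : Task V E k → Outcome) (v : V) (b : Fin 2) : ℂ :=
  match P.readout v with
  | .out => 1
  | .xy => ((Real.sqrt 2 : ℝ) : ℂ)⁻¹ * sg (measBit (ω (.read v)) * b)
  | .yz α => (1 + sg (measBit (ω (.read v))) * sg b * Complex.exp (-(α * Complex.I))) / 2

/-- The amplitude of a task, where the vertices are in the basis state `x` and the outside qubits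
end in the basis state `r`. The factor `2` at an emission is compensated by averaging over the
vertices. -/
def kraus (ω : Task V E k → Outcome) (x : V → Fin 2) (r : Fin m → Fin 2) : Task V E k → ℂ
  | .emit v => 2 * if h : ∃ i, P.inp i = v then if r h.choose = P.prevCut ω v then 1 else 0
      else ((Real.sqrt 2 : ℝ) : ℂ)⁻¹ * sg (x v * P.prevCut ω v)
  | .leg _ _ _ => 1
  | .cut v => ((Real.sqrt 2 : ℝ) : ℂ)⁻¹ * sg (measBit (ω (.cut v)) * x v)
  | .fuse e j => fuseAmp (fused ω e j) (ω (.fuse e j)) (x (P.ends e 0)) (x (P.ends e 1))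
  | .read v => sg ((x v + P.x v ω) * P.z v ω) * P.readAmp ω v (x v + P.x v ω)

/-- The photons that have left the delay lines at a task without being detected, where `b` is the
content of the emitter. -/
def gone (ω : Task V E k → Outcome) (x : V → Fin 2) (b : Fin 2) : Task V E k → Fock
  | .fuse e j => MvPolynomial.X (.lost (P.idx (.fuse e j)) 0, b)
  | .read v => MvPolynomial.X (.lost (P.idx (.read v)) 0, b) *
      match P.readout v with
      | .out => MvPolynomial.X (.out (P.idx (.read v)), x v + P.x v ω)
      | _ => 1
  | _ => 1

/-- The amplitude of the tasks in `pre` for the input state `ψ`. -/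
def amp (ω : Task V E k → Outcome) (pre : List (Task V E k)) (ψ : (Fin m → Fin 2) → ℂ)
    (x : V → Fin 2) (r : Fin m → Fin 2) : ℂ :=
  ψ (fun i => if Task.emit (P.inp i) ∈ pre then x (P.inp i) else r i) *
    (pre.map (P.kraus ω x r)).prod

/-- The photons that are present after the tasks in `pre`. -/
def photons (ω : Task V E k → Outcome) (pre : List (Task V E k)) (x : V → Fin 2) (b : Fin 2) :
    Fock :=
  (pre.map (P.gone ω x b)).prod * P.inflight pre x

/-- The state of the run after the tasks in `pre` is the average over the basis states `x` of the
vertices, where the emitter contains `at x`. -/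
def Inv (ω : Task V E k → Outcome) (pre : List (Task V E k)) (c : (V → Fin 2) → Fin 2) : Prop :=
  ∀ ψ b r, P.settings.run ψ (hist ω pre) b r = ((1 / 2 : ℂ) ^ Fintype.card V) •
    ∑ x : V → Fin 2, if b = c x then P.amp ω pre ψ x r • P.photons ω pre x b else 0

/-- Records that satisfy the constraints of photon number conservation. -/
structure Valid (ω : Task V E k → Outcome) : Prop where
  emit : ∀ v, ω (.emit v) = noPhoton
  leg : ∀ e j i, ω (.leg e j i) = noPhoton
  cut : ∀ v, ω (.cut v) = measOut (measBit (ω (.cut v)))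
  fuse : ∀ e j b₀ b₁, detectAll (ω (.fuse e j)) (rusCircuit (fused ω e j) .Y
    (MvPolynomial.X (.fus 0, b₀) * MvPolynomial.X (.fus 1, b₁))) =
      MvPolynomial.C (fuseAmp (fused ω e j) (ω (.fuse e j)) b₀ b₁)
  read_out : ∀ v, P.readout v = .out → ω (.read v) = noPhoton
  read : ∀ v, P.readout v ≠ .out → ω (.read v) = measOut (measBit (ω (.read v)))

/-- The wires of photons that have left the set-up. -/
def Left : Set Mode := {k | (∃ t l, k.1 = .lost t l) ∨ ∃ t, k.1 = .out t}

lemma gone_mem (ω : Task V E k → Outcome) (x : V → Fin 2) (b : Fin 2) (a : Task V E k) :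
    P.gone ω x b a ∈ MvPolynomial.supported ℂ Left := by
  cases a with
  | fuse e j => exact MvPolynomial.X_mem_supported.2 (.inl ⟨_, _, rfl⟩)
  | read v =>
    refine mul_mem (MvPolynomial.X_mem_supported.2 (.inl ⟨_, _, rfl⟩)) ?_
    split
    · exact MvPolynomial.X_mem_supported.2 (.inr ⟨_, rfl⟩)
    · exact one_mem _
  | _ => exact one_mem _

lemma prod_gone_mem (ω : Task V E k → Outcome) (x : V → Fin 2) (b : Fin 2)
    (pre : List (Task V E k)) :
    (pre.map (P.gone ω x b)).prod ∈ MvPolynomial.supported ℂ Left :=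
  list_prod_mem fun y hy => by
    obtain ⟨a, -, rfl⟩ := List.mem_map.1 hy
    exact P.gone_mem ω x b a

lemma left_subset : Left ⊆ Undetected := by
  rintro ⟨w, i⟩ (⟨t, l, rfl⟩ | ⟨t, rfl⟩) <;> simp [Undetected]

lemma inflight_mem (pre : List (Task V E k)) (x : V → Fin 2) :
    P.inflight pre x ∈ MvPolynomial.supported ℂ Undetected :=
  prod_mem fun a _ => MvPolynomial.X_mem_supported.2 (by simp [Undetected])

lemma rewire_left (t : ℕ) {g : Fock} (hg : g ∈ MvPolynomial.supported ℂ Left) :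
    rewire (P.settings.throughLines t) (rewire (P.settings.intoLines t) g) = g := by
  rw [algHom_eq_self (φ := rewire (P.settings.intoLines t)) _ hg,
    algHom_eq_self (φ := rewire (P.settings.throughLines t)) _ hg]
  all_goals
    rintro ⟨w, i⟩ (⟨t, l, rfl⟩ | ⟨t, rfl⟩) <;>
      simp [rewire_X, Settings.throughLines, Settings.intoLines]

lemma hist_append (ω : Task V E k → Outcome) (pre : List (Task V E k)) (a : Task V E k) :
    hist ω (pre ++ [a]) = ω a :: hist ω pre := by simp [hist]

lemma length_hist (ω : Task V E k → Outcome) (pre : List (Task V E k)) :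
    (hist ω pre).length = pre.length := by simp [hist]

/-- In one time step, the modules do not act on the photons `g` that are elsewhere. -/
lemma optics_eq {past : List Outcome} {o : Outcome} {f loc g : Fock}
    (hf : rewire (P.settings.throughLines past.length)
      (rewire (P.settings.intoLines past.length) f) = loc * g)
    (hg : g ∈ MvPolynomial.supported ℂ Undetected) :
    P.settings.optics past o f = detectAll o (P.settings.correctAndMeasure past.length past
      (rusCircuit (P.settings.done past) .Y loc)) * g := by
  unfold Settings.optics
  rw [hf, map_mul, map_mul, algHom_eq_self (fun k hk => rusCircuit_X hk _ _) hg,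
    algHom_eq_self (fun k hk => correctAndMeasure_X _ _ _ hk.2.2) hg]
  exact detectAll_mul _ _ hg

/-- The optical part of a time step as a linear map. -/
def opticsL (past : List Outcome) (o : Outcome) : Fock →ₗ[ℂ] Fock :=
  detectAllL o ∘ₗ (P.settings.correctAndMeasure past.length past).toLinearMap ∘ₗ
    (rusCircuit (P.settings.done past) .Y).toLinearMap ∘ₗ
    (rewire (P.settings.throughLines past.length)).toLinearMap ∘ₗ
    (rewire (P.settings.intoLines past.length)).toLinearMap

lemma opticsL_apply (past : List Outcome) (o : Outcome) (f : Fock) :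
    P.opticsL past o f = P.settings.optics past o f := rfl

section Steps

variable {P} {pre post : List (Task V E k)} {a : Task V E k} {ω : Task V E k → Outcome}
  {c : (V → Fin 2) → Fin 2}

/-- One more time step, for the state that is described by `Inv`. -/
lemma run_append (hI : P.Inv ω pre c)
    (hin : ∀ f : State m, P.settings.input pre.length f = f)
    (ψ : (Fin m → Fin 2) → ℂ) (b : Fin 2) (r : Fin m → Fin 2) :
    P.settings.run ψ (hist ω (pre ++ [a])) b r = ((1 / 2 : ℂ) ^ Fintype.card V) •
      ∑ x : V → Fin 2, ((P.settings.u pre.length).1 b (c x) * P.amp ω pre ψ x r) •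
        P.settings.optics (hist ω pre) (ω a)
          (MvPolynomial.X (.src, b) * P.photons ω pre x (c x)) := by
  rw [hist_append, Settings.run, Settings.step, length_hist, hin, emit]
  simp only [← opticsL_apply]
  simp only [← map_smul, ← map_sum]
  congr 1
  simp only [hI ψ, ← MvPolynomial.smul_eq_C_mul]
  simp only [smul_comm _ ((1 / 2 : ℂ) ^ Fintype.card V), ← Finset.smul_sum]
  rw [mul_smul_comm]
  congr 1
  simp only [Finset.smul_sum]
  rw [Finset.sum_comm, Finset.mul_sum]
  refine Finset.sum_congr rfl fun x _ => ?_
  rw [Finset.sum_eq_single (c x) (by intro b' _ hb; simp [hb]) (by simp)]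
  simp [mul_smul]

lemma input_eq_self (h : P.prog = pre ++ a :: post) (ha : ∀ i, a ≠ .emit (P.inp i))
    (f : State m) : P.settings.input pre.length f = f := by
  have hinj : Function.Injective P.settings.inTime := P.settings.inTime.injective
  have : Function.partialInv P.settings.inTime pre.length = none := by
    rw [Option.eq_none_iff_forall_ne_some]
    intro i hi
    have h1 := (hinj.isPartialInv i pre.length).1 hi
    exact ha i (P.idx_injective ((idx_eq h).trans h1.symm))
  rw [Settings.input, this]

lemma input_eq_exchange {i : Fin m} (h : P.prog = pre ++ .emit (P.inp i) :: post)
    (f : State m) : P.settings.input pre.length f = exchange i f := by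
  have hinj : Function.Injective P.settings.inTime := P.settings.inTime.injective
  have : Function.partialInv P.settings.inTime pre.length = some i :=
    (hinj.isPartialInv i pre.length).2 (idx_eq h)
  rw [Settings.input, this]

lemma amp_append (ha : ∀ i, a ≠ .emit (P.inp i)) (ψ : (Fin m → Fin 2) → ℂ) (x : V → Fin 2)
    (r : Fin m → Fin 2) :
    P.amp ω (pre ++ [a]) ψ x r = P.kraus ω x r a * P.amp ω pre ψ x r := by
  have : ∀ i, Task.emit (P.inp i) ∈ pre ++ [a] ↔ Task.emit (P.inp i) ∈ pre := fun i => by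
    simp [(ha i).symm]
  simp only [amp, this, List.map_append, List.prod_append, List.map_cons, List.map_nil,
    List.prod_cons, List.prod_nil]
  ring

/-- A task at which the emitter keeps its content multiplies the amplitude. -/
lemma Inv.append (hI : P.Inv ω pre c) (h : P.prog = pre ++ a :: post)
    (ha : ∀ i, a ≠ .emit (P.inp i)) (hu : P.settings.u pre.length = 1)
    (hopt : ∀ x r, P.settings.optics (hist ω pre) (ω a)
      (MvPolynomial.X (.src, c x) * P.photons ω pre x (c x)) =
        P.kraus ω x r a • P.photons ω (pre ++ [a]) x (c x)) :
    P.Inv ω (pre ++ [a]) c := by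
  intro ψ b r
  rw [run_append hI (input_eq_self h ha), hu]
  congr 1
  refine Finset.sum_congr rfl fun x _ => ?_
  by_cases hb : b = c x
  · rw [if_pos hb, amp_append ha, hb, hopt x r, smul_smul]
    congr 1
    simp [mul_comm]
  · rw [if_neg hb]
    simp [Matrix.one_apply_ne hb]

/-- The optical part of a time step at which the emitted photon enters a delay line of positive
length and no photon is detected. -/
lemma optics_emission (h : P.prog = pre ++ a :: post) (hω : ω a = noPhoton)
    (hd : dest a ∉ pre ++ [a]) (hpre : ∀ a' ∈ pre, dest a' ≠ a)
    (x : V → Fin 2) (b : Fin 2) (hg : P.gone ω x b a = 1) :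
    P.settings.optics (hist ω pre) (ω a) (MvPolynomial.X (.src, P.rail x a) * P.photons ω pre x b) =
      P.photons ω (pre ++ [a]) x b := by
  have key : rewire (P.settings.throughLines (hist ω pre).length)
      (rewire (P.settings.intoLines (hist ω pre).length)
        (MvPolynomial.X (.src, P.rail x a) * P.photons ω pre x b)) =
      1 * P.photons ω (pre ++ [a]) x b := by
    rw [length_hist, photons, mul_left_comm, map_mul, map_mul, transport_emit h hd hpre,
      rewire_left _ _ (P.prod_gone_mem ω x b pre), photons]
    simp [hg]
  rw [optics_eq P key, map_one, map_one, hω, detectAll_noPhoton_one, one_mul]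
  exact mul_mem (MvPolynomial.supported_mono left_subset (P.prod_gone_mem ω x b _))
    (P.inflight_mem _ x)

/-- The optical part of a time step at which the emitted photon leaves at once. -/
lemma optics_leave (h : P.prog = pre ++ a :: post) (hd : dest a = a) (x : V → Fin 2)
    (b b' : Fin 2) :
    ∀ loc, ∀ g ∈ MvPolynomial.supported ℂ Left,
      MvPolynomial.X (P.settings.exit pre.length 0, b) * P.arriving pre a x = loc * g →
      P.settings.optics (hist ω pre) (ω a) (MvPolynomial.X (.src, b) * P.photons ω pre x b') =
      detectAll (ω a) (P.settings.correctAndMeasure pre.length (hist ω pre)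
        (rusCircuit (P.settings.done (hist ω pre)) .Y loc)) *
        (g * ((pre.map (P.gone ω x b')).prod * P.inflight (pre ++ [a]) x)) := by
  intro loc g hg hloc
  have key : rewire (P.settings.throughLines (hist ω pre).length)
      (rewire (P.settings.intoLines (hist ω pre).length)
        (MvPolynomial.X (.src, b) * P.photons ω pre x b')) =
      loc * (g * ((pre.map (P.gone ω x b')).prod * P.inflight (pre ++ [a]) x)) := by
    rw [length_hist, photons, mul_left_comm, map_mul, map_mul, transport_leave h hd, hloc,
      rewire_left _ _ (P.prod_gone_mem ω x b' pre)]
    ring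
  rw [optics_eq P key, length_hist]
  exact mul_mem (MvPolynomial.supported_mono left_subset hg)
    (mul_mem (MvPolynomial.supported_mono left_subset (P.prod_gone_mem ω x b' _))
      (P.inflight_mem _ x))

end Steps

end Plan

/-- Averaging over a bit on which the summand does not depend. -/
lemma sum_eq_sum_ite {V M : Type*} [Fintype V] [DecidableEq V] [AddCommGroup M] [Module ℂ M]
    (v : V) (b : Fin 2) (G : (V → Fin 2) → M) (hG : ∀ x b', G (Function.update x v b') = G x) :
    ∑ x, G x = ∑ x, if b = x v then (2 : ℂ) • G x else 0 := by
  have h1 : ∑ x, (if b = x v then G x else 0) = ∑ x, if b = x v + 1 then G x else 0 := by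
    rw [← Equiv.sum_comp (Equiv.addRight (Pi.single v 1 : V → Fin 2))
      (fun x => if b = x v then G x else 0)]
    refine Finset.sum_congr rfl fun x _ => ?_
    have : x + Pi.single v 1 = Function.update x v (x v + 1) := by
      ext1 u
      by_cases hu : u = v
      · subst hu; simp
      · simp [hu]
    simp only [Equiv.coe_addRight, this, hG, Function.update_self]
  calc ∑ x, G x = ∑ x, ((if b = x v then G x else 0) + if b = x v + 1 then G x else 0) := by
        refine Finset.sum_congr rfl fun x _ => ?_
        rcases Fin.exists_fin_two.1 ⟨b, rfl⟩ with hb | hb <;>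
          rcases Fin.exists_fin_two.1 ⟨x v, rfl⟩ with hx | hx <;> rw [hb, hx] <;> simp
    _ = _ := by
        rw [Finset.sum_add_distrib, ← h1, ← Finset.sum_add_distrib]
        refine Finset.sum_congr rfl fun x _ => ?_
        split_ifs
        · rw [two_smul]
        · simp

namespace Plan

variable {V E : Type} [Fintype V] [DecidableEq V] [Fintype E] [DecidableEq E] {k m n : ℕ}
  {P : Plan V E k m n} {pre post : List (Task V E k)} {ω : Task V E k → Outcome}

lemma mem_block {v : V} {a : Task V E k} : a ∈ P.block v ↔ a = .emit v ∨
    (∃ e j i, P.ends e i = v ∧ a = .leg e j i) ∨ a = .cut v := by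
  simp only [block, List.mem_cons, List.mem_append, mem_legs, List.not_mem_nil, or_false]

lemma gone_of_mem_block {v : V} {a : Task V E k} (ha : a ∈ P.block v) (x : V → Fin 2) (b : Fin 2) :
    P.gone ω x b a = 1 := by
  rcases mem_block.1 ha with rfl | ⟨e, j, i, -, rfl⟩ | rfl <;> rfl

lemma photons_prod (hpre : ∀ a ∈ pre, ∃ u, a ∈ P.block u) (x : V → Fin 2) (b : Fin 2) :
    (pre.map (P.gone ω x b)).prod = 1 := by
  refine List.prod_eq_one fun y hy => ?_
  obtain ⟨a, ha, rfl⟩ := List.mem_map.1 hy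
  obtain ⟨u, hu⟩ := hpre a ha
  exact gone_of_mem_block hu x b

lemma photons_eq_inflight (hpre : ∀ a ∈ pre, ∃ u, a ∈ P.block u) (x : V → Fin 2) (b : Fin 2) :
    P.photons ω pre x b = P.inflight pre x := by
  rw [photons, photons_prod hpre, one_mul]

lemma dest_notMem (hpre : ∀ a ∈ pre, ∃ u, a ∈ P.block u) (a : Task V E k)
    (ha : ∀ u, dest a ∉ P.block u) : dest a ∉ pre :=
  fun h => let ⟨u, hu⟩ := hpre _ h; ha u hu

lemma inflight_update {v : V} (hpre : ∀ a ∈ pre, ∃ u, u ≠ v ∧ a ∈ P.block u) (x : V → Fin 2)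
    (b : Fin 2) : P.inflight pre (Function.update x v b) = P.inflight pre x := by
  refine Finset.prod_congr rfl fun a ha => ?_
  obtain ⟨u, huv, hu⟩ := hpre a (by simpa using (Finset.mem_filter.1 ha).1)
  congr 2
  rcases mem_block.1 hu with rfl | ⟨e, j, i, rfl, rfl⟩ | rfl <;> simp [rail, huv]

lemma kraus_update {v : V} {a : Task V E k} (ha : ∃ u, u ≠ v ∧ a ∈ P.block u) (x : V → Fin 2)
    (b : Fin 2) (r : Fin m → Fin 2) :
    P.kraus ω (Function.update x v b) r a = P.kraus ω x r a := by
  obtain ⟨u, huv, hu⟩ := ha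
  rcases mem_block.1 hu with rfl | ⟨e, j, i, rfl, rfl⟩ | rfl <;> simp [kraus, huv]

lemma amp_update {v : V} (hpre : ∀ a ∈ pre, ∃ u, u ≠ v ∧ a ∈ P.block u)
    (ψ : (Fin m → Fin 2) → ℂ) (x : V → Fin 2) (b : Fin 2) (r : Fin m → Fin 2) :
    P.amp ω pre ψ (Function.update x v b) r = P.amp ω pre ψ x r := by
  rw [amp, amp]
  congr 1
  · congr 1
    ext1 i
    split_ifs with h
    · obtain ⟨u, huv, hu⟩ := hpre _ h
      have : P.inp i = u := by
        rcases mem_block.1 hu with h | ⟨e, j, i, -, h⟩ | h <;> simp at h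
        exact h
      rw [this, Function.update_of_ne huv]
    · rfl
  · congr 1
    exact List.map_congr_left fun a ha => kraus_update (hpre a ha) x b r

lemma inp_injective (P : Plan V E k m n) : Function.Injective P.inp := fun i j h =>
  P.inp_strictMono.injective (by simp [h])

lemma kraus_update_right {i : Fin m} {a : Task V E k} (ha : ∃ u, u ≠ P.inp i ∧ a ∈ P.block u)
    (x : V → Fin 2) (b : Fin 2) (r : Fin m → Fin 2) :
    P.kraus ω x (Function.update r i b) a = P.kraus ω x r a := by
  obtain ⟨u, huv, hu⟩ := ha
  rcases mem_block.1 hu with rfl | ⟨e, j, i, rfl, rfl⟩ | rfl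
  · simp only [kraus]
    congr 1
    by_cases h : ∃ i, P.inp i = u
    · have : h.choose ≠ i := fun e => huv (by rw [← h.choose_spec, e])
      simp only [dif_pos h, Function.update_of_ne this]
    · simp only [dif_neg h]
  · rfl
  · rfl

lemma inv_nil (P : Plan V E k m n) (ω : Task V E k → Outcome) : P.Inv ω [] fun _ => 0 := by
  intro ψ b r
  have h : ∀ x : V → Fin 2, (if b = 0 then P.amp ω [] ψ x r • P.photons ω [] x b else 0) =
      if b = 0 then MvPolynomial.C (ψ r) else 0 := by
    intro x
    simp [amp, photons, inflight, MvPolynomial.smul_eq_C_mul]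
  simp only [h, hist, List.map_nil, List.reverse_nil, Settings.run, Finset.sum_const,
    Finset.card_univ, Fintype.card_fun, Fintype.card_fin]
  rw [← Nat.cast_smul_eq_nsmul ℂ, smul_smul]
  simp

lemma optics_emit {v : V} (hV : P.Valid ω) (h : P.prog = pre ++ .emit v :: post)
    (hpre : ∀ a ∈ pre, ∃ u, u ≠ v ∧ a ∈ P.block u) (x : V → Fin 2) (b b' : Fin 2)
    (hb : b = x v) :
    P.settings.optics (hist ω pre) (ω (.emit v))
      (MvPolynomial.X (.src, b) * P.photons ω pre x b') = P.photons ω (pre ++ [.emit v]) x b' := by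
  subst hb
  have hpre' : ∀ a ∈ pre, ∃ u, a ∈ P.block u := fun a ha => (hpre a ha).imp fun _ h => h.2
  refine optics_emission h (hV.emit v) ?_ ?_ x b' rfl
  · intro hd
    rcases List.mem_append.1 hd with hd | hd
    · exact dest_notMem hpre' (.emit v) (fun u => by simp [dest, mem_block]) hd
    · simp [dest] at hd
  · intro a' _
    cases a' <;> simp only [dest, ne_eq, reduceCtorEq, not_false_eq_true]

/-- A vertex that is not an input starts with a Hadamard on the emitter. -/
lemma Inv.append_emit {v : V} (hV : P.Valid ω) (hI : P.Inv ω pre fun _ => P.prevCut ω v)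
    (h : P.prog = pre ++ .emit v :: post) (hpre : ∀ a ∈ pre, ∃ u, u ≠ v ∧ a ∈ P.block u)
    (hv : ¬ ∃ i, P.inp i = v) : P.Inv ω (pre ++ [.emit v]) fun x => x v := by
  have hpre' : ∀ a ∈ pre, ∃ u, a ∈ P.block u := fun a ha => (hpre a ha).imp fun _ h => h.2
  have hne : ∀ i, (Task.emit v : Task V E k) ≠ .emit (P.inp i) := by
    intro i e
    simp only [Task.emit.injEq] at e
    exact hv ⟨i, e.symm⟩
  intro ψ b r
  rw [run_append hI (input_eq_self h hne)]
  congr 1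
  rw [sum_eq_sum_ite v b]
  · refine Finset.sum_congr rfl fun x _ => ?_
    by_cases hb : b = x v
    · have hu : P.settings.u pre.length = hadU := by
        simp only [settings, getElem?_prog h, if_neg hv]
      rw [if_pos hb, if_pos hb, optics_emit hV h hpre x b _ hb, amp_append hne, smul_smul, hu, hb]
      congr 1
      · simp only [hadU, had1, Matrix.of_apply, kraus, dif_neg hv]
        ring
      · simp [photons, gone, photons_prod hpre']
    · rw [if_neg hb, if_neg hb]
  · intro x b'
    rw [amp_update hpre, photons_eq_inflight hpre', inflight_update hpre, photons_eq_inflight hpre']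

/-- At an input vertex the emitter is exchanged with an outside qubit. -/
lemma Inv.append_emit_inp {i : Fin m} (hV : P.Valid ω)
    (hI : P.Inv ω pre fun _ => P.prevCut ω (P.inp i))
    (h : P.prog = pre ++ .emit (P.inp i) :: post)
    (hpre : ∀ a ∈ pre, ∃ u, u ≠ P.inp i ∧ a ∈ P.block u) :
    P.Inv ω (pre ++ [.emit (P.inp i)]) fun x => x (P.inp i) := by
  have hpre' : ∀ a ∈ pre, ∃ u, a ∈ P.block u := fun a ha => (hpre a ha).imp fun _ h => h.2
  intro ψ b r
  have hu : P.settings.u pre.length = 1 := by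
    simp only [settings, getElem?_prog h]
    exact if_pos ⟨i, rfl⟩
  have hrun : P.settings.run ψ (hist ω (pre ++ [.emit (P.inp i)])) b r =
      ((1 / 2 : ℂ) ^ Fintype.card V) • ∑ x : V → Fin 2,
        if r i = P.prevCut ω (P.inp i) then P.amp ω pre ψ x (Function.update r i b) •
          P.settings.optics (hist ω pre) (ω (.emit (P.inp i)))
            (MvPolynomial.X (.src, b) * P.inflight pre x) else 0 := by
    have hem : emit (P.settings.u pre.length).1 (exchange i (P.settings.run ψ (hist ω pre))) b r =
        MvPolynomial.X (.src, b) * P.settings.run ψ (hist ω pre) (r i) (Function.update r i b) := by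
      rw [hu, emit, Finset.sum_eq_single b (by
        intro b' _ hb
        simp [Matrix.one_apply_ne hb.symm]) (by simp)]
      simp [exchange]
    rw [hist_append, Settings.run, Settings.step, length_hist, input_eq_exchange h, hem, hI ψ]
    simp only [← opticsL_apply, mul_smul_comm, map_smul, Finset.mul_sum, map_sum]
    congr 1
    refine Finset.sum_congr rfl fun x _ => ?_
    split_ifs
    · rw [mul_smul_comm, map_smul, photons_eq_inflight hpre']
    · simp
  rw [hrun]
  congr 1
  rw [sum_eq_sum_ite (P.inp i) b]
  · refine Finset.sum_congr rfl fun x _ => ?_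
    by_cases hb : b = x (P.inp i)
    · have hex : ∃ i', P.inp i' = P.inp i := ⟨i, rfl⟩
      have hch : hex.choose = i := P.inp_injective hex.choose_spec
      rw [if_pos hb, if_pos hb, ← photons_eq_inflight (ω := ω) hpre' x b,
        optics_emit hV h hpre x b _ hb]
      have hamp : P.amp ω (pre ++ [.emit (P.inp i)]) ψ x r =
          2 * if r i = P.prevCut ω (P.inp i) then P.amp ω pre ψ x (Function.update r i b)
            else 0 := by
        have hk : P.kraus ω x r (.emit (P.inp i)) =
            2 * if r i = P.prevCut ω (P.inp i) then 1 else 0 := by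
          simp only [kraus, dif_pos hex, hch]
        have hmap : pre.map (P.kraus ω x (Function.update r i b)) = pre.map (P.kraus ω x r) :=
          List.map_congr_left fun a ha => kraus_update_right (hpre a ha) x b r
        have hψ : (fun i' => if Task.emit (P.inp i') ∈ pre ++ [.emit (P.inp i)] then x (P.inp i')
            else r i') = fun i' => if Task.emit (P.inp i') ∈ pre then x (P.inp i') else
              Function.update r i b i' := by
          ext1 i'
          by_cases hi : i' = i
          · subst hi
            simp [notMem_pre h, hb]
          · have : P.inp i' ≠ P.inp i := fun e => hi (P.inp_injective e)
            simp [hi, this]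
        rw [amp, amp, hψ, hmap, List.map_append, List.prod_append, List.map_singleton,
          List.prod_singleton, hk]
        split_ifs <;> ring
      rw [hamp]
      split_ifs
      · rw [smul_smul]
      · simp
    · rw [if_neg hb, if_neg hb]
  · intro x b'
    rw [amp_update hpre, inflight_update hpre]

lemma Inv.append_leg {v : V} {e : E} {j : Fin k} {i : Fin 2} (hV : P.Valid ω)
    (hI : P.Inv ω pre fun x => x v) (he : P.ends e i = v)
    (h : P.prog = pre ++ .leg e j i :: post) (hpre : ∀ a ∈ pre, ∃ u, a ∈ P.block u) :
    P.Inv ω (pre ++ [.leg e j i]) fun x => x v := by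
  subst he
  refine hI.append h (by simp) (by simp only [settings, getElem?_prog h]) fun x r => ?_
  rw [kraus, one_smul]
  refine optics_emission h (hV.leg e j i) ?_ ?_ x _ rfl
  · intro hd
    rcases List.mem_append.1 hd with hd | hd
    · exact dest_notMem hpre (.leg e j i) (fun u => by simp [dest, mem_block]) hd
    · simp [dest] at hd
  · intro a' _
    cases a' <;> simp [dest]

lemma exit_cut {v : V} (h : P.prog = pre ++ .cut v :: post) :
    P.settings.exit pre.length 0 = .meas := by
  simp [Settings.exit, settings, getElem?_prog h]

lemma arriving_cut {v : V} (h : P.prog = pre ++ .cut v :: post) (x : V → Fin 2) :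
    P.arriving pre (.cut v) x = 1 := by
  refine Finset.prod_eq_one fun a ha => ?_
  have h1 := (Finset.mem_filter.1 ha).2
  have h2 : a ∈ pre := by simpa using (Finset.mem_filter.1 ha).1
  cases a <;> simp only [dest, reduceCtorEq] at h1
  rw [h1] at h2
  exact absurd h2 (notMem_pre h)

lemma correctAndMeasure_cut {v : V} (h : P.prog = pre ++ .cut v :: post) (past : List Outcome)
    (b : Fin 2) : P.settings.correctAndMeasure pre.length past (MvPolynomial.X (.meas, b)) =
      measCircuit .meas .YZ 0 (MvPolynomial.X (.meas, b)) := by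
  unfold Settings.correctAndMeasure
  simp only [settings, getElem?_prog h, AlgHom.comp_apply, correct_X]
  simp

/-- The photon of a cut projects the emitter onto a known basis state. -/
lemma Inv.append_cut {v : V} (hV : P.Valid ω) (hI : P.Inv ω pre fun x => x v)
    (h : P.prog = pre ++ .cut v :: post) (hpre : ∀ a ∈ pre, ∃ u, a ∈ P.block u) :
    P.Inv ω (pre ++ [.cut v]) fun _ => measBit (ω (.cut v)) := by
  intro ψ b r
  rw [run_append hI (input_eq_self h (by simp))]
  congr 1
  refine Finset.sum_congr rfl fun x _ => ?_
  have hu : P.settings.u pre.length = hadU := by simp only [settings, getElem?_prog h]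
  have hpre' : ∀ a ∈ pre ++ [.cut v], ∃ u, a ∈ P.block u := by
    intro a ha
    rcases List.mem_append.1 ha with ha | ha
    · exact hpre a ha
    · exact ⟨v, by rw [List.mem_singleton.1 ha]; simp [mem_block]⟩
  rw [optics_leave h rfl x b (x v) (MvPolynomial.X (.meas, b)) 1 (one_mem _)
    (by rw [exit_cut h, arriving_cut h]), rusCircuit_X_meas, correctAndMeasure_cut h, hV.cut v,
    detectAll_measCircuit_YZ, one_mul, ← hV.cut v, photons_prod hpre x (x v), one_mul,
    photons_eq_inflight hpre', amp_append (by simp), hu, ← MvPolynomial.smul_eq_C_mul, smul_smul]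
  by_cases hb : b = measBit (ω (.cut v))
  · rw [if_pos hb, ← hb]
    congr 1
    simp only [hadU, had1, kraus, ← hb, sg_mul_self, Matrix.of_apply, Complex.ofReal_zero,
      zero_mul, neg_zero, Complex.exp_zero]
    ring
  · rw [if_neg hb]
    have : sg (measBit (ω (.cut v))) * sg b = -1 := by
      rcases Fin.exists_fin_two.1 ⟨b, rfl⟩ with h1 | h1 <;>
        rcases Fin.exists_fin_two.1 ⟨measBit (ω (.cut v)), rfl⟩ with h2 | h2 <;>
        simp_all
    simp [this]

end Plan

lemma algHom_rusCircuit {φ : Fock →ₐ[ℂ] Fock}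
    (h : ∀ k : Mode, k.1 ≠ .meas → φ (MvPolynomial.X k) = MvPolynomial.X k) (d : Bool)
    (b₀ b₁ : Fin 2) :
    φ (rusCircuit d .Y (MvPolynomial.X (.fus 0, b₀) * MvPolynomial.X (.fus 1, b₁))) =
      rusCircuit d .Y (MvPolynomial.X (.fus 0, b₀) * MvPolynomial.X (.fus 1, b₁)) := by
  have h' : ∀ i b, φ (MvPolynomial.X (.fus i, b)) = MvPolynomial.X (.fus i, b) := fun i b =>
    h _ (by simp)
  cases d
  · rw [rusCircuit_false]
    simp only [map_smul, map_add, map_sub, Outcome.mon, map_mul, map_pow, h', pow_zero, map_one]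
  · rw [rusCircuit_true]
    simp only [map_smul, map_add, Outcome.mon, map_mul, map_pow, h', pow_zero, map_one]

/-- Induction over the prefixes of a list. -/
lemma list_prefix_induction {α : Type*} {Q : List α → Prop} {l : List α} (h0 : Q [])
    (h : ∀ l₁ a l₂, l = l₁ ++ a :: l₂ → Q l₁ → Q (l₁ ++ [a])) : Q l := by
  have key : ∀ l₁ l₂, l = l₁ ++ l₂ → Q l₁ := by
    intro l₁
    induction l₁ using List.reverseRecOn with
    | nil => exact fun _ _ => h0
    | append_singleton l₁ a ih =>
      intro l₂ hl
      rw [List.append_assoc, List.singleton_append] at hl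
      exact h _ _ _ hl (ih _ hl)
  exact key l [] (by simp)

lemma val_eq_length {k : ℕ} {js js' : List (Fin k)} {j : Fin k}
    (h : List.finRange k = js ++ j :: js') : j.val = js.length := by
  have h1 : (List.finRange k)[js.length]? = some j := by rw [h]; simp
  obtain ⟨hlt, h2⟩ := List.getElem?_eq_some_iff.1 h1
  rw [← h2]
  simp

lemma mem_iff_lt {k : ℕ} {js js' : List (Fin k)} {j : Fin k}
    (h : List.finRange k = js ++ j :: js') (i : Fin k) : i ∈ js ↔ i < j := by
  have hp := List.pairwise_lt_finRange k
  have hi := List.mem_finRange i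
  rw [h] at hp hi
  obtain ⟨-, h1, h2⟩ := List.pairwise_append.1 hp
  constructor
  · exact fun h => h2 i h j List.mem_cons_self
  · intro hlt
    rcases List.mem_append.1 hi with hi | hi
    · exact hi
    · rcases List.mem_cons.1 hi with rfl | hi
      · exact absurd hlt (lt_irrefl _)
      · exact absurd hlt ((List.pairwise_cons.1 h1).1 i hi).not_gt

namespace Plan

variable {V E : Type} [Fintype V] [DecidableEq V] [Fintype E] [DecidableEq E] {k m n : ℕ}
  {P : Plan V E k m n} {pre post : List (Task V E k)} {ω : Task V E k → Outcome}
  {c : (V → Fin 2) → Fin 2}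

/-! ### The fusions -/

lemma settings_restart {e : E} {j : Fin k} (h : P.prog = pre ++ .fuse e j :: post) :
    P.settings.restart pre.length = decide (j.val = 0) := by
  simp only [settings, getElem?_prog h]

/-- At an attempt to create an edge, the switch of the fusion module tells whether the edge exists
already, since the module is restarted at the first attempt. -/
lemma done_hist {e : E} {js js' : List (Fin k)} {j : Fin k}
    (hj : List.finRange k = js ++ j :: js')
    (h : P.prog = (pre ++ js.map (.fuse e)) ++ .fuse e j :: post) :
    P.settings.done (hist ω (pre ++ js.map (.fuse e))) = fused ω e j := by
  have key : P.settings.done (hist ω (pre ++ js.map (.fuse e))) =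
      decide (∃ i ∈ js, (ω (.fuse e i)).success = true) := by
    induction js using List.reverseRecOn generalizing j js' post with
    | nil =>
      have h0 := settings_restart h
      rw [val_eq_length hj] at h0
      simp only [List.map_nil, List.append_nil, List.length_nil, decide_true] at h0 ⊢
      rw [← length_hist ω] at h0
      cases hp : hist ω pre with
      | nil => simp [Settings.done]
      | cons o past =>
        rw [hp] at h0
        simp only [List.length_cons] at h0
        simp [Settings.done, h0]
    | append_singleton js i ih =>
      have h0 := settings_restart h
      rw [val_eq_length hj] at h0
      have h1 := ih (j := i) (js' := j :: js') (post := .fuse e j :: post) (by simpa using hj)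
        (by simpa using h)
      have hl : (hist ω (pre ++ js.map (.fuse e))).length + 1 =
          (pre ++ (js ++ [i]).map (Task.fuse e)).length := by
        simp [hist]
        omega
      rw [List.map_append, List.map_singleton, ← List.append_assoc, hist_append, Settings.done, hl,
        h0, h1]
      simp [or_and_right, exists_or]
  rw [key, fused]
  simp only [mem_iff_lt hj]

section Fuse

variable {e : E} {j : Fin k}

lemma idx_leg_lt (h : P.prog = pre ++ .fuse e j :: post) (hleg : ∀ i, .leg e j i ∈ pre)
    (i : Fin 2) : P.idx (.leg e j i) < P.idx (.fuse e j) := by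
  rw [idx_eq h]
  exact (idx_lt_iff h _).2 (hleg i)

/-- The lines with the photons of both ends are connected to the fusion module: their lengths are
different since the photons were emitted at different times. -/
lemma exit_fuse (h : P.prog = pre ++ .fuse e j :: post) (hleg : ∀ i, .leg e j i ∈ pre)
    (i : Fin 2) : P.settings.exit pre.length (P.delay (.leg e j i)) = .fus i := by
  have h0 := idx_leg_lt h hleg 0
  have h1 := idx_leg_lt h hleg 1
  have hne : P.idx (.leg e j 0) ≠ P.idx (.leg e j 1) := fun h => by
    simpa using P.idx_injective h
  have hd : P.delay (.leg e j 0) ≠ P.delay (.leg e j 1) := by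
    simp only [delay, dest]
    omega
  rcases Fin.exists_fin_two.1 ⟨i, rfl⟩ with rfl | rfl
  · simp [Settings.exit, settings, getElem?_prog h]
  · simp [Settings.exit, settings, getElem?_prog h, hd]

lemma exit_fuse_zero (h : P.prog = pre ++ .fuse e j :: post) (hleg : ∀ i, .leg e j i ∈ pre) :
    P.settings.exit pre.length 0 = .lost (P.idx (.fuse e j)) 0 := by
  have h0 : P.delay (.leg e j 0) ≠ 0 := (Nat.sub_pos_of_lt (idx_leg_lt h hleg 0)).ne'
  have h1 : P.delay (.leg e j 1) ≠ 0 := (Nat.sub_pos_of_lt (idx_leg_lt h hleg 1)).ne'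
  simp [Settings.exit, settings, getElem?_prog h, h0, h1, idx_eq h]

lemma arriving_fuse (h : P.prog = pre ++ .fuse e j :: post) (hleg : ∀ i, .leg e j i ∈ pre)
    (x : V → Fin 2) : P.arriving pre (.fuse e j) x =
      MvPolynomial.X (.fus 0, x (P.ends e 0)) * MvPolynomial.X (.fus 1, x (P.ends e 1)) := by
  have hset : (pre.toFinset.filter fun a => dest a = .fuse e j) =
      {.leg e j 0, .leg e j 1} := by
    ext a
    simp only [Finset.mem_filter, List.mem_toFinset, Finset.mem_insert, Finset.mem_singleton]
    constructor
    · rintro ⟨ha, hd⟩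
      cases a <;> simp only [dest, reduceCtorEq] at hd
      · rename_i e' j' i
        obtain ⟨rfl, rfl⟩ := by simpa using hd
        rcases Fin.exists_fin_two.1 ⟨i, rfl⟩ with rfl | rfl <;> simp
      · exact absurd (hd ▸ ha) (notMem_pre h)
    · rintro (rfl | rfl)
      · exact ⟨hleg 0, rfl⟩
      · exact ⟨hleg 1, rfl⟩
  rw [arriving, hset, Finset.prod_pair (by simp), exit_fuse h hleg, exit_fuse h hleg]
  rfl

/-- At an attempt to create an edge, the photons of its ends are detected, and the photon emitted
at this time is discarded. -/
lemma Inv.append_fuse {b : Fin 2} (hV : P.Valid ω) (hI : P.Inv ω pre fun _ => b)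
    (h : P.prog = pre ++ .fuse e j :: post) (hleg : ∀ i, .leg e j i ∈ pre)
    (hdone : P.settings.done (hist ω pre) = fused ω e j) :
    P.Inv ω (pre ++ [.fuse e j]) fun _ => b := by
  refine hI.append h (by simp) (by simp only [settings, getElem?_prog h]) fun x r => ?_
  rw [optics_leave h rfl x b b (MvPolynomial.X (.fus 0, x (P.ends e 0)) *
      MvPolynomial.X (.fus 1, x (P.ends e 1))) (MvPolynomial.X (.lost (P.idx (.fuse e j)) 0, b))
    (MvPolynomial.X_mem_supported.2 (.inl ⟨_, _, rfl⟩))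
    (by rw [exit_fuse_zero h hleg, arriving_fuse h hleg]; ring),
    algHom_rusCircuit (fun k hk => correctAndMeasure_X _ _ _ hk), hdone, hV.fuse, kraus,
    MvPolynomial.smul_eq_C_mul, photons]
  simp only [List.map_append, List.prod_append, List.map_cons, List.map_nil, List.prod_singleton,
    gone]
  ring

end Fuse

/-! ### The readouts -/

section Read

variable {v : V}

lemma idx_emit_lt_idx_read (h : P.prog = pre ++ .read v :: post) (hv : .emit v ∈ pre) :
    P.idx (.emit v) < P.idx (.read v) := by
  rw [idx_eq h]
  exact (idx_lt_iff h _).2 hv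

lemma exit_read (h : P.prog = pre ++ .read v :: post) :
    P.settings.exit pre.length (P.delay (.emit v)) = .meas := by
  simp [Settings.exit, settings, getElem?_prog h]

lemma exit_read_zero (h : P.prog = pre ++ .read v :: post) (hv : .emit v ∈ pre) :
    P.settings.exit pre.length 0 = .lost (P.idx (.read v)) 0 := by
  have h0 : P.delay (.emit v) ≠ 0 := (Nat.sub_pos_of_lt (idx_emit_lt_idx_read h hv)).ne'
  simp [Settings.exit, settings, getElem?_prog h, h0, idx_eq h]

lemma arriving_read (h : P.prog = pre ++ .read v :: post) (hv : .emit v ∈ pre) (x : V → Fin 2) :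
    P.arriving pre (.read v) x = MvPolynomial.X (.meas, x v) := by
  have hset : (pre.toFinset.filter fun a => dest a = .read v) = {.emit v} := by
    ext a
    simp only [Finset.mem_filter, List.mem_toFinset, Finset.mem_singleton]
    constructor
    · rintro ⟨ha, hd⟩
      cases a <;> simp only [dest, reduceCtorEq] at hd
      · simpa using hd
      · exact absurd (hd ▸ ha) (notMem_pre h)
    · rintro rfl
      exact ⟨hv, rfl⟩
  rw [arriving, hset, Finset.prod_singleton, exit_read h]
  rfl

lemma correct_read (h : P.prog = pre ++ .read v :: post)
    (hpre : ∀ a, Task.Before P.rank v a → a ∈ pre) (b : Fin 2) :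
    correct .meas (P.settings.x pre.length (hist ω pre)) (P.settings.z pre.length (hist ω pre))
      (MvPolynomial.X (.meas, b)) =
    MvPolynomial.C (sg ((b + P.x v ω) * P.z v ω)) * MvPolynomial.X (.meas, b + P.x v ω) := by
  have hlook : ∀ a, Task.Before P.rank v a → P.look (hist ω pre) a = ω a := fun a ha =>
    P.look_hist h ω (hpre a ha)
  simp only [settings, getElem?_prog h, correct_X, P.x_congr v _ _ hlook, P.z_congr v _ _ hlook]

lemma read_eq (hV : P.Valid ω) (h : P.prog = pre ++ .read v :: post)
    (hpre : ∀ a, Task.Before P.rank v a → a ∈ pre) (b : Fin 2) :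
    detectAll (ω (.read v)) (P.settings.correctAndMeasure pre.length (hist ω pre)
      (MvPolynomial.X (.meas, b))) =
    MvPolynomial.C (sg ((b + P.x v ω) * P.z v ω) * P.readAmp ω v (b + P.x v ω)) *
      match P.readout v with
      | .out => MvPolynomial.X (.out (P.idx (.read v)), b + P.x v ω)
      | _ => 1 := by
  have hplane : P.settings.plane pre.length = match P.readout v with
      | .out => none
      | .xy => some .XY
      | .yz _ => some .YZ := by
    simp only [settings, getElem?_prog h]
  have hangle : P.settings.angle pre.length = match P.readout v with
      | .yz α => α
      | _ => 0 := by
    simp only [settings, getElem?_prog h]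
  unfold Settings.correctAndMeasure
  rw [AlgHom.comp_apply, correct_read h hpre, hplane, hangle]
  have hro := hV.read_out v
  have hr := hV.read v
  cases hread : P.readout v with
  | out =>
    simp only [map_mul, rewire_X, if_true, readAmp, hread, mul_one]
    rw [MvPolynomial.algHom_C, MvPolynomial.algebraMap_eq, ← MvPolynomial.smul_eq_C_mul,
      detectAll_smul, ← MvPolynomial.smul_eq_C_mul, idx_eq h, hro hread,
      ← one_mul (MvPolynomial.X (Wire.out pre.length, _)), detectAll_mul, detectAll_noPhoton_one]
    exact MvPolynomial.X_mem_supported.2 (by simp [Undetected])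
  | xy =>
    simp only [map_mul, readAmp, hread, mul_one]
    rw [MvPolynomial.algHom_C, MvPolynomial.algebraMap_eq, ← MvPolynomial.smul_eq_C_mul,
      detectAll_smul, hr (by simp [hread]), detectAll_measCircuit_XY, ← hr (by simp [hread]),
      MvPolynomial.smul_eq_C_mul, map_mul]
  | yz α =>
    simp only [map_mul, readAmp, hread, mul_one]
    rw [MvPolynomial.algHom_C, MvPolynomial.algebraMap_eq, ← MvPolynomial.smul_eq_C_mul,
      detectAll_smul, hr (by simp [hread]), detectAll_measCircuit_YZ, ← hr (by simp [hread]),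
      MvPolynomial.smul_eq_C_mul]

/-- At a readout, the photon emitted for it is corrected and measured or released, and the photon
emitted at this time is discarded. -/
lemma Inv.append_read {b : Fin 2} (hV : P.Valid ω) (hI : P.Inv ω pre fun _ => b)
    (h : P.prog = pre ++ .read v :: post) (hv : .emit v ∈ pre)
    (hpre : ∀ a, Task.Before P.rank v a → a ∈ pre) :
    P.Inv ω (pre ++ [.read v]) fun _ => b := by
  refine hI.append h (by simp) (by simp only [settings, getElem?_prog h]) fun x r => ?_
  rw [optics_leave h rfl x b b (MvPolynomial.X (.meas, x v))
    (MvPolynomial.X (.lost (P.idx (.read v)) 0, b))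
    (MvPolynomial.X_mem_supported.2 (.inl ⟨_, _, rfl⟩))
    (by rw [exit_read_zero h hv, arriving_read h hv]; ring), rusCircuit_X_meas,
    read_eq hV h hpre, kraus, MvPolynomial.smul_eq_C_mul, photons]
  simp only [List.map_append, List.prod_append, List.map_cons, List.map_nil, List.prod_singleton,
    gone]
  cases P.readout v <;> ring

end Read

/-! ### The complete run -/

lemma lastCut_append_singleton (ω : Task V E k → Outcome) (vs : List V) (v : V) :
    lastCut ω (vs ++ [v]) = measBit (ω (.cut v)) := by simp [lastCut]

lemma prevCut_eq {vs vs' : List V} {v : V} (h : P.vlist = vs ++ v :: vs') :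
    P.prevCut ω v = lastCut ω vs := by
  have hn := P.nodup_vlist
  rw [h] at hn
  have hv : v ∉ vs := fun hv => (List.nodup_append'.1 hn).2.2 hv List.mem_cons_self
  rw [prevCut, h, List.takeWhile_append_of_pos]
  · simp
  · intro u hu
    simpa using fun e : u = v => hv (e ▸ hu)

/-- The emissions for one vertex. -/
lemma Inv.append_block {v : V} (hV : P.Valid ω) (hI : P.Inv ω pre fun _ => P.prevCut ω v)
    (h : P.prog = pre ++ (P.block v ++ post))
    (hpre : ∀ a ∈ pre, ∃ u, u ≠ v ∧ a ∈ P.block u) :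
    P.Inv ω (pre ++ P.block v) fun _ => measBit (ω (.cut v)) := by
  have hpre' : ∀ a ∈ pre, ∃ u, a ∈ P.block u := fun a ha => (hpre a ha).imp fun _ h => h.2
  have hblock : ∀ l, (∀ a ∈ l, a ∈ P.block v) → ∀ a ∈ pre ++ l, ∃ u, a ∈ P.block u := by
    intro l hl a ha
    rcases List.mem_append.1 ha with ha | ha
    · exact hpre' a ha
    · exact ⟨v, hl a ha⟩
  have h1 : P.Inv ω (pre ++ [.emit v]) fun x => x v := by
    by_cases hv : ∃ i, P.inp i = v
    · obtain ⟨i, rfl⟩ := hv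
      exact hI.append_emit_inp hV (by simpa [block] using h) hpre
    · exact hI.append_emit hV (by simpa [block] using h) hpre hv
  have h2 : P.Inv ω (pre ++ .emit v :: P.legs v) fun x => x v := by
    refine list_prefix_induction (Q := fun l => P.Inv ω (pre ++ .emit v :: l) fun x => x v) h1 ?_
    intro l₁ a l₂ hl ih
    have ha : a ∈ P.legs v := by rw [hl]; simp
    obtain ⟨e, j, i, he, rfl⟩ := P.mem_legs.1 ha
    have h3 := ih.append_leg (e := e) (j := j) (i := i) (post := l₂ ++ [.cut v] ++ post) hV he
      (by rw [h, block, hl]; simp) (hblock _ fun a ha => by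
        rcases List.mem_cons.1 ha with rfl | ha
        · simp [block]
        · refine List.mem_cons_of_mem _ (List.mem_append_left _ ?_)
          rw [hl]
          exact List.mem_append_left _ ha)
    simpa using h3
  have h4 := h2.append_cut hV (post := post) (by simpa [block] using h) (hblock _ fun a ha => by
    simp only [block, List.mem_cons, List.mem_append] at ha ⊢
    tauto)
  simpa [block] using h4

lemma inv_blocks (hV : P.Valid ω) :
    P.Inv ω (P.vlist.flatMap P.block) fun _ => lastCut ω P.vlist := by
  refine list_prefix_induction
    (Q := fun vs => P.Inv ω (vs.flatMap P.block) fun _ => lastCut ω vs) (P.inv_nil ω) ?_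
  intro vs v vs' hv ih
  rw [← prevCut_eq hv] at ih
  have hn := P.nodup_vlist
  rw [hv] at hn
  have hvs : v ∉ vs := fun hv => (List.nodup_append'.1 hn).2.2 hv List.mem_cons_self
  have h := ih.append_block (v := v) (post := vs'.flatMap P.block ++
    ((Finset.univ : Finset E).toList.flatMap (fuses k) ++ P.vlist.map .read)) hV (by
      rw [prog]
      conv_lhs => rw [show P.vlist.flatMap P.block = (vs ++ v :: vs').flatMap P.block by rw [hv]]
      simp) (by
      intro a ha
      obtain ⟨u, hu, ha⟩ := List.mem_flatMap.1 ha
      exact ⟨u, fun e => hvs (e ▸ hu), ha⟩)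
  rw [lastCut_append_singleton, List.flatMap_append]
  simpa using h

lemma leg_mem_blocks (e : E) (j : Fin k) (i : Fin 2) :
    Task.leg e j i ∈ P.vlist.flatMap P.block :=
  List.mem_flatMap.2 ⟨P.ends e i, P.mem_vlist _, mem_block.2 (.inr (.inl ⟨e, j, i, rfl, rfl⟩))⟩

lemma inv_fuses (hV : P.Valid ω) :
    P.Inv ω (P.vlist.flatMap P.block ++ (Finset.univ : Finset E).toList.flatMap (fuses k))
      fun _ => lastCut ω P.vlist := by
  refine list_prefix_induction (Q := fun es => P.Inv ω (P.vlist.flatMap P.block ++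
    es.flatMap (fuses k)) fun _ => lastCut ω P.vlist) (by simpa using inv_blocks hV) ?_
  intro es e es' he ih
  have h1 : P.Inv ω (P.vlist.flatMap P.block ++ es.flatMap (fuses k) ++
      (List.finRange k).map (.fuse e)) fun _ => lastCut ω P.vlist := by
    refine list_prefix_induction (Q := fun js => P.Inv ω (P.vlist.flatMap P.block ++
      es.flatMap (fuses k) ++ js.map (.fuse e)) fun _ => lastCut ω P.vlist) (by simpa using ih) ?_
    intro js j js' hj ih'
    have hprog : P.prog = (P.vlist.flatMap P.block ++ es.flatMap (fuses k) ++ js.map (.fuse e)) ++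
        .fuse e j :: (js'.map (.fuse e) ++ es'.flatMap (fuses k) ++ P.vlist.map .read) := by
      rw [prog, he]
      conv_lhs => rw [List.flatMap_append, List.flatMap_cons, fuses, hj]
      simp
    have h2 := ih'.append_fuse hV hprog
      (fun i => List.mem_append_left _ (List.mem_append_left _ (P.leg_mem_blocks e j i)))
      (done_hist hj hprog)
    simpa using h2
  simpa [fuses] using h1

/-- The state after the complete run. -/
lemma inv_prog (hV : P.Valid ω) : P.Inv ω P.prog fun _ => lastCut ω P.vlist := by
  rw [prog, ← List.append_assoc]
  refine list_prefix_induction (Q := fun vs => P.Inv ω (P.vlist.flatMap P.block ++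
    (Finset.univ : Finset E).toList.flatMap (fuses k) ++ vs.map .read)
      fun _ => lastCut ω P.vlist) (by simpa using inv_fuses hV) ?_
  intro vs v vs' hv ih
  have hprog : P.prog = (P.vlist.flatMap P.block ++
      (Finset.univ : Finset E).toList.flatMap (fuses k) ++ vs.map .read) ++
      .read v :: vs'.map .read := by
    rw [prog]
    conv_lhs => rw [show P.vlist.map (.read : V → Task V E k) = (vs ++ v :: vs').map .read by
      rw [hv]]
    simp
  have h2 := ih.append_read hV hprog
    (by
      refine List.mem_append_left _ (List.mem_append_left _ (List.mem_flatMap.2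
        ⟨v, P.mem_vlist v, mem_block.2 (.inl rfl)⟩)))
    (by
      intro a ha
      have hmem := P.mem_prog a
      rw [prog, ← List.append_assoc] at hmem
      rcases List.mem_append.1 hmem with hmem | hmem
      · exact List.mem_append_left _ hmem
      · obtain ⟨u, -, rfl⟩ := List.mem_map.1 hmem
        exact List.mem_append_right _ (List.mem_map.2 ⟨u, P.mem_of_rank_lt hv ha, rfl⟩))
  simpa using h2

lemma inflight_prog (x : V → Fin 2) : P.inflight P.prog x = 1 := by
  rw [inflight, Finset.filter_false_of_mem]
  · simp
  · intro a _
    simp [P.mem_prog]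

end Plan

/-! ### The amplitude of a successful record -/

lemma list_prod_map_flatMap {α β M : Type*} [CommMonoid M] (l : List α) (g : α → List β)
    (f : β → M) : ((l.flatMap g).map f).prod = (l.map fun a => ((g a).map f).prod).prod := by
  induction l with
  | nil => simp
  | cons a l ih => simp [ih]

lemma ii_pow_four (b : Fin 2) : ii b ^ 4 = 1 := by
  unfold ii
  split_ifs <;> simp

namespace Plan

variable {V E : Type} [Fintype V] [DecidableEq V] [Fintype E] [DecidableEq E] {k m n : ℕ}
  (P : Plan V E k m n)

lemma prod_vlist {M : Type*} [CommMonoid M] (f : V → M) : (P.vlist.map f).prod = ∏ v, f v := by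
  rw [(P.vlist_perm.map f).prod_eq, Finset.prod_map_toList]

/-- The product over all tasks, sorted by their kind. -/
lemma prod_prog {M : Type*} [CommMonoid M] (f : Task V E k → M)
    (hleg : ∀ e j i, f (.leg e j i) = 1) : (P.prog.map f).prod =
      (∏ v, f (.emit v) * f (.cut v)) * ((∏ e, ∏ j, f (.fuse e j)) * ∏ v, f (.read v)) := by
  rw [prog, List.map_append, List.map_append, List.prod_append, List.prod_append,
    list_prod_map_flatMap, list_prod_map_flatMap, prod_vlist, Finset.prod_map_toList, List.map_map,
    prod_vlist]
  congr 1
  · refine Finset.prod_congr rfl fun v _ => ?_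
    have : ((P.legs v).map f).prod = 1 := List.prod_eq_one fun y hy => by
      obtain ⟨a, ha, rfl⟩ := List.mem_map.1 hy
      obtain ⟨e, j, i, -, rfl⟩ := P.mem_legs.1 ha
      exact hleg e j i
    simp [block, this]
  · congr 1
    refine Finset.prod_congr rfl fun e _ => ?_
    rw [fuses, List.map_map, ← List.ofFn_eq_map, List.prod_ofFn]
    rfl

/-- The Pauli `Z` by-product on the end `i` of the edge `e`. -/
def edgeZ (ω : Task V E k → Outcome) (e : E) (i : Fin 2) : Fin 2 :=
  ∑ j, zBit (fused ω e j) (ω (.fuse e j)) i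

/-- The Pauli `Z` by-product on a vertex. -/
def vertexZ (ω : Task V E k → Outcome) (v : V) : Fin 2 :=
  (∑ e, ∑ i, if P.ends e i = v then edgeZ ω e i else 0) + measBit (ω (.cut v)) +
    if ∃ i, P.inp i = v then 0 else P.prevCut ω v

/-- The attempt `J e` is the first that creates the edge `e`. -/
def FirstSuccess (ω : Task V E k → Outcome) (J : E → Fin k) : Prop :=
  ∀ e j, (!fused ω e j && (ω (.fuse e j)).success) = decide (j = J e)

variable {P} {ω : Task V E k → Outcome} {J : E → Fin k}

/-- The phase gates of the failed attempts and of the separate measurements cancel, since their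
number is a multiple of four. -/
lemma prod_fuseAmp (hk : k % 4 = 1) (hJ : FirstSuccess ω J) (e : E) (b₀ b₁ : Fin 2) :
    ∏ j, fuseAmp (fused ω e j) (ω (.fuse e j)) b₀ b₁ =
      (∏ j, fuseScale (fused ω e j) (ω (.fuse e j))) * sg (b₀ * b₁) *
        (sg (edgeZ ω e 0 * b₀) * sg (edgeZ ω e 1 * b₁)) := by
  -- Exactly one attempt contributes the controlled `Z`; `k - 1` is a multiple of four.
  have h1 : ∏ j : Fin k, (if j = J e then sg (b₀ * b₁) else ii b₀ * ii b₁) = sg (b₀ * b₁) := by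
    rw [← Finset.mul_prod_erase _ _ (Finset.mem_univ (J e)), if_pos rfl,
      Finset.prod_congr rfl fun j hj => if_neg (Finset.ne_of_mem_erase hj), Finset.prod_const,
      Finset.card_erase_of_mem (Finset.mem_univ _), Finset.card_univ, Fintype.card_fin]
    obtain ⟨q, hq⟩ : ∃ q, k - 1 = 4 * q := ⟨k / 4, by omega⟩
    rw [hq, pow_mul, mul_pow, ii_pow_four, ii_pow_four]
    simp
  have h2 : ∀ i b, ∏ j, sg (zBit (fused ω e j) (ω (.fuse e j)) i * b) = sg (edgeZ ω e i * b) := by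
    intro i b
    rw [edgeZ, Finset.sum_mul, sg_sum]
  simp only [fuseAmp, hJ e, decide_eq_true_eq, Finset.prod_mul_distrib, h1, h2]
  ring

lemma prod_edgeZ (x : V → Fin 2) :
    ∏ e, (sg (edgeZ ω e 0 * x (P.ends e 0)) * sg (edgeZ ω e 1 * x (P.ends e 1))) =
      ∏ v, sg (x v * ∑ e, ∑ i, if P.ends e i = v then edgeZ ω e i else 0) := by
  rw [← sg_sum]
  simp only [← sg_add, Finset.mul_sum]
  rw [← sg_sum, Finset.sum_comm]
  congr 1
  refine Finset.sum_congr rfl fun e _ => ?_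
  rw [Finset.sum_comm, Fin.sum_univ_two]
  simp [mul_comm]

lemma card_inp (P : Plan V E k m n) :
    (Finset.univ.filter fun v => ¬ ∃ i, P.inp i = v).card = Fintype.card V - m := by
  have h : (Finset.univ.filter fun v => ¬ ∃ i, P.inp i = v) = (Finset.univ.image P.inp)ᶜ := by
    ext v; simp
  rw [h, Finset.card_compl, Finset.card_image_of_injective _ P.inp_injective, Finset.card_univ,
    Fintype.card_fin]

lemma prod_emit (x : V → Fin 2) (r : Fin m → Fin 2) :
    ∏ v, P.kraus ω x r (.emit v) = 2 ^ Fintype.card V *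
      ((((Real.sqrt 2 : ℝ) : ℂ)⁻¹ ^ (Fintype.card V - m) *
        if r = fun i => P.prevCut ω (P.inp i) then 1 else 0) *
        ∏ v, sg (x v * if ∃ i, P.inp i = v then 0 else P.prevCut ω v)) := by
  have h : ∀ v, P.kraus ω x r (.emit v) = 2 * (((if ¬ ∃ i, P.inp i = v then
      ((Real.sqrt 2 : ℝ) : ℂ)⁻¹ else 1) * if ∀ i, P.inp i = v → r i = P.prevCut ω v then 1 else 0) *
      sg (x v * if ∃ i, P.inp i = v then 0 else P.prevCut ω v)) := by
    intro v
    by_cases hv : ∃ i, P.inp i = v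
    · have : (∀ i, P.inp i = v → r i = P.prevCut ω v) ↔ r hv.choose = P.prevCut ω v :=
        ⟨fun h => h _ hv.choose_spec, fun h i hi => by
          rw [← h, P.inp_injective (hi.trans hv.choose_spec.symm)]⟩
      simp only [kraus, dif_pos hv, this]
      simp [hv]
    · have : ∀ i, P.inp i = v → r i = P.prevCut ω v := fun i hi => absurd ⟨i, hi⟩ hv
      simp only [kraus, dif_neg hv, if_pos this]
      simp [hv]
  simp only [h, Finset.prod_mul_distrib]
  rw [Finset.prod_const, Finset.card_univ, ← Finset.prod_filter, Finset.prod_const, card_inp]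
  congr 3
  rw [Finset.prod_ite_zero, Finset.prod_const_one]
  congr 1
  simp only [Finset.mem_univ, true_implies, eq_iff_iff]
  constructor
  · intro h
    ext1 i
    exact h _ i rfl
  · rintro rfl v i rfl
    rfl

/-- The amplitude of a record in which every edge is created. -/
lemma amp_prog (hk : k % 4 = 1) (hJ : FirstSuccess ω J) (ψ : (Fin m → Fin 2) → ℂ)
    (x : V → Fin 2) (r : Fin m → Fin 2) :
    P.amp ω P.prog ψ x r = 2 ^ Fintype.card V *
      ((((Real.sqrt 2 : ℝ) : ℂ)⁻¹ ^ (Fintype.card V - m) *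
        ((Real.sqrt 2 : ℝ) : ℂ)⁻¹ ^ Fintype.card V *
        ∏ e, ∏ j, fuseScale (fused ω e j) (ω (.fuse e j))) *
        if r = fun i => P.prevCut ω (P.inp i) then 1 else 0) *
      (ψ (fun i => x (P.inp i)) * (∏ v, sg (x v * P.vertexZ ω v)) *
        (∏ e, sg (x (P.ends e 0) * x (P.ends e 1))) *
        ∏ v, sg ((x v + P.x v ω) * P.z v ω) * P.readAmp ω v (x v + P.x v ω)) := by
  have hmem : ∀ i, Task.emit (P.inp i) ∈ P.prog := fun i => P.mem_prog _
  have hZ : ∏ v, sg (x v * P.vertexZ ω v) =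
      (∏ v, sg (x v * ∑ e, ∑ i, if P.ends e i = v then edgeZ ω e i else 0)) *
      (∏ v, sg (measBit (ω (.cut v)) * x v)) *
      ∏ v, sg (x v * if ∃ i, P.inp i = v then 0 else P.prevCut ω v) := by
    rw [← Finset.prod_mul_distrib, ← Finset.prod_mul_distrib]
    refine Finset.prod_congr rfl fun v _ => ?_
    rw [← sg_add, ← sg_add, vertexZ, mul_add, mul_add, mul_comm (measBit _)]
  simp only [amp, hmem, if_true]
  rw [P.prod_prog _ fun _ _ _ => rfl, Finset.prod_mul_distrib, prod_emit, hZ, ← prod_edgeZ]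
  simp only [kraus, prod_fuseAmp hk hJ]
  simp only [Finset.prod_mul_distrib, Finset.prod_const, Finset.card_univ]
  ring

/-- The tasks at which the photon emitted at the same time is discarded. -/
def discards : (E × Fin k) ⊕ V → Task V E k := Sum.elim (fun p => .fuse p.1 p.2) .read

lemma discards_injective : Function.Injective (discards : (E × Fin k) ⊕ V → Task V E k) := by
  rintro (⟨e, j⟩ | v) (⟨e', j'⟩ | v') h <;> simp_all [discards]

/-- The photons that are discarded during the complete run; `b` is the final content of the
emitter. -/
def discarded (P : Plan V E k m n) (b : Fin 2) : Fock :=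
  ∏ a, MvPolynomial.X (.lost (P.idx (discards a)) 0, b)

lemma outp_injective (P : Plan V E k m n) : Function.Injective P.outp := fun i j h =>
  P.outp_strictMono.injective (by simp [h])

lemma prod_gone (x : V → Fin 2) (b : Fin 2) : (P.prog.map (P.gone ω x b)).prod =
    P.discarded b * ∏ i, MvPolynomial.X (.out (P.settings.outTime i),
      x (P.outp i) + P.x (P.outp i) ω) := by
  have hout : (∏ v, match P.readout v with
      | .out => (MvPolynomial.X (.out (P.idx (.read v)), x v + P.x v ω) : Fock)
      | _ => 1) = ∏ i, MvPolynomial.X (.out (P.settings.outTime i),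
      x (P.outp i) + P.x (P.outp i) ω) := by
    have h : ∀ v, (match P.readout v with
      | .out => (MvPolynomial.X (.out (P.idx (.read v)), x v + P.x v ω) : Fock)
      | _ => 1) = if v ∈ Finset.univ.image P.outp then
        MvPolynomial.X (.out (P.idx (.read v)), x v + P.x v ω) else 1 := by
      intro v
      have hv := P.readout_eq_out v
      have hmem : v ∈ Finset.univ.image P.outp ↔ ∃ i, P.outp i = v := by simp
      by_cases hc : P.readout v = .out
      · rw [if_pos (hmem.2 (hv.1 hc)), hc]
      · rw [if_neg fun h => hc (hv.2 (hmem.1 h))]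
        cases h : P.readout v <;> simp_all
    simp only [h]
    rw [Finset.prod_ite_mem, Finset.univ_inter, Finset.prod_image P.outp_injective.injOn]
    rfl
  rw [P.prod_prog _ fun _ _ _ => rfl]
  simp only [gone, Finset.prod_mul_distrib, discarded, Fintype.prod_sum_type,
    Fintype.prod_prod_type, discards, Sum.elim_inl, Sum.elim_inr]
  rw [← hout]
  simp only [Finset.prod_const_one, one_mul, mul_assoc]

/-- The part of the amplitude of a record that does not depend on the basis state of the
vertices. -/
def scale (_P : Plan V E k m n) (ω : Task V E k → Outcome) : ℂ :=
  ((Real.sqrt 2 : ℝ) : ℂ)⁻¹ ^ (Fintype.card V - m) *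
  ((Real.sqrt 2 : ℝ) : ℂ)⁻¹ ^ Fintype.card V * ∏ e, ∏ j, fuseScale (fused ω e j) (ω (.fuse e j))

variable (P ω) in
/-- The amplitude with which the basis state `x` of the vertices contributes to a record. -/
def coef (ψ : (Fin m → Fin 2) → ℂ) (x : V → Fin 2) : ℂ :=
  ψ (fun i => x (P.inp i)) * (∏ v, sg (x v * P.vertexZ ω v)) *
    (∏ e, sg (x (P.ends e 0) * x (P.ends e 1))) *
    ∏ v, sg ((x v + P.x v ω) * P.z v ω) * P.readAmp ω v (x v + P.x v ω)

/-- The final state of the run for a record in which every edge is created. -/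
lemma run_prog (hk : k % 4 = 1) (hV : P.Valid ω) (hJ : FirstSuccess ω J)
    (ψ : (Fin m → Fin 2) → ℂ) (b : Fin 2) (r : Fin m → Fin 2) :
    P.settings.run ψ (hist ω P.prog) b r =
      (if b = lastCut ω P.vlist ∧ r = fun i => P.prevCut ω (P.inp i) then
        P.scale ω • P.discarded b else 0) *
      ∑ x : V → Fin 2, P.coef ω ψ x • ∏ i, MvPolynomial.X (.out (P.settings.outTime i),
        x (P.outp i) + P.x (P.outp i) ω) := by
  rw [inv_prog hV ψ b r]
  by_cases hb : b = lastCut ω P.vlist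
  swap
  · simp [hb]
  simp only [if_pos hb, photons, inflight_prog, mul_one, prod_gone, amp_prog hk hJ]
  by_cases hr : r = fun i => P.prevCut ω (P.inp i)
  swap
  · simp [hr]
  rw [if_pos (show _ ∧ _ from ⟨hb, hr⟩), Finset.smul_sum, Finset.mul_sum]
  refine Finset.sum_congr rfl fun x _ => ?_
  rw [if_pos hr, mul_one]
  change (1 / 2 : ℂ) ^ Fintype.card V • (2 ^ Fintype.card V * P.scale ω * P.coef ω ψ x) •
    (P.discarded b * _) = (P.scale ω • P.discarded b) * P.coef ω ψ x • _
  rw [smul_mul_smul_comm, smul_smul]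
  congr 1
  have : (1 / 2 : ℂ) ^ Fintype.card V * 2 ^ Fintype.card V = 1 := by
    rw [← mul_pow]; norm_num
  linear_combination (P.scale ω * P.coef ω ψ x) * this

end Plan

/-! ### The measurement pattern of a layered circuit -/

/-- The vertices of the graph: for each layer one for every parity `y`, whose measurement applies a
phase to that parity, and one for every qubit. -/
abbrev Vtx (L n : ℕ) : Type := (Fin (L + 1) × (Fin n → Fin 2)) ⊕ (Fin (L + 1) × Fin n)

/-- The edges of the graph: each qubit is joined to itself in the next layer, and each parity to the
qubits in its support. -/
abbrev Edg (L n : ℕ) : Type :=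
  (Fin L × Fin n) ⊕ {p : Fin (L + 1) × (Fin n → Fin 2) × Fin n // p.2.1 p.2.2 = 1}

variable {L n k m : ℕ}

/-- The by-product `X` on a qubit, given by the measurement of the qubit in the layer before. -/
def flow (ω : Task (Vtx L n) (Edg L n) k → Outcome) (l : Fin (L + 1)) (j : Fin n) : Fin 2 :=
  Fin.cases 0 (fun l' => measBit (ω (.read (.inr (l'.castSucc, j))))) l

/-- The by-product `X` in the layer before. -/
def prevFlow (ω : Task (Vtx L n) (Edg L n) k → Outcome) (l : Fin (L + 1)) (j : Fin n) : Fin 2 :=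
  Fin.cases 0 (fun l' => flow ω l'.castSucc j) l

/-- The order in which the vertices are read out: by layers, in each layer the parities first. -/
def vtxRank : Vtx L n → ℕ :=
  Sum.elim (fun p => p.1.val * (n + 1)) fun p => p.1.val * (n + 1) + 1 + p.2.val

lemma flow_congr {v : Vtx L n} {ω ω' : Task (Vtx L n) (Edg L n) k → Outcome}
    (h : ∀ a, Task.Before vtxRank v a → ω a = ω' a) {l : Fin (L + 1)}
    (hl : l.val * (n + 1) ≤ vtxRank v) (j : Fin n) : flow ω l j = flow ω' l j := by
  cases l using Fin.cases with
  | zero => rfl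
  | succ l =>
    simp only [flow, Fin.cases_succ]
    rw [h]
    simp only [Task.Before, vtxRank, Sum.elim_inr, Fin.val_castSucc] at hl ⊢
    rw [Fin.val_succ, Nat.succ_mul] at hl
    have := j.isLt
    omega

lemma prevFlow_congr {v : Vtx L n} {ω ω' : Task (Vtx L n) (Edg L n) k → Outcome}
    (h : ∀ a, Task.Before vtxRank v a → ω a = ω' a) {l : Fin (L + 1)}
    (hl : l.val * (n + 1) ≤ vtxRank v) (j : Fin n) : prevFlow ω l j = prevFlow ω' l j := by
  cases l using Fin.cases with
  | zero => rfl
  | succ l =>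
    simp only [prevFlow, Fin.cases_succ]
    refine flow_congr h ?_ j
    rw [Fin.val_succ, Nat.succ_mul] at hl
    rw [Fin.val_castSucc]
    omega

/-- The measurement pattern without its `Z` corrections. -/
def patternCore (L k : ℕ) (hm : m ≤ n) (α : ℕ → (Fin n → Fin 2) → ℝ) :
    Plan (Vtx L n) (Edg L n) k m n where
  ends := Sum.elim (fun e => ![.inr (e.1.castSucc, e.2), .inr (e.1.succ, e.2)])
    fun e => ![.inl (e.1.1, e.1.2.1), .inr (e.1.1, e.1.2.2)]
  rank := vtxRank
  inp i := .inr (0, Fin.castLE hm i)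
  inp_strictMono i j h := by simpa [vtxRank] using h
  outp i := .inr (Fin.last L, i)
  outp_strictMono i j h := by simpa [vtxRank] using h
  readout := Sum.elim (fun p => .yz (α p.1 p.2)) fun p => if p.1 = Fin.last L then .out else .xy
  readout_eq_out v := by
    rcases v with p | ⟨l, j⟩
    · simp
    · by_cases h : l = Fin.last L
      · simp [h]
      · simp [h, Ne.symm h]
  x v ω := Sum.elim (fun _ => 0) (fun p => flow ω p.1 p.2) v
  z _ _ := 0
  x_congr v ω ω' h := by
    rcases v with p | ⟨l, j⟩
    · rfl
    · exact flow_congr h (by simp only [vtxRank, Sum.elim_inr]; omega) j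
  z_congr _ _ _ _ := rfl

/-- The part of the `Z` corrections that is due to the measurements of other vertices. -/
def flowZ (ω : Task (Vtx L n) (Edg L n) k → Outcome) : Vtx L n → Fin 2 :=
  Sum.elim (fun p => dot p.2 (flow ω p.1))
    fun p => prevFlow ω p.1 p.2 + ∑ y : Fin n → Fin 2, measBit (ω (.read (.inl (p.1, y)))) * y p.2

lemma flowZ_congr {v : Vtx L n} {ω ω' : Task (Vtx L n) (Edg L n) k → Outcome}
    (h : ∀ a, Task.Before vtxRank v a → ω a = ω' a) : flowZ ω v = flowZ ω' v := by
  rcases v with p | ⟨l, j⟩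
  · simp only [flowZ, Sum.elim_inl]
    congr 1
    ext1 j
    exact flow_congr h (by simp [vtxRank]) j
  · simp only [flowZ, Sum.elim_inr]
    rw [prevFlow_congr h (by simp only [vtxRank, Sum.elim_inr]; omega) j]
    congr 1
    refine Finset.sum_congr rfl fun y _ => ?_
    rw [h]
    simp only [Task.Before, vtxRank, Sum.elim_inr, Sum.elim_inl]
    omega

lemma Plan.vertexZ_congr {V E : Type} [Fintype V] [DecidableEq V] [Fintype E] [DecidableEq E]
    (P : Plan V E k m n) {v : V} {ω ω' : Task V E k → Outcome}
    (h : ∀ a, Task.Before P.rank v a → ω a = ω' a) (u : V) : P.vertexZ ω u = P.vertexZ ω' u := by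
  have hf : ∀ e j, ω (.fuse e j) = ω' (.fuse e j) := fun e j => h _ trivial
  have hc : ∀ w, ω (.cut w) = ω' (.cut w) := fun w => h _ trivial
  have hl : ∀ vs, lastCut ω vs = lastCut ω' vs := fun vs => by
    unfold lastCut
    split <;> simp [hc]
  have hd : ∀ e j, fused ω e j = fused ω' e j := fun e j => by simp [fused, hf]
  simp only [vertexZ, edgeZ, prevCut, hf, hc, hl, hd]

/-- The measurement pattern for the product of the first `L + 1` layers: the parities are measured
in the `YZ` plane, which applies the diagonal layers, and the qubits of all layers but the last in
the `XY` plane, which applies Hadamard gates on all qubits. -/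
def pattern (L k : ℕ) (hm : m ≤ n) (α : ℕ → (Fin n → Fin 2) → ℝ) :
    Plan (Vtx L n) (Edg L n) k m n :=
  { patternCore L k hm α with
    z := fun v ω => (patternCore L k hm α).vertexZ ω v + flowZ ω v
    z_congr := fun v ω ω' h => by
      rw [(patternCore L k hm α).vertexZ_congr h v, flowZ_congr h] }

section Coef

variable {hm : m ≤ n} {α : ℕ → (Fin n → Fin 2) → ℝ}
  {ω : Task (Vtx L n) (Edg L n) k → Outcome}

lemma pattern_z (v : Vtx L n) : (pattern L k hm α).z v ω =
    (pattern L k hm α).vertexZ ω v + flowZ ω v := rfl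

lemma add_add_self (a b : Fin 2) : a + b + b = a := by
  revert a b; decide

lemma dot_add (y a b : Fin n → Fin 2) : dot y (a + b) = dot y a + dot y b := by
  simp [dot, mul_add, Finset.sum_add_distrib]

/-- The controlled `Z` gates of the graph. -/
lemma prod_edges (x : Vtx L n → Fin 2) :
    ∏ e, sg (x ((pattern L k hm α).ends e 0) * x ((pattern L k hm α).ends e 1)) =
      (∏ l : Fin L, ∏ j, sg (x (.inr (l.castSucc, j)) * x (.inr (l.succ, j)))) *
      ∏ l, ∏ y, sg (x (.inl (l, y)) * dot y fun j => x (.inr (l, j))) := by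
  rw [Fintype.prod_sum_type, Fintype.prod_prod_type]
  congr 1
  have h : ∀ p : Fin (L + 1) × (Fin n → Fin 2) × Fin n,
      (if p.2.1 p.2.2 = 1 then sg (x (.inl (p.1, p.2.1)) * x (.inr (p.1, p.2.2))) else 1) =
        sg (x (.inl (p.1, p.2.1)) * (p.2.1 p.2.2 * x (.inr (p.1, p.2.2)))) := by
    intro p
    rcases Fin.exists_fin_two.1 ⟨p.2.1 p.2.2, rfl⟩ with h | h <;> simp [h]
  have h1 := Finset.prod_subtype (F := inferInstance) (p := fun p => p.2.1 p.2.2 = 1)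
    (Finset.univ.filter fun p :
    Fin (L + 1) × (Fin n → Fin 2) × Fin n => p.2.1 p.2.2 = 1) (by simp)
    fun p => sg (x (.inl (p.1, p.2.1)) * x (.inr (p.1, p.2.2)))
  refine h1.symm.trans ?_
  rw [Finset.prod_filter]
  simp only [h, Fintype.prod_prod_type, dot, Finset.mul_sum, sg_sum]

variable (hm α ω) in
/-- The sign of a record. -/
def signOf : ℂ :=
  (∏ v, sg ((pattern L k hm α).x v ω * (pattern L k hm α).vertexZ ω v)) *
    ∏ l : Fin L, ∏ j, sg (flow ω l.castSucc j * flow ω l.succ j)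

lemma norm_signOf : ‖signOf hm α ω‖ = 1 := by
  simp [signOf, norm_prod]

lemma prod_readAmp (x : Vtx L n → Fin 2) :
    ∏ v, (pattern L k hm α).readAmp ω v (x v) =
      (∏ l : Fin (L + 1), ∏ y, (1 + sg (measBit (ω (.read (.inl (l, y))))) * sg (x (.inl (l, y))) *
        Complex.exp (-(α l y * Complex.I))) / 2) *
      ∏ l : Fin L, ∏ j, ((Real.sqrt 2 : ℝ) : ℂ)⁻¹ *
        sg (flow ω l.succ j * x (.inr (l.castSucc, j))) := by
  rw [Fintype.prod_sum_type, Fintype.prod_prod_type, Fintype.prod_prod_type]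
  congr 1
  rw [Fin.prod_univ_castSucc]
  have h : ∀ l : Fin L, l.castSucc ≠ Fin.last L := fun l => (Fin.castSucc_lt_last l).ne
  simp [Plan.readAmp, pattern, patternCore, h, flow]

lemma prod_flowZ (x : Vtx L n → Fin 2) : ∏ v, sg (x v * flowZ ω v) =
    (∏ l, ∏ y, sg (x (.inl (l, y)) * dot y (flow ω l))) *
    ((∏ l : Fin L, ∏ j, sg (x (.inr (l.succ, j)) * flow ω l.castSucc j)) *
      ∏ l, ∏ y, sg (measBit (ω (.read (.inl (l, y)))) * dot y fun j => x (.inr (l, j)))) := by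
  rw [Fintype.prod_sum_type, Fintype.prod_prod_type, Fintype.prod_prod_type]
  congr 1
  simp only [flowZ, Sum.elim_inr, mul_add, sg_add, Finset.prod_mul_distrib]
  congr 1
  · rw [Fin.prod_univ_succ]
    simp [prevFlow]
  · refine Finset.prod_congr rfl fun l _ => ?_
    simp only [dot, Finset.mul_sum, ← sg_sum]
    rw [Finset.sum_comm]
    congr 1
    exact Finset.sum_congr rfl fun y _ => Finset.sum_congr rfl fun j _ => by
      rw [mul_comm, mul_assoc]

/-- In the frame that is shifted by the `X` by-products, all by-products cancel. -/
lemma coef_add (ψ : (Fin m → Fin 2) → ℂ) (x : Vtx L n → Fin 2) :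
    (pattern L k hm α).coef ω ψ (x + fun v => (pattern L k hm α).x v ω) =
      signOf hm α ω * (ψ (fun i => x (.inr (0, Fin.castLE hm i))) *
      (∏ l : Fin (L + 1), ∏ y, sg (x (.inl (l, y)) * dot y fun j => x (.inr (l, j))) *
        sg (measBit (ω (.read (.inl (l, y)))) * dot y fun j => x (.inr (l, j))) *
        ((1 + sg (measBit (ω (.read (.inl (l, y))))) * sg (x (.inl (l, y))) *
          Complex.exp (-(α l y * Complex.I))) / 2)) *
      ∏ l : Fin L, hadN n (fun j => x (.inr (l.succ, j))) fun j => x (.inr (l.castSucc, j))) := by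
  have hin : (fun i => (x + fun v => (pattern L k hm α).x v ω) ((pattern L k hm α).inp i)) =
      fun i => x (.inr (0, Fin.castLE hm i)) := by
    ext1 i
    change x _ + 0 = _
    rw [add_zero]
    rfl
  have hZ : (∏ v, sg ((x v + (pattern L k hm α).x v ω) * (pattern L k hm α).vertexZ ω v)) *
      ∏ v, sg (x v * ((pattern L k hm α).vertexZ ω v + flowZ ω v)) =
      (∏ v, sg ((pattern L k hm α).x v ω * (pattern L k hm α).vertexZ ω v)) *
        ∏ v, sg (x v * flowZ ω v) := by
    rw [← Finset.prod_mul_distrib, ← Finset.prod_mul_distrib]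
    refine Finset.prod_congr rfl fun v _ => ?_
    rw [add_mul, mul_add, sg_add, sg_add]
    linear_combination sg ((pattern L k hm α).x v ω * (pattern L k hm α).vertexZ ω v) *
      sg (x v * flowZ ω v) * sg_mul_self (x v * (pattern L k hm α).vertexZ ω v)
  have hE := prod_edges (k := k) (hm := hm) (α := α) (x + fun v => (pattern L k hm α).x v ω)
  have hx1 : ∀ p, (x + fun v => (pattern L k hm α).x v ω) (.inl p) = x (.inl p) := fun p => by
    change x _ + 0 = _
    rw [add_zero]
  have hx2 : ∀ l j, (x + fun v => (pattern L k hm α).x v ω) (.inr (l, j)) =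
    x (.inr (l, j)) + flow ω l j := fun l j => rfl
  simp only [hx1, hx2] at hE
  have hd : ∀ l y, (dot y fun j => x (.inr (l, j)) + flow ω l j) =
    (dot y fun j => x (.inr (l, j))) + dot y (flow ω l) := fun l y => dot_add y _ _
  simp only [hd, mul_add, add_mul, sg_add, Finset.prod_mul_distrib] at hE
  have hF := prod_flowZ (ω := ω) x
  have hR := prod_readAmp (hm := hm) (α := α) (ω := ω) x
  have hC : ∀ f : Fin L → Fin n → Fin 2, (∏ l, ∏ j, sg (f l j)) * ∏ l, ∏ j, sg (f l j) = 1 := by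
    intro f
    simp only [← Finset.prod_mul_distrib, sg_mul_self, Finset.prod_const_one]
  have hG : ∀ f : Fin (L + 1) → (Fin n → Fin 2) → Fin 2,
      (∏ l, ∏ j, sg (f l j)) * ∏ l, ∏ j, sg (f l j) = 1 := by
    intro f
    simp only [← Finset.prod_mul_distrib, sg_mul_self, Finset.prod_const_one]
  have hH : ∏ l : Fin L, hadN n (fun j => x (.inr (l.succ, j)))
      (fun j => x (.inr (l.castSucc, j))) =
      (∏ l : Fin L, ∏ _j : Fin n, ((Real.sqrt 2 : ℝ) : ℂ)⁻¹) *
      ∏ l : Fin L, ∏ j, sg (x (.inr (l.castSucc, j)) * x (.inr (l.succ, j))) := by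
    rw [← Finset.prod_mul_distrib]
    refine Finset.prod_congr rfl fun l _ => ?_
    rw [hadN_apply, dot, sg_sum, Finset.prod_const, Finset.card_univ, Fintype.card_fin, mul_comm]
    congr 1
    exact Finset.prod_congr rfl fun j _ => by rw [mul_comm]
  have h2 := hC fun l j => x (.inr (l.castSucc, j)) * flow ω l.succ j
  have h3 := hC fun l j => x (.inr (l.succ, j)) * flow ω l.castSucc j
  have h4 := hG fun l y => x (.inl (l, y)) * dot y (flow ω l)
  rw [Plan.coef, hin, hE, signOf, hH]
  simp only [pattern_z, Pi.add_apply, add_add_self]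
  rw [Finset.prod_mul_distrib, hR]
  simp only [Finset.prod_mul_distrib, mul_comm (flow ω (Fin.succ _) _) (x _),
    mul_comm (flow ω (Fin.castSucc _) _) (x _)]
  rw [hF] at hZ
  generalize (∏ l : Fin L, ∏ j, sg (x (.inr (l.castSucc, j)) * flow ω l.succ j)) = C2 at *
  generalize (∏ l : Fin L, ∏ j, sg (x (.inr (l.succ, j)) * flow ω l.castSucc j)) = C3 at *
  generalize (∏ l, ∏ y, sg (x (.inl (l, y)) * dot y (flow ω l))) = G2 at *
  generalize (∏ v, sg ((x v + (pattern L k hm α).x v ω) * (pattern L k hm α).vertexZ ω v)) = S1 at *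
  generalize (∏ v, sg (x v * ((pattern L k hm α).vertexZ ω v + flowZ ω v))) = S2 at *
  generalize (∏ v, sg ((pattern L k hm α).x v ω * (pattern L k hm α).vertexZ ω v)) = S3 at *
  generalize (∏ l, ∏ y, sg (measBit (ω (.read (.inl (l, y)))) * dot y fun j => x (.inr (l, j)))) =
    M at *
  generalize (∏ l : Fin L, ∏ j, sg (x (.inr (l.castSucc, j)) * x (.inr (l.succ, j)))) = C1 at *
  generalize (∏ l : Fin L, ∏ j, sg (flow ω l.castSucc j * flow ω l.succ j)) = C4 at *
  generalize (∏ l, ∏ y, sg (x (.inl (l, y)) * dot y fun j => x (.inr (l, j)))) = G1 at *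
  generalize (∏ l : Fin L, ∏ _j : Fin n, ((Real.sqrt 2 : ℝ) : ℂ)⁻¹) = W at *
  generalize (ψ fun i => x (.inr (0, Fin.castLE hm i))) = q at *
  generalize (∏ l : Fin (L + 1), ∏ y, (1 + sg (measBit (ω (.read (.inl (l, y))))) *
    sg (x (.inl (l, y))) * Complex.exp (-(α l y * Complex.I))) / 2) = A at *
  linear_combination q * C1 * C4 * G1 * A * W * ((C2 * C2 * C3 * G2) * hZ +
    S3 * M * (C3 * C3 * G2 * G2 * h2 + G2 * G2 * h3 + h4))

/-- The measurement of a parity applies a phase to it. -/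
lemma sum_yz (μ Q : Fin 2) (θ : ℝ) :
    ∑ b : Fin 2, sg (b * Q) * sg (μ * Q) *
      ((1 + sg μ * sg b * Complex.exp (-(θ * Complex.I))) / 2) = ph θ Q := by
  rcases Fin.exists_fin_two.1 ⟨μ, rfl⟩ with rfl | rfl <;>
    rcases Fin.exists_fin_two.1 ⟨Q, rfl⟩ with rfl | rfl <;>
      simp [ph] <;> ring

/-- The amplitudes of a record add up to the matrix entries of the layered circuit. -/
lemma sum_coef (ψ : (Fin m → Fin 2) → ℂ) (s : Settings m n) :
    ∑ x, (pattern L k hm α).coef ω ψ x •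
        ∏ i, (MvPolynomial.X (.out (s.outTime i), x ((pattern L k hm α).outp i) +
          (pattern L k hm α).x ((pattern L k hm α).outp i) ω) : Fock) =
      signOf hm α ω •
        s.encode ((layers α L).mulVec fun z => ψ fun i => z (Fin.castLE hm i)) := by
  rw [← Equiv.sum_comp (Equiv.addRight fun v => (pattern L k hm α).x v ω)
    (fun x => (pattern L k hm α).coef ω ψ x •
        ∏ i, (MvPolynomial.X (.out (s.outTime i), x ((pattern L k hm α).outp i) +
          (pattern L k hm α).x ((pattern L k hm α).outp i) ω) : Fock))]
  simp only [Equiv.coe_addRight, coef_add, Pi.add_apply, add_add_self]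
  -- The bits of the parities and those of the qubits are summed separately, the former first.
  let e : ((Fin (L + 1) → (Fin n → Fin 2) → Fin 2) × (Fin (L + 1) → Fin n → Fin 2)) ≃
      (Vtx L n → Fin 2) :=
    (Equiv.prodCongr (Equiv.curry _ _ _).symm (Equiv.curry _ _ _).symm).trans
      (Equiv.sumArrowEquivProdArrow _ _ _).symm
  have he1 : ∀ g q l y, e (g, q) (.inl (l, y)) = g l y := fun _ _ _ _ => rfl
  have he2 : ∀ g q l j, e (g, q) (.inr (l, j)) = q l j := fun _ _ _ _ => rfl
  have he3 : ∀ g q i, e (g, q) ((pattern L k hm α).outp i) = q (Fin.last L) i := fun _ _ _ => rfl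
  rw [← Equiv.sum_comp e, Fintype.sum_prod_type_right]
  simp only [he1, he2, he3]
  have hsum : ∀ q : Fin (L + 1) → Fin n → Fin 2,
      ∑ g : Fin (L + 1) → (Fin n → Fin 2) → Fin 2, ∏ l : Fin (L + 1), ∏ y,
        sg (g l y * dot y (q l)) * sg (measBit (ω (.read (.inl (l, y)))) * dot y (q l)) *
        ((1 + sg (measBit (ω (.read (.inl (l, y))))) * sg (g l y) *
          Complex.exp (-(α l y * Complex.I))) / 2) =
      ∏ l : Fin (L + 1), ∏ y, ph (α l y) (dot y (q l)) := by
    intro q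
    rw [← Fintype.piFinset_univ, ← Finset.prod_univ_sum (fun _ => Finset.univ)
      (fun (l : Fin (L + 1)) (g : (Fin n → Fin 2) → Fin 2) => ∏ y,
        sg (g y * dot y (q l)) * sg (measBit (ω (.read (.inl (l, y)))) * dot y (q l)) *
        ((1 + sg (measBit (ω (.read (.inl (l, y))))) * sg (g y) *
          Complex.exp (-(α l y * Complex.I))) / 2))]
    refine Finset.prod_congr rfl fun l _ => ?_
    rw [← Fintype.piFinset_univ, ← Finset.prod_univ_sum (fun _ => Finset.univ)
      (fun (y : Fin n → Fin 2) (b : Fin 2) =>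
        sg (b * dot y (q l)) * sg (measBit (ω (.read (.inl (l, y)))) * dot y (q l)) *
        ((1 + sg (measBit (ω (.read (.inl (l, y))))) * sg b *
          Complex.exp (-(α l y * Complex.I))) / 2))]
    exact Finset.prod_congr rfl fun y _ => sum_yz _ _ _
  simp only [← Finset.sum_smul, ← Finset.mul_sum, ← Finset.sum_mul]
  simp only [hsum, mul_smul, ← Finset.smul_sum]
  congr 1
  rw [Settings.encode]
  simp only [layers_mulVec, map_sum, Finset.sum_mul]
  rw [Finset.sum_comm]
  refine Finset.sum_congr rfl fun q _ => ?_
  rw [Finset.sum_eq_single (q (Fin.last L)) (by intro z _ hz; simp [hz.symm]) (by simp), if_pos rfl,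
    ← MvPolynomial.smul_eq_C_mul]
  simp only [mul_smul]

end Coef

/-! ### Norms -/

/-- Photons in different modes form a normalised state. -/
lemma fockNormSq_smul_prod_X {ι : Type*} [Fintype ι] {f : ι → Mode} (hf : Function.Injective f)
    (c : ℂ) : fockNormSq (c • ∏ a, MvPolynomial.X (f a)) = ‖c‖ ^ 2 := by
  classical
  have h : c • ∏ a, (MvPolynomial.X (f a) : Fock) =
      MvPolynomial.monomial (∑ a, Finsupp.single (f a) 1) c := by
    rw [show ∏ a, (MvPolynomial.X (f a) : Fock) =
      ∏ a, MvPolynomial.monomial (Finsupp.single (f a) 1) 1 from rfl,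
      ← MvPolynomial.monomial_sum_one,
      MvPolynomial.smul_monomial, smul_eq_mul, mul_one]
  rw [h]
  by_cases hc : c = 0
  · simp [hc, fockNormSq]
  · rw [fockNormSq, MvPolynomial.support_monomial, if_neg hc, Finset.sum_singleton,
      MvPolynomial.coeff_monomial, if_pos rfl, Finset.prod_eq_one, one_mul]
    intro k _
    rw [Nat.cast_eq_one, Nat.factorial_eq_one, Finsupp.finsetSum_apply]
    simp only [Finsupp.single_apply]
    rw [← Finset.card_filter, Finset.card_le_one]
    intro a ha b hb
    exact hf ((Finset.mem_filter.1 ha).2.trans (Finset.mem_filter.1 hb).2.symm)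

/-! ### The successful records -/

lemma measBit_measOut (b : Fin 2) : measBit (measOut b) = b := by
  rcases Fin.exists_fin_two.1 ⟨b, rfl⟩ with rfl | rfl <;> simp [measBit, measOut, bitOf]

lemma measOut_injective : Function.Injective measOut := fun a b h => by
  rw [← measBit_measOut a, h, measBit_measOut]

lemma failOut_injective : Function.Injective failOut := by
  rintro ⟨a, b⟩ ⟨a', b'⟩ h
  fin_cases a <;> fin_cases b <;> fin_cases a' <;> fin_cases b' <;> simp_all [failOut]

lemma succOut_injective : Function.Injective succOut := by
  rintro ⟨a, b⟩ ⟨a', b'⟩ h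
  fin_cases a <;> fin_cases b <;> fin_cases a' <;> fin_cases b' <;> simp_all [succOut]

lemma sepOut_injective : Function.Injective sepOut := by
  rintro ⟨a, b⟩ ⟨a', b'⟩ h
  fin_cases a <;> fin_cases b <;> fin_cases a' <;> fin_cases b' <;> simp_all [sepOut]

namespace Plan

variable {V E : Type} [Fintype V] [DecidableEq V] [Fintype E] [DecidableEq E] {k m n : ℕ}
  (P : Plan V E k m n)

/-- The data that determine a successful record: for each edge the first successful attempt to
create it and the four equally likely outcomes of each attempt, and the bits that are observed at
the cuts and at the readouts. -/
abbrev Choices : Type := (E → Fin k) × (E → Fin k → Fin 2 × Fin 2) × (V → Fin 2) ×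
  ({v // ¬ ∃ i, P.outp i = v} → Fin 2)

/-- The record with the given data. -/
def record (q : P.Choices) : Task V E k → Outcome
  | .emit _ => noPhoton
  | .leg _ _ _ => noPhoton
  | .cut v => measOut (q.2.2.1 v)
  | .fuse e j => if j < q.1 e then failOut (q.2.1 e j) else
      if j = q.1 e then succOut (q.2.1 e j) else sepOut (q.2.1 e j)
  | .read v => if h : ∃ i, P.outp i = v then noPhoton else measOut (q.2.2.2 ⟨v, h⟩)

variable {P}

lemma success_of_lt {q : P.Choices} {e : E} {j : Fin k} (h : j < q.1 e) :
    (P.record q (.fuse e j)).success = false := by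
  simp [record, h, success_failOut]

lemma success_first (q : P.Choices) (e : E) : (P.record q (.fuse e (q.1 e))).success = true := by
  simp [record, success_succOut]

lemma fused_record (q : P.Choices) (e : E) (j : Fin k) :
    fused (P.record q) e j = decide (q.1 e < j) := by
  rw [fused, decide_eq_decide]
  constructor
  · rintro ⟨j', hj', hs⟩
    refine lt_of_le_of_lt (not_lt.1 fun h => ?_) hj'
    rw [success_of_lt h] at hs
    exact absurd hs (by simp)
  · exact fun h => ⟨_, h, success_first q e⟩

lemma firstSuccess_record (q : P.Choices) : FirstSuccess (P.record q) q.1 := by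
  intro e j
  rw [fused_record]
  rcases lt_trichotomy j (q.1 e) with h | h | h
  · simp [success_of_lt h, h.ne]
  · subst h
    simp [success_first]
  · simp [h, h.ne']

lemma valid_record (q : P.Choices) : P.Valid (P.record q) where
  emit _ := rfl
  leg _ _ _ := rfl
  cut v := by simp only [record, measBit_measOut]
  fuse e j b₀ b₁ := by
    rw [fused_record]
    rcases lt_trichotomy j (q.1 e) with h | h | h
    · simp only [record, if_pos h, decide_eq_false h.not_gt]
      exact detectAll_rus_fail _ _ _
    · simp only [record, if_neg h.not_lt, if_pos h, decide_eq_false h.not_gt]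
      exact detectAll_rus_succ _ _ _
    · simp only [record, if_neg h.not_gt, if_neg h.ne', decide_eq_true h]
      exact detectAll_rus_sep _ _ _
  read_out v h := by simp only [record, dif_pos ((P.readout_eq_out v).1 h)]
  read v h := by
    simp only [record, dif_neg fun h' => h ((P.readout_eq_out v).2 h'), measBit_measOut]

lemma record_injective : Function.Injective P.record := by
  intro q q' h
  have hJ : q.1 = q'.1 := by
    ext1 e
    rcases lt_trichotomy (q.1 e) (q'.1 e) with h' | h' | h'
    · have h1 := success_first q e
      rw [h, success_of_lt h'] at h1
      exact absurd h1 (by simp)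
    · exact h'
    · have h1 := success_first q' e
      rw [← h, success_of_lt h'] at h1
      exact absurd h1 (by simp)
  refine Prod.ext hJ (Prod.ext ?_ (Prod.ext ?_ ?_))
  · ext1 e
    ext1 j
    have h1 := congrFun h (.fuse e j)
    simp only [record, hJ] at h1
    split_ifs at h1
    · exact failOut_injective h1
    · exact succOut_injective h1
    · exact sepOut_injective h1
  · ext1 v
    exact measOut_injective (congrFun h (.cut v))
  · ext1 v
    have h1 := congrFun h (.read v)
    simp only [record, dif_neg v.2] at h1
    exact measOut_injective h1

lemma hist_record_injective : Function.Injective fun q => hist (P.record q) P.prog := by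
  intro q q' h
  refine record_injective (funext fun a => ?_)
  have h1 := List.map_inj_left.1 (List.reverse_injective h)
  exact h1 a (P.mem_prog a)

lemma norm_scale_record (q : P.Choices) : ‖P.scale (P.record q)‖ ^ 2 =
    (1 / 2) ^ (Fintype.card V - m) * (1 / 2) ^ Fintype.card V *
      ∏ e, ∏ j, if j ≤ q.1 e then (1 / 8 : ℝ) else 1 / 4 := by
  have hs : ‖((Real.sqrt 2 : ℝ) : ℂ)⁻¹‖ ^ 2 = 1 / 2 := by
    rw [norm_inv, inv_pow, Complex.norm_real, Real.norm_eq_abs, sq_abs, Real.sq_sqrt (by norm_num)]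
    norm_num
  have hf : ∀ e j, ‖fuseScale (fused (P.record q) e j) (P.record q (.fuse e j))‖ ^ 2 =
      if j ≤ q.1 e then (1 / 8 : ℝ) else 1 / 4 := by
    intro e j
    rw [fused_record]
    rcases lt_trichotomy j (q.1 e) with h | h | h
    · simp only [record, if_pos h, decide_eq_false h.not_gt, if_pos h.le, norm_fuseScale_fail]
    · simp only [record, if_neg h.not_lt, if_pos h, decide_eq_false h.not_gt, if_pos h.le,
        norm_fuseScale_succ]
    · simp only [record, if_neg h.not_gt, if_neg h.ne', decide_eq_true h, if_neg h.not_ge,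
        norm_fuseScale_sep]
  simp only [scale, norm_mul, norm_pow, norm_prod, mul_pow, ← Finset.prod_pow, hf]
  simp only [← pow_mul, mul_comm _ 2]
  simp only [pow_mul, hs]

/-- The probability that one of `k` attempts, each with probability `1 / 2`, succeeds. -/
lemma sum_first_success (k : ℕ) :
    ∑ J : Fin k, ∏ j : Fin k, 4 * (if j ≤ J then (1 / 8 : ℝ) else 1 / 4) = 1 - (1 / 2) ^ k := by
  have h : ∀ J : Fin k, ∏ j : Fin k, 4 * (if j ≤ J then (1 / 8 : ℝ) else 1 / 4) =
      (1 / 2) ^ (J.val + 1) := by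
    intro J
    have h1 : ∀ j : Fin k, 4 * (if j ≤ J then (1 / 8 : ℝ) else 1 / 4) =
        if j ∈ Finset.Iic J then 1 / 2 else 1 := by
      intro j
      simp only [Finset.mem_Iic]
      split_ifs <;> norm_num
    simp only [h1]
    rw [Finset.prod_ite_mem, Finset.univ_inter, Finset.prod_const, Fin.card_Iic]
  simp only [h]
  clear h
  rw [Fin.sum_univ_eq_sum_range fun i => (1 / 2 : ℝ) ^ (i + 1)]
  induction k with
  | zero => simp
  | succ k ih =>
    rw [Finset.sum_range_succ, ih]
    ring

lemma card_outp (P : Plan V E k m n) :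
    Fintype.card {v // ¬ ∃ i, P.outp i = v} = Fintype.card V - n := by
  have h : (Finset.univ.filter fun v => ¬ ∃ i, P.outp i = v) = (Finset.univ.image P.outp)ᶜ := by
    ext v; simp
  rw [Fintype.card_subtype, h, Finset.card_compl,
    Finset.card_image_of_injective _ P.outp_injective, Finset.card_univ, Fintype.card_fin]

/-- The total probability of the successful records, up to the normalisation of the outputs. -/
lemma sum_norm_scale (hm : m ≤ n) :
    ∑ q : P.Choices, ‖P.scale (P.record q)‖ ^ 2 * 2 ^ (n - m) =
      (1 - (1 / 2) ^ k) ^ Fintype.card E := by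
  have hn : n ≤ Fintype.card V := by
    simpa using Fintype.card_le_of_injective _ P.outp_injective
  have hc : (1 / 2 : ℝ) ^ (Fintype.card V - m) * 2 ^ (n - m) = (1 / 2) ^ (Fintype.card V - n) := by
    rw [show Fintype.card V - m = (Fintype.card V - n) + (n - m) by omega, pow_add, mul_assoc,
      ← mul_pow]
    norm_num
  have h2 : ∀ N : ℕ, (2 : ℝ) ^ N * (1 / 2) ^ N = 1 := fun N => by rw [← mul_pow]; norm_num
  have hterm : ∀ J : E → Fin k, ((4 : ℝ) ^ k) ^ Fintype.card E * (2 ^ Fintype.card V *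
      (2 ^ (Fintype.card V - n) * ((1 / 2) ^ (Fintype.card V - m) * (1 / 2) ^ Fintype.card V *
      (∏ e, ∏ j, if j ≤ J e then (1 / 8 : ℝ) else 1 / 4) * 2 ^ (n - m)))) =
      ∏ e, ∏ j, 4 * if j ≤ J e then (1 / 8 : ℝ) else 1 / 4 := by
    intro J
    simp only [Finset.prod_mul_distrib, Finset.prod_const, Finset.card_univ, Fintype.card_fin]
    linear_combination (((4 : ℝ) ^ k) ^ Fintype.card E *
      (∏ e, ∏ j, if j ≤ J e then (1 / 8 : ℝ) else 1 / 4)) *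
      (2 ^ Fintype.card V * 2 ^ (Fintype.card V - n) * (1 / 2) ^ Fintype.card V * hc +
        h2 (Fintype.card V - n) * (2 ^ Fintype.card V * (1 / 2) ^ Fintype.card V) +
        h2 (Fintype.card V))
  have hsum : ∀ F : (E → Fin k) → ℝ, ∑ q : P.Choices, F q.1 = ((4 : ℝ) ^ k) ^ Fintype.card E *
      (2 ^ Fintype.card V * (2 ^ (Fintype.card V - n) * ∑ J, F J)) := by
    intro F
    simp only [Fintype.sum_prod_type, Finset.sum_const, Finset.card_univ, nsmul_eq_mul,
      Fintype.card_fun, Fintype.card_prod, Fintype.card_fin, card_outp,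
      ← Finset.mul_sum]
    norm_num
    ring
  simp only [norm_scale_record]
  rw [hsum fun J => (1 / 2) ^ (Fintype.card V - m) * (1 / 2) ^ Fintype.card V *
    (∏ e, ∏ j, if j ≤ J e then (1 / 8 : ℝ) else 1 / 4) * 2 ^ (n - m)]
  simp only [Finset.mul_sum, hterm]
  rw [← sum_first_success, ← Finset.card_univ, ← Finset.prod_const, Finset.prod_univ_sum,
    Fintype.piFinset_univ]

/-! ### Implementation of a layered circuit -/

lemma discarded_mem (b : Fin 2) :
    P.discarded b ∈ MvPolynomial.supported ℂ {k : Mode | ∀ t, k.1 ≠ .out t} :=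
  prod_mem fun a _ => MvPolynomial.X_mem_supported.2 (by simp)

lemma fockNormSq_discarded (b : Fin 2) (c : ℂ) : fockNormSq (c • P.discarded b) = ‖c‖ ^ 2 := by
  refine fockNormSq_smul_prod_X (f := fun a => (.lost (P.idx (discards a)) 0, b)) ?_ c
  intro a a' h
  exact discards_injective (P.idx_injective (by simpa using h))

end Plan

lemma fockNormSq_zero : fockNormSq 0 = 0 := by simp [fockNormSq]

lemma encode_smul {m n : ℕ} (s : Settings m n) (c : ℂ) (φ : (Fin n → Fin 2) → ℂ) :
    s.encode (c • φ) = c • s.encode φ := by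
  simp [Settings.encode, Finset.smul_sum, MvPolynomial.smul_eq_C_mul, mul_assoc]

/-- A layered circuit that acts as `A` on inputs in which the remaining qubits are in the state
`|+⟩`, up to normalisation. -/
lemma implements_of_layers {L n k m : ℕ} (hk : k % 4 = 1) (hm : m ≤ n)
    (α : ℕ → (Fin n → Fin 2) → ℝ) (A : Matrix (Fin n → Fin 2) (Fin m → Fin 2) ℂ) (γ : ℂ)
    (hγ : ‖γ‖ ^ 2 = 2 ^ (n - m))
    (hA : ∀ ψ, (layers α L).mulVec (fun z => ψ fun i => z (Fin.castLE hm i)) = γ • A.mulVec ψ)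
    {p : ℝ} (hp : p < (1 - (1 / 2) ^ k) ^ Fintype.card (Edg L n)) :
    (pattern L k hm α).settings.Implements A p := by
  set P := pattern L k hm α with hP
  let R : P.Choices → State m := fun q b r =>
    if b = Plan.lastCut (P.record q) P.vlist ∧ r = fun i => P.prevCut (P.record q) (P.inp i) then
      (P.scale (P.record q) * signOf hm α (P.record q) * γ) • P.discarded b else 0
  have hR : Function.Injective fun q => hist (P.record q) P.prog := P.hist_record_injective
  -- The remaining state is given as a function of the data of the record, which the record
  -- determines.
  refine ⟨Finset.univ.image fun q => hist (P.record q) P.prog,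
    Function.extend (fun q => hist (P.record q) P.prog) R 0, ?_, ?_⟩
  · intro h hh
    obtain ⟨q, -, rfl⟩ := Finset.mem_image.1 hh
    rw [hR.extend_apply]
    refine ⟨Plan.length_hist _ _, ?_, ?_⟩
    · intro b r
      have hmem : R q b r ∈ MvPolynomial.supported ℂ {k : Mode | ∀ t, k.1 ≠ .out t} := by
        simp only [R]
        split_ifs
        · exact Subalgebra.smul_mem _ (P.discarded_mem b) _
        · exact zero_mem _
      exact fun k hk => MvPolynomial.mem_supported.1 hmem hk
    · intro ψ b r
      rw [P.run_prog hk (P.valid_record q) (P.firstSuccess_record q), sum_coef, hA, encode_smul]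
      simp only [R]
      split_ifs
      · simp only [smul_mul_assoc, mul_smul_comm, smul_smul]
        congr 1
        ring
      · simp
  · rw [Finset.sum_image hR.injOn]
    simp only [hR.extend_apply]
    have hnorm : ∀ q, ∑ b, ∑ r, fockNormSq (R q b r) =
        ‖P.scale (P.record q)‖ ^ 2 * 2 ^ (n - m) := by
      intro q
      rw [Finset.sum_eq_single (Plan.lastCut (P.record q) P.vlist) (fun b _ hb => by
        simp [R, hb, fockNormSq_zero]) (by simp),
        Finset.sum_eq_single (fun i => P.prevCut (P.record q) (P.inp i)) (fun r _ hr => by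
        simp [R, hr, fockNormSq_zero]) (by simp)]
      simp only [R, and_self, if_true]
      rw [P.fockNormSq_discarded, norm_mul, norm_mul, mul_pow, mul_pow, hγ, norm_signOf]
      ring
    simp only [hnorm]
    refine hp.trans_eq ?_
    convert (P.sum_norm_scale hm).symm

/-- The number of attempts can be chosen such that all edges are created with a probability as close
to one as desired. -/
lemma exists_attempts (N : ℕ) {ε : ℝ} (hε : 0 < ε) :
    ∃ k : ℕ, k % 4 = 1 ∧ 1 - ε < (1 - (1 / 2 : ℝ) ^ k) ^ N := by
  obtain ⟨q, hq⟩ := exists_pow_lt_of_lt_one (div_pos hε (Nat.cast_add_one_pos (α := ℝ) N))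
    (show (1 / 2 : ℝ) < 1 by norm_num)
  -- Bernoulli's inequality reduces the claim to `N * 2⁻ᵏ < ε`.
  refine ⟨4 * q + 1, by omega, ?_⟩
  have hle : (1 / 2 : ℝ) ^ (4 * q + 1) ≤ (1 / 2) ^ q :=
    pow_le_pow_of_le_one (by norm_num) (by norm_num) (by omega)
  have hpos : (0 : ℝ) < (1 / 2) ^ (4 * q + 1) := by positivity
  have hle1 : (1 / 2 : ℝ) ^ (4 * q + 1) ≤ 1 := pow_le_one₀ (by norm_num) (by norm_num)
  have h1 := one_add_mul_le_pow (a := -(1 / 2 : ℝ) ^ (4 * q + 1)) (by linarith) N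
  rw [lt_div_iff₀ (Nat.cast_add_one_pos N)] at hq
  have h2 : (N : ℝ) * (1 / 2) ^ (4 * q + 1) ≤ N * (1 / 2) ^ q :=
    mul_le_mul_of_nonneg_left hle (Nat.cast_nonneg N)
  have h3 : (0 : ℝ) < (1 / 2) ^ q := by positivity
  calc 1 - ε < 1 + N * -(1 / 2 : ℝ) ^ (4 * q + 1) := by nlinarith
    _ ≤ (1 + -(1 / 2 : ℝ) ^ (4 * q + 1)) ^ N := h1
    _ = _ := by rw [← sub_eq_add_neg]

/-- The state `|+⟩⋯|+⟩` is the result of Hadamard gates on `|0⟩⋯|0⟩`. -/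
lemma hadN_mulVec_one (n : ℕ) :
    (hadN n).mulVec (fun _ => 1) = ((Real.sqrt 2 : ℝ) : ℂ) ^ n • Pi.single 0 1 := by
  have h : (fun _ => 1) = ((Real.sqrt 2 : ℝ) : ℂ) ^ n • (hadN n).mulVec (Pi.single 0 1) := by
    ext1 x
    rw [Matrix.mulVec_single_one, Pi.smul_apply, Matrix.col_apply, hadN_apply]
    simp [dot]
  rw [h, Matrix.mulVec_smul, Matrix.mulVec_mulVec, hadN_mul_hadN, Matrix.one_mulVec]

end SpinOptical

end

theorem mainTheorem5 (n : ℕ) (U : Matrix.unitaryGroup (Fin n → Fin 2) ℂ) (ε : ℝ) (hε : 0 < ε) :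
    (∃ s : SpinOptical.Settings n n, s.Implements U.1 (1 - ε)) ∧
    (∃ s : SpinOptical.Settings 0 n,
      s.Implements (Matrix.of fun y _ => U.1 y (fun _ => 0)) (1 - ε)) := by
  open SpinOptical in
  have hU : U.1.conjTranspose * U.1 = 1 := Matrix.mem_unitaryGroup_iff'.1 U.2
  constructor
  · obtain ⟨L, α, c, hc, h⟩ := (Gen.of_unitary U.1 hU).exists_layers
    have hc0 : c ≠ 0 := fun e => by simp [e] at hc
    obtain ⟨k, hk, hp⟩ := exists_attempts (Fintype.card (Edg L n)) hε
    refine ⟨_, implements_of_layers hk le_rfl α U.1 c⁻¹ (by simp [hc]) (fun ψ => ?_) hp⟩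
    rw [h, Matrix.smul_mulVec, smul_smul, inv_mul_cancel₀ hc0, one_smul]
    rfl
  · -- The unitary `U 𝐇` maps the state `|+⟩⋯|+⟩`, in which the vertices are prepared, to `U|0⋯0⟩`.
    have hUH : (U.1 * hadN n).conjTranspose * (U.1 * hadN n) = 1 := by
      rw [Matrix.conjTranspose_mul, Matrix.mul_assoc, ← Matrix.mul_assoc _ U.1, hU, Matrix.one_mul,
        hadN_conjTranspose, hadN_mul_hadN]
    obtain ⟨L, α, c, hc, h⟩ := (Gen.of_unitary _ hUH).exists_layers
    have hc0 : c ≠ 0 := fun e => by simp [e] at hc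
    obtain ⟨k, hk, hp⟩ := exists_attempts (Fintype.card (Edg L n)) hε
    refine ⟨_, implements_of_layers hk (Nat.zero_le n) α _ (c⁻¹ * ((Real.sqrt 2 : ℝ) : ℂ) ^ n)
      ?_ (fun ψ => ?_) hp⟩
    · rw [norm_mul, norm_inv, hc, norm_pow, Complex.norm_real, Real.norm_eq_abs, inv_one, one_mul,
        ← pow_mul, mul_comm, pow_mul, sq_abs, Real.sq_sqrt (by norm_num), Nat.sub_zero]
    · have hψ : (fun z : Fin n → Fin 2 => ψ fun i => z (Fin.castLE (Nat.zero_le n) i)) =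
          ψ 0 • fun _ => 1 := by
        ext1 z
        rw [Pi.smul_apply, smul_eq_mul, mul_one]
        congr 1
        exact Subsingleton.elim _ _
      have hl : layers α L = c⁻¹ • (U.1 * hadN n) := by
        rw [h, smul_smul, inv_mul_cancel₀ hc0, one_smul]
      rw [hψ, hl, Matrix.mulVec_smul, Matrix.smul_mulVec, ← Matrix.mulVec_mulVec,
        hadN_mulVec_one, Matrix.mulVec_smul, Matrix.mulVec_single_one]
      ext1 y
      have hy : (Matrix.of fun y (_ : Fin 0 → Fin 2) => U.1 y fun _ => 0).mulVec ψ y =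
          U.1 y 0 * ψ 0 := by
        rw [Matrix.mulVec, dotProduct, Fintype.sum_unique]
        exact congrArg (U.1 y 0 * ψ ·) (Subsingleton.elim _ _)
      rw [Pi.smul_apply (c⁻¹ * _), hy]
      simp only [Pi.smul_apply, smul_eq_mul, Matrix.col_apply]
      ring
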